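/- Theorem 6.1 (density of the limiting spectral distribution for identity covariance). Let $c\in(0,\infty)$. For each $n\ge 1$ let $p=p(n)$ with $p/n\to c$, and let $Z_1=Z_1^{(n)},Z_2=Z_2^{(n)}$ be random $p\times n$ complex matrices whose entries $z_{ij}^{(k)}$ ($k=1,2$) are, for each $n$, all independent with $\mathbb{E}z_{ij}^{(k)}=0$ and $\mathbb{E}|z_{ij}^{(k)}|^2=1$, and such that $\sup_{n,k,i,j}\mathbb{E}|z_{ij}^{(k)}|^{2+\eta_0}<\infty$ for some $\eta_0>0$. Put $S_n=\frac1n(Z_1Z_2^*-Z_2Z_1^*)$, a skew-Hermitian matrix with eigenvalues $\mathrm{i}\lambda_1,\dots,\mathrm{i}\lambda_p$, and identify distributions on $\mathrm{i}\mathbb{R}$ with distributions on $\mathbb{R}$ via $\mathrm{i}t\leftrightarrow t$, so that the empirical spectral distribution of $S_n$ is $\frac1p\sum_{j}\delta_{\lambda_j}$. Then there is a probability distribution on $\mathbb{R}$, depending only on $c$, to which the empirical spectral distribution of $S_n$ converges weakly almost surely, for every such choice of $p(n),Z_1,Z_2$. Its distribution function $F_c$ has the following properties. Define $$r_1=-\frac{c+1}{3c^3},\quad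 r_3=-\frac{(c-2)^3}{27c^3},\quad d_0=\frac1{27c^6},\quad d_2=\frac{2c^2+10c-1}{27c^6},\quad d_4=\frac{(c-2)^3}{27c^5},$$ $$R(z)=\frac{r_1}{z}+\frac{r_3}{z^3}\ (z\in\mathbb{C}\setminus\{0\}),\qquad R_\pm=\frac{d_2\pm\sqrt{d_2^2-4d_0d_4}}{2d_0},$$ $$L_c=\sqrt{R_-\mathbf{1}_{\{R_->0\}}},\qquad U_c=\sqrt{R_+},\qquad S_c=(-U_c,-L_c)\cup(L_c,U_c),$$ and for real $x\ne0$ $$r(x)=\lim_{\epsilon\downarrow0}R(-\epsilon+\mathrm{i}x),\qquad d(x)=d_0-\frac{d_2}{x^2}+\frac{d_4}{x^4},\qquad V_\pm(x)=|r(x)|\pm\sqrt{-d(x)}\ \text{ (for } x\in S_c).$$ (a) $F_c$ is differentiable at every $x\neq0$, with derivative $$f_c(x)=\frac{\sqrt3}{2\pi}\Big(V_+(x)^{1/3}-V_-(x)^{1/3}\Big)\mathbf{1}_{\{x\in S_c\}}.$$ (b) $F_c$ is differentiable at $x=0$ if and only if $0<c<2$, and in that case $f_c(0)=F_c'(0)=\dfrac{1}{\pi\sqrt{2c-c^2}}$.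 (c) The density $f_c=F_c'$ is continuous at every point where it exists. -/

import Mathlib

open MeasureTheory ProbabilityTheory Filter Topology
open scoped NNReal ENNReal BoundedContinuousFunction

noncomputable section

namespace CommutatorLSD

/-! ### The random matrix model -/

/-- The sample commutator matrix `n⁻¹ (X₁ X₂ᴴ - X₂ X₁ᴴ)` of two `p × n` data matrices. -/
def sampleCommutator {p n : ℕ} (X₁ X₂ : Matrix (Fin p) (Fin n) ℂ) : Matrix (Fin p) (Fin p) ℂ :=
  (n : ℂ)⁻¹ • (X₁ * X₂.conjTranspose - X₂ * X₁.conjTranspose)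

theorem sampleCommutator_conjTranspose {p n : ℕ} (X₁ X₂ : Matrix (Fin p) (Fin n) ℂ) :
    (sampleCommutator X₁ X₂).conjTranspose = -sampleCommutator X₁ X₂ := by
  simp [sampleCommutator, Matrix.conjTranspose_smul, Matrix.conjTranspose_sub,
    Matrix.conjTranspose_mul, ← smul_neg]

theorem isHermitian_neg_I_smul {p : ℕ} {S : Matrix (Fin p) (Fin p) ℂ}
    (hS : S.conjTranspose = -S) : ((-Complex.I) • S).IsHermitian := by
  simp [Matrix.IsHermitian, Matrix.conjTranspose_smul, hS]

/-- The empirical spectral distribution of a skew-Hermitian matrix `S` whose eigenvalues are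
`i λ₁, …, i λ_p`. Distributions on the imaginary axis are identified with distributions on `ℝ`
through `i t ↔ t`, so this is `p⁻¹ ∑ⱼ δ_{λⱼ}`, where the `λⱼ` are the eigenvalues (with
multiplicity) of the Hermitian matrix `-i S`. -/
def skewESD {p : ℕ} (S : Matrix (Fin p) (Fin p) ℂ) (hS : S.conjTranspose = -S) : Measure ℝ :=
  (p : ℝ≥0∞)⁻¹ • ∑ j : Fin p, Measure.dirac ((isHermitian_neg_I_smul hS).eigenvalues j)

/-- Weak convergence (convergence in distribution) of a sequence of measures on `ℝ`. -/
def WeaklyTendsto (μ : ℕ → Measure ℝ) (ν : Measure ℝ) : Prop :=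
  ∀ f : ℝ →ᵇ ℝ, Tendsto (fun n => ∫ x, f x ∂(μ n)) atTop (𝓝 (∫ x, f x ∂ν))

/-- The assumptions on the innovations: for every `n` there are two random `p n × n` complex
matrices `Z n 0`, `Z n 1`, all of whose entries together are independent, with zero mean, unit
variance, and absolute moments of some order `2 + η > 2` that are bounded uniformly in all
indices. Nothing is assumed about the joint law for different values of `n`. -/
structure IsInnovationArray {Ω : Type*} [MeasurableSpace Ω] (P : Measure Ω) (p : ℕ → ℕ)
    (Z : (n : ℕ) → Fin 2 → Ω → Matrix (Fin (p n)) (Fin n) ℂ) : Prop where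
  measurable_entry : ∀ n k i j, Measurable fun ω => Z n k ω i j
  indep : ∀ n, iIndepFun
    (fun (e : Fin 2 × Fin (p n) × Fin n) (ω : Ω) => Z n e.1 ω e.2.1 e.2.2) P
  mean_zero : ∀ n k i j, ∫ ω, Z n k ω i j ∂P = 0
  variance_one : ∀ n k i j, ∫ ω, ‖Z n k ω i j‖ ^ 2 ∂P = 1
  moment_bound : ∃ η : ℝ, 0 < η ∧ ∃ M : ℝ≥0, ∀ n k i j,
    ∫⁻ ω, ‖Z n k ω i j‖ₑ ^ (2 + η) ∂P ≤ M

/-- `F` is the limiting spectral distribution of the commutator matrices with identity covariance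
for the array `Z`: almost surely the empirical spectral distributions of
`n⁻¹ (Z₁ Z₂ᴴ - Z₂ Z₁ᴴ)` converge weakly to `F`. -/
def IsLSD {Ω : Type*} [MeasurableSpace Ω] (P : Measure Ω) (p : ℕ → ℕ)
    (Z : (n : ℕ) → Fin 2 → Ω → Matrix (Fin (p n)) (Fin n) ℂ) (F : Measure ℝ) : Prop :=
  ∀ᵐ ω ∂P, WeaklyTendsto
    (fun n => skewESD (sampleCommutator (Z n 0 ω) (Z n 1 ω))
      (sampleCommutator_conjTranspose (Z n 0 ω) (Z n 1 ω))) F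

/-! ### The explicit parameters of the density -/

def r₁ (c : ℝ) : ℝ := -(c + 1) / (3 * c ^ 3)
def r₃ (c : ℝ) : ℝ := -(c - 2) ^ 3 / (27 * c ^ 3)
def d₀ (c : ℝ) : ℝ := 1 / (27 * c ^ 6)
def d₂ (c : ℝ) : ℝ := (2 * c ^ 2 + 10 * c - 1) / (27 * c ^ 6)
def d₄ (c : ℝ) : ℝ := (c - 2) ^ 3 / (27 * c ^ 5)

/-- `R(z) = r₁ / z + r₃ / z³` for complex `z ≠ 0`. -/
def R (c : ℝ) (z : ℂ) : ℂ := (r₁ c : ℂ) / z + (r₃ c : ℂ) / z ^ 3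

/-- `r(x)` for real `x ≠ 0`: the limit of `R(-ε + i x)` as `ε ↓ 0`, which is `R(i x)`
(see `tendsto_R`). -/
def r (c x : ℝ) : ℂ := R c (Complex.I * x)

theorem tendsto_R (c : ℝ) {x : ℝ} (hx : x ≠ 0) :
    Tendsto (fun ε : ℝ => R c (-(ε : ℂ) + Complex.I * x)) (𝓝[>] 0) (𝓝 (r c x)) := by
  have hne : (-((0 : ℝ) : ℂ) + Complex.I * x) ≠ 0 := by simp [hx]
  have hcont : ContinuousAt (fun ε : ℝ => R c (-(ε : ℂ) + Complex.I * x)) 0 := by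
    unfold R
    refine ContinuousAt.add (ContinuousAt.div (by fun_prop) (by fun_prop) hne)
      (ContinuousAt.div (by fun_prop) (by fun_prop) (pow_ne_zero 3 hne))
  have h := hcont.tendsto.mono_left (nhdsWithin_le_nhds (s := Set.Ioi (0 : ℝ)))
  simpa [r] using h

/-- `d(x) = d₀ - d₂ / x² + d₄ / x⁴` for real `x ≠ 0`. -/
def d (c x : ℝ) : ℝ := d₀ c - d₂ c / x ^ 2 + d₄ c / x ^ 4

def Rplus (c : ℝ) : ℝ := (d₂ c + √(d₂ c ^ 2 - 4 * d₀ c * d₄ c)) / (2 * d₀ c)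
def Rminus (c : ℝ) : ℝ := (d₂ c - √(d₂ c ^ 2 - 4 * d₀ c * d₄ c)) / (2 * d₀ c)

/-- `L_c`: the square root of `R₋` if `R₋ > 0`, and `0` otherwise. -/
def L (c : ℝ) : ℝ := √(if 0 < Rminus c then Rminus c else 0)

def U (c : ℝ) : ℝ := √(Rplus c)

/-- `S_c = (-U_c, -L_c) ∪ (L_c, U_c)`. -/
def S (c : ℝ) : Set ℝ := Set.Ioo (-U c) (-L c) ∪ Set.Ioo (L c) (U c)

def Vplus (c x : ℝ) : ℝ := ‖r c x‖ + √(-d c x)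
def Vminus (c x : ℝ) : ℝ := ‖r c x‖ - √(-d c x)

/-- The density `f_c(x) = (√3 / (2π)) (V₊(x)^{1/3} - V₋(x)^{1/3}) 1_{x ∈ S_c}` off the origin. -/
def density (c : ℝ) : ℝ → ℝ :=
  (S c).indicator fun x =>
    √3 / (2 * Real.pi) * (Vplus c x ^ (1 / 3 : ℝ) - Vminus c x ^ (1 / 3 : ℝ))

end CommutatorLSD

end

noncomputable section

namespace CommutatorLSD

/-! ### The Stieltjes transform -/

/-- The Stieltjes transform `z ↦ ∫ (x - z)⁻¹ dμ(x)` of a measure on the real line. -/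
def stieltjes (μ : Measure ℝ) (z : ℂ) : ℂ := ∫ x : ℝ, ((x : ℂ) - z)⁻¹ ∂μ

theorem ofReal_sub_ne_zero {z : ℂ} (hz : 0 < z.im) (x : ℝ) : (x : ℂ) - z ≠ 0 := fun h => by
  have := congrArg Complex.im h
  simp at this
  linarith

theorem norm_inv_ofReal_sub_le {z : ℂ} (hz : 0 < z.im) (x : ℝ) :
    ‖((x : ℂ) - z)⁻¹‖ ≤ z.im⁻¹ := by
  rw [norm_inv]
  refine inv_anti₀ hz ?_
  calc z.im = |((x : ℂ) - z).im| := by simp [abs_of_pos hz]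
    _ ≤ _ := Complex.abs_im_le_norm _

theorem continuous_inv_ofReal_sub {z : ℂ} (hz : 0 < z.im) :
    Continuous fun x : ℝ => ((x : ℂ) - z)⁻¹ :=
  Continuous.inv₀ (by fun_prop) (ofReal_sub_ne_zero hz)

theorem integrable_inv_ofReal_sub (μ : Measure ℝ) [IsFiniteMeasure μ] {z : ℂ} (hz : 0 < z.im) :
    Integrable (fun x : ℝ => ((x : ℂ) - z)⁻¹) μ :=
  Integrable.of_bound (continuous_inv_ofReal_sub hz).aestronglyMeasurable z.im⁻¹
    (ae_of_all _ (norm_inv_ofReal_sub_le hz))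

theorem norm_stieltjes_le (μ : Measure ℝ) [IsProbabilityMeasure μ] {z : ℂ} (hz : 0 < z.im) :
    ‖stieltjes μ z‖ ≤ z.im⁻¹ := by
  simpa [stieltjes] using norm_integral_le_of_norm_le_const (μ := μ)
    (ae_of_all _ (norm_inv_ofReal_sub_le hz))

theorem tendsto_stieltjes {μ : ℕ → ProbabilityMeasure ℝ} {ν : ProbabilityMeasure ℝ}
    (h : Tendsto μ atTop (𝓝 ν)) {z : ℂ} (hz : 0 < z.im) :
    Tendsto (fun n => stieltjes (μ n) z) atTop (𝓝 (stieltjes ν z)) := by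
  rw [ProbabilityMeasure.tendsto_iff_forall_integral_rclike_tendsto ℂ] at h
  exact h (BoundedContinuousFunction.ofNormedAddCommGroup _ (continuous_inv_ofReal_sub hz) z.im⁻¹
    (norm_inv_ofReal_sub_le hz))

theorem im_inv_ofReal_sub (x : ℝ) (z : ℂ) :
    (((x : ℂ) - z)⁻¹).im = z.im / ((x - z.re) ^ 2 + z.im ^ 2) := by
  rw [Complex.inv_im, Complex.normSq_apply]
  simp
  ring

theorem stieltjes_im (μ : Measure ℝ) [IsFiniteMeasure μ] {z : ℂ} (hz : 0 < z.im) :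
    (stieltjes μ z).im = ∫ x : ℝ, z.im / ((x - z.re) ^ 2 + z.im ^ 2) ∂μ := by
  have h := integral_im (𝕜 := ℂ) (integrable_inv_ofReal_sub μ hz)
  simp only [RCLike.im_to_complex] at h
  rw [stieltjes, ← h]
  simp_rw [im_inv_ofReal_sub]

theorem integrable_poisson (μ : Measure ℝ) [IsFiniteMeasure μ] {z : ℂ} (hz : 0 < z.im) :
    Integrable (fun x : ℝ => z.im / ((x - z.re) ^ 2 + z.im ^ 2)) μ := by
  have h := (integrable_inv_ofReal_sub μ hz).im
  simpa only [RCLike.im_to_complex, im_inv_ofReal_sub] using h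

theorem stieltjes_im_pos (μ : Measure ℝ) [IsProbabilityMeasure μ] {z : ℂ} (hz : 0 < z.im) :
    0 < (stieltjes μ z).im := by
  rw [stieltjes_im μ hz]
  have hpos : ∀ x : ℝ, 0 < z.im / ((x - z.re) ^ 2 + z.im ^ 2) := fun x => by positivity
  rw [integral_pos_iff_support_of_nonneg (fun x => (hpos x).le) (integrable_poisson μ hz)]
  have : Function.support (fun x : ℝ => z.im / ((x - z.re) ^ 2 + z.im ^ 2)) = Set.univ :=
    Set.eq_univ_of_forall fun x => (hpos x).ne'
  simp [this]

theorem differentiableAt_stieltjes (μ : Measure ℝ) [IsFiniteMeasure μ] {z : ℂ} (hz : 0 < z.im) :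
    DifferentiableAt ℂ (stieltjes μ) z := by
  have h := hasDerivAt_resolventTransform (𝕜 := ℝ) (A := ℂ) (μ := μ) z (by
    rintro ⟨x, -, hx⟩
    rw [← hx] at hz
    simp at hz)
  have heq : resolventTransform μ = stieltjes μ := by
    funext w
    simp [resolventTransform, stieltjes, resolvent, Ring.inverse_eq_inv']
  rw [heq] at h
  exact h.differentiableAt

theorem analyticOnNhd_stieltjes (μ : Measure ℝ) [IsFiniteMeasure μ] :
    AnalyticOnNhd ℂ (stieltjes μ) {z | 0 < z.im} :=
  DifferentiableOn.analyticOnNhd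
    (fun _ hz => (differentiableAt_stieltjes μ hz).differentiableWithinAt)
    (isOpen_lt continuous_const Complex.continuous_im)

theorem isPreconnected_upperHalfPlane : IsPreconnected {z : ℂ | 0 < z.im} :=
  (convex_halfSpace_im_gt 0).isPreconnected

/-- Two functions analytic on the upper half-plane which agree on a horizontal line agree. -/
theorem eq_of_eq_on_line {f g : ℂ → ℂ} (hf : AnalyticOnNhd ℂ f {z | 0 < z.im})
    (hg : AnalyticOnNhd ℂ g {z | 0 < z.im}) {v : ℝ} (hv : 0 < v)
    (h : ∀ t : ℝ, f (t + v * Complex.I) = g (t + v * Complex.I)) {z : ℂ} (hz : 0 < z.im) :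
    f z = g z := by
  have hmem : (v * Complex.I : ℂ) ∈ {z : ℂ | 0 < z.im} := by simpa using hv
  refine hf.eqOn_of_preconnected_of_frequently_eq hg isPreconnected_upperHalfPlane hmem ?_ hz
  have hten : Tendsto (fun t : ℝ => (t : ℂ) + v * Complex.I) (𝓝[≠] 0) (𝓝[≠] (v * Complex.I)) := by
    refine tendsto_nhdsWithin_iff.2 ⟨?_, ?_⟩
    · have : Continuous fun t : ℝ => (t : ℂ) + v * Complex.I := by fun_prop
      simpa using (this.tendsto 0).mono_left nhdsWithin_le_nhds
    · filter_upwards [self_mem_nhdsWithin] with t ht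
      simpa using ht
  exact hten.frequently (Eventually.of_forall h).frequently

/-- The mass of an atom, recovered from the Stieltjes transform above it. -/
theorem tendsto_atom (μ : Measure ℝ) [IsFiniteMeasure μ] (a : ℝ) :
    Tendsto (fun ε : ℝ => -(ε * Complex.I) * stieltjes μ (a + ε * Complex.I)) (𝓝[>] 0)
      (𝓝 (μ.real {a} : ℂ)) := by
  have h1 : ∀ ε : ℝ, -(ε * Complex.I) * stieltjes μ (a + ε * Complex.I)
      = ∫ x : ℝ, -(ε * Complex.I) * ((x : ℂ) - (a + ε * Complex.I))⁻¹ ∂μ := fun ε => by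
    rw [integral_const_mul]; rfl
  have h2 : (μ.real {a} : ℂ) = ∫ x : ℝ, ({a} : Set ℝ).indicator (fun _ => (1 : ℂ)) x ∂μ := by
    rw [integral_indicator (measurableSet_singleton a)]
    simp [Measure.real]
  simp_rw [h1]
  rw [h2]
  refine tendsto_integral_filter_of_dominated_convergence (fun _ => 1) ?_ ?_
    (integrable_const _) ?_
  · filter_upwards [self_mem_nhdsWithin] with ε hε
    exact (continuous_const.mul
      (continuous_inv_ofReal_sub (by simpa using hε))).aestronglyMeasurable
  · filter_upwards [self_mem_nhdsWithin] with ε hε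
    refine ae_of_all _ fun x => ?_
    have hε' : 0 < ε := hε
    have := norm_inv_ofReal_sub_le (z := a + ε * Complex.I) (by simpa using hε') x
    rw [norm_mul]
    calc _ ≤ ε * ε⁻¹ := by
          gcongr
          · simp [abs_of_pos hε']
          · simpa using this
      _ = 1 := mul_inv_cancel₀ hε'.ne'
  · refine ae_of_all _ fun x => ?_
    by_cases hx : x = a
    · subst hx
      refine tendsto_const_nhds.congr' ?_
      filter_upwards [self_mem_nhdsWithin] with ε hε
      have hε' : (ε : ℂ) ≠ 0 := by exact_mod_cast (ne_of_gt hε : ε ≠ 0)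
      simp
      field_simp
      simp
    · rw [Set.indicator_of_notMem (by simpa using hx)]
      have hne : (x : ℂ) - (a + (0 : ℝ) * Complex.I) ≠ 0 := by
        simp [sub_eq_zero]; exact hx
      have hc : ContinuousAt (fun ε : ℝ =>
          -(ε * Complex.I) * ((x : ℂ) - (a + ε * Complex.I))⁻¹) 0 :=
        ContinuousAt.mul (by fun_prop) (ContinuousAt.inv₀ (by fun_prop) hne)
      simpa using hc.tendsto.mono_left (nhdsWithin_le_nhds (s := Set.Ioi (0 : ℝ)))

theorem integral_poisson {ε : ℝ} (hε : 0 < ε) (x a b : ℝ) :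
    ∫ t in a..b, ε / ((x - t) ^ 2 + ε ^ 2)
      = Real.arctan ((b - x) / ε) - Real.arctan ((a - x) / ε) := by
  refine intervalIntegral.integral_eq_sub_of_hasDerivAt
    (f := fun t => Real.arctan ((t - x) / ε)) (fun t _ => ?_) ?_
  · have h : HasDerivAt (fun t => (t - x) / ε) (1 / ε) t :=
      ((hasDerivAt_id t).sub_const x).div_const ε
    have hne : (x - t) ^ 2 + ε ^ 2 ≠ 0 := by positivity
    have hne' : ε ^ 2 + (t - x) ^ 2 ≠ 0 := by positivity
    have hne'' : (t - x) ^ 2 + ε ^ 2 ≠ 0 := by positivity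
    have hne3 : 1 + ((t - x) / ε) ^ 2 ≠ 0 := by positivity
    refine h.arctan.congr_deriv ?_
    field_simp
    ring
  · refine Continuous.intervalIntegrable ?_ _ _
    exact Continuous.div (by fun_prop) (by fun_prop) fun t => by positivity

theorem integral_im_stieltjes (μ : Measure ℝ) [IsFiniteMeasure μ] {ε : ℝ} (hε : 0 < ε) (a b : ℝ) :
    ∫ t in a..b, (stieltjes μ (t + ε * Complex.I)).im
      = ∫ x, (Real.arctan ((b - x) / ε) - Real.arctan ((a - x) / ε)) ∂μ := by
  have h1 : ∀ t : ℝ, (stieltjes μ (t + ε * Complex.I)).im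
      = ∫ x : ℝ, ε / ((x - t) ^ 2 + ε ^ 2) ∂μ := fun t => by
    rw [stieltjes_im μ (by simpa using hε)]
    simp
  simp_rw [h1, ← integral_poisson hε]
  refine intervalIntegral_integral_swap ?_
  have hfin : IsFiniteMeasure (volume.restrict (Set.uIoc a b)) :=
    ⟨by simp [Set.uIoc]⟩
  have : Continuous (Function.uncurry fun t x : ℝ => ε / ((x - t) ^ 2 + ε ^ 2)) := by
    unfold Function.uncurry
    exact Continuous.div (by fun_prop) (by fun_prop) fun t => by positivity
  refine Integrable.of_bound this.aestronglyMeasurable ε⁻¹ (ae_of_all _ fun p => ?_)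
  simp only [Function.uncurry]
  rw [Real.norm_of_nonneg (by positivity), div_le_iff₀ (by positivity)]
  field_simp
  nlinarith [sq_nonneg (p.2 - p.1)]

theorem tendsto_arctan_div (y : ℝ) :
    Tendsto (fun ε : ℝ => Real.arctan (y / ε)) (𝓝[>] 0) (𝓝 (Real.pi / 2 * SignType.sign y)) := by
  rcases lt_trichotomy y 0 with hy | rfl | hy
  · have : Tendsto (fun ε : ℝ => y / ε) (𝓝[>] 0) atBot := by
      simp_rw [div_eq_mul_inv]
      exact tendsto_inv_nhdsGT_zero.const_mul_atTop_of_neg hy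
    have h := (Real.tendsto_arctan_atBot.mono_right nhdsWithin_le_nhds).comp this
    simpa [sign_neg hy, Function.comp_def, neg_div] using h
  · simp
  · have : Tendsto (fun ε : ℝ => y / ε) (𝓝[>] 0) atTop := by
      simp_rw [div_eq_mul_inv]
      exact tendsto_inv_nhdsGT_zero.const_mul_atTop hy
    have h := (Real.tendsto_arctan_atTop.mono_right nhdsWithin_le_nhds).comp this
    simpa [sign_pos hy, Function.comp_def] using h

/-- Stieltjes inversion on an interval, where the endpoints may be atoms. -/
theorem tendsto_integral_im_stieltjes (μ : Measure ℝ) [IsFiniteMeasure μ] {a b : ℝ} (hab : a < b) :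
    Tendsto (fun ε : ℝ => ∫ t in a..b, (stieltjes μ (t + ε * Complex.I)).im) (𝓝[>] 0)
      (𝓝 (Real.pi * (μ.real (Set.Ioo a b) + μ.real {a} / 2 + μ.real {b} / 2))) := by
  have h2 : Real.pi * (μ.real (Set.Ioo a b) + μ.real {a} / 2 + μ.real {b} / 2)
      = ∫ x : ℝ, ((Set.Ioo a b).indicator (fun _ => Real.pi) x
        + ({a} : Set ℝ).indicator (fun _ => Real.pi / 2) x
        + ({b} : Set ℝ).indicator (fun _ => Real.pi / 2) x) ∂μ := by
    have hi : ∀ (s : Set ℝ) (c : ℝ), MeasurableSet s → Integrable (s.indicator fun _ => c) μ :=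
      fun s c hs => (integrable_const c).indicator hs
    have h1 := hi _ Real.pi (measurableSet_Ioo (a := a) (b := b))
    have h2 := hi _ (Real.pi / 2) (measurableSet_singleton a)
    have h3 := hi _ (Real.pi / 2) (measurableSet_singleton b)
    have h4 := integral_add (h1.add h2) h3
    have h5 := integral_add h1 h2
    simp only [Pi.add_apply] at h4
    rw [h4, h5, integral_indicator measurableSet_Ioo,
      integral_indicator (measurableSet_singleton a),
      integral_indicator (measurableSet_singleton b)]
    simp [Measure.real]
    ring
  rw [h2]
  refine Tendsto.congr' (f₁ := fun ε : ℝ =>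
    ∫ x, (Real.arctan ((b - x) / ε) - Real.arctan ((a - x) / ε)) ∂μ) ?_ ?_
  · filter_upwards [self_mem_nhdsWithin] with ε hε
    rw [integral_im_stieltjes μ hε]
  refine tendsto_integral_filter_of_dominated_convergence (fun _ => Real.pi) ?_ ?_
    (integrable_const _) ?_
  · refine Eventually.of_forall fun ε => Continuous.aestronglyMeasurable ?_
    exact (Real.continuous_arctan.comp (by fun_prop)).sub
      (Real.continuous_arctan.comp (by fun_prop))
  · refine Eventually.of_forall fun ε => ae_of_all _ fun x => ?_
    have := Real.arctan_lt_pi_div_two ((b - x) / ε)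
    have := Real.neg_pi_div_two_lt_arctan ((b - x) / ε)
    have := Real.arctan_lt_pi_div_two ((a - x) / ε)
    have := Real.neg_pi_div_two_lt_arctan ((a - x) / ε)
    rw [Real.norm_eq_abs, abs_le]
    constructor <;> linarith
  · refine ae_of_all _ fun x => ?_
    have h := (tendsto_arctan_div (b - x)).sub (tendsto_arctan_div (a - x))
    convert h using 2
    simp only [Set.indicator_apply, Set.mem_Ioo, Set.mem_singleton_iff]
    rcases lt_trichotomy x a with h1 | rfl | h1
    · rw [sign_pos (by linarith : 0 < b - x), sign_pos (by linarith : 0 < a - x),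
        if_neg (by simp [h1.le]), if_neg h1.ne, if_neg (h1.trans hab).ne]
      simp
    · rw [sign_pos (by linarith : 0 < b - x), if_neg (by simp), if_pos rfl, if_neg hab.ne]
      simp
    · rw [sign_neg (by linarith : a - x < 0), if_neg h1.ne']
      rcases lt_trichotomy x b with h2 | rfl | h2
      · rw [sign_pos (by linarith : 0 < b - x), if_pos ⟨h1, h2⟩, if_neg h2.ne]
        simp
      · simp
      · rw [sign_neg (by linarith : b - x < 0), if_neg (by simp [h2.le]), if_neg h2.ne']
        simp

/-- A finite measure on the real line is determined by its Stieltjes transform. -/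
theorem measure_eq_of_stieltjes_eq (μ ν : Measure ℝ) [IsFiniteMeasure μ]
    [IsFiniteMeasure ν] (h : ∀ z : ℂ, 0 < z.im → stieltjes μ z = stieltjes ν z) : μ = ν := by
  have hatom : ∀ a, μ.real {a} = ν.real {a} := fun a => by
    have h1 := (tendsto_atom μ a).congr' (f₂ := fun ε : ℝ =>
        -(ε * Complex.I) * stieltjes ν (a + ε * Complex.I)) (by
      filter_upwards [self_mem_nhdsWithin] with ε hε
      rw [h _ (by simpa using hε)])
    exact_mod_cast tendsto_nhds_unique h1 (tendsto_atom ν a)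
  refine Real.measure_ext_Ioo_rat fun a b => ?_
  rcases le_or_gt (b : ℝ) a with hab | hab
  · simp [Set.Ioo_eq_empty (not_lt.2 hab)]
  have h1 := tendsto_integral_im_stieltjes μ hab
  have h2 := tendsto_integral_im_stieltjes ν hab
  have h3 := tendsto_nhds_unique (h1.congr' (by
    filter_upwards [self_mem_nhdsWithin] with ε hε
    refine intervalIntegral.integral_congr fun t _ => ?_
    exact congrArg Complex.im (h _ (by simpa using hε)))) h2
  have h4 := mul_left_cancel₀ Real.pi_pos.ne' h3
  rw [hatom a, hatom b] at h4
  exact (measureReal_eq_measureReal_iff).1 (by linarith)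

theorem measureReal_norm_gt_le (μ : Measure ℝ) [IsProbabilityMeasure μ] {v : ℝ} (hv : 0 < v) :
    μ.real {x | v < ‖x‖} ≤ 2 * ‖1 + v * Complex.I * stieltjes μ (v * Complex.I)‖ := by
  have hz : 0 < (v * Complex.I : ℂ).im := by simpa using hv
  have hint := integrable_poisson μ hz
  have h1 : (1 + v * Complex.I * stieltjes μ (v * Complex.I)).re
      = ∫ x : ℝ, (1 - v * (v / (x ^ 2 + v ^ 2))) ∂μ := by
    simp only [Complex.mul_re, Complex.mul_im, Complex.ofReal_re, Complex.ofReal_im, Complex.I_re,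
      Complex.I_im, mul_zero, mul_one, sub_zero, add_zero] at hint
    rw [integral_sub (integrable_const _) (hint.const_mul v), integral_const_mul]
    have := stieltjes_im μ hz
    simp only [Complex.mul_re, Complex.mul_im, Complex.ofReal_re, Complex.ofReal_im, Complex.I_re,
      Complex.I_im, mul_zero, mul_one, sub_zero, add_zero] at this
    rw [← this]
    simp
    ring
  have h2 : μ.real {x | v < ‖x‖} ≤ 2 * ∫ x : ℝ, (1 - v * (v / (x ^ 2 + v ^ 2))) ∂μ := by
    have hm : MeasurableSet {x : ℝ | v < ‖x‖} := measurableSet_lt measurable_const measurable_norm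
    rw [← integral_const_mul, ← integral_indicator_one hm]
    refine integral_mono ((integrable_const _).indicator hm) ?_ fun x => ?_
    · simp only [Complex.mul_re, Complex.mul_im, Complex.ofReal_re, Complex.ofReal_im, Complex.I_re,
        Complex.I_im, mul_zero, mul_one, sub_zero, add_zero] at hint
      exact ((integrable_const _).sub (hint.const_mul v)).const_mul 2
    · have hpos : 0 < x ^ 2 + v ^ 2 := by positivity
      have he : 1 - v * (v / (x ^ 2 + v ^ 2)) = x ^ 2 / (x ^ 2 + v ^ 2) := by
        field_simp; ring
      by_cases hx : v < ‖x‖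
      · rw [Set.indicator_of_mem (by exact hx)]
        simp only [Pi.one_apply]
        rw [he, ← mul_div_assoc, le_div_iff₀ hpos]
        have : v ^ 2 < x ^ 2 := by
          rw [← sq_abs x]; exact pow_lt_pow_left₀ hx hv.le two_ne_zero
        linarith
      · rw [Set.indicator_of_notMem (by exact hx), he]
        positivity
  rw [← h1] at h2
  exact h2.trans (by gcongr; exact Complex.re_le_norm _)

/-! ### The cubic equation and the explicit density -/

/-- The left hand side of the cubic equation `(1 + z m) (1 - c² m²) + 2 c m² = 0` satisfied by the
Stieltjes transform of the limiting spectral distribution. -/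
def lsdCubic (c : ℝ) (z m : ℂ) : ℂ := (1 + z * m) * (1 - (c : ℂ) ^ 2 * m ^ 2) + 2 * c * m ^ 2

/-- The linear coefficient of the depressed cubic is `-3 q`. -/
def depressedQ (c x : ℝ) : ℝ := 1 / (3 * c ^ 2) + (c - 2) ^ 2 / (9 * c ^ 2 * x ^ 2)

/-- The constant coefficient of the depressed cubic is `2 s`. -/
def depressedS (c x : ℝ) : ℝ := r₁ c / x - r₃ c / x ^ 3

/-- The shift that removes the quadratic term of the cubic. -/
def cubicShift (c x : ℝ) : ℝ := (2 - c) / (3 * c * x)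

theorem depressedQ_pos {c : ℝ} (hc : 0 < c) (x : ℝ) : 0 < depressedQ c x := by
  unfold depressedQ; positivity

theorem depressedS_sq_sub {c x : ℝ} (hc : 0 < c) (hx : x ≠ 0) :
    depressedS c x ^ 2 - depressedQ c x ^ 3 = -d c x := by
  unfold depressedS depressedQ d r₁ r₃ d₀ d₂ d₄
  field_simp
  ring

theorem norm_r {c x : ℝ} : ‖r c x‖ = |depressedS c x| := by
  have : r c x = -Complex.I * (depressedS c x : ℂ) := by
    by_cases hx : x = 0
    · simp [r, R, depressedS, hx]
    have hx' : (x : ℂ) ≠ 0 := by exact_mod_cast hx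
    unfold r R depressedS
    push_cast
    field_simp
    simp [pow_succ]
    ring
  rw [this]
  simp

theorem lsdCubic_eq_depressed {c x : ℝ} (hc : 0 < c) (hx : x ≠ 0) (y : ℂ) :
    lsdCubic c x (y + cubicShift c x)
      = -(c ^ 2 * x : ℂ) * (y ^ 3 - 3 * depressedQ c x * y + 2 * depressedS c x) := by
  have hx' : (x : ℂ) ≠ 0 := by exact_mod_cast hx
  have hc' : (c : ℂ) ≠ 0 := by exact_mod_cast hc.ne'
  unfold lsdCubic depressedS depressedQ cubicShift r₁ r₃
  push_cast
  field_simp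
  ring

/-- Off the origin the density is given by a single formula, since `√` vanishes on negatives. -/
def densityFormula (c x : ℝ) : ℝ :=
  √3 / (2 * Real.pi) * (Vplus c x ^ (1 / 3 : ℝ) - Vminus c x ^ (1 / 3 : ℝ))

theorem d_mul_pow {c x : ℝ} (hx : x ≠ 0) :
    d c x * x ^ 4 = d₀ c * (x ^ 2) ^ 2 - d₂ c * x ^ 2 + d₄ c := by
  unfold d
  field_simp

theorem discr_eq {c : ℝ} (hc : 0 < c) :
    d₂ c ^ 2 - 4 * d₀ c * d₄ c = (4 * c + 1) ^ 3 / (27 * c ^ 6) ^ 2 := by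
  unfold d₀ d₂ d₄
  field_simp
  ring

theorem d_mul_pow_eq {c x : ℝ} (hc : 0 < c) (hx : x ≠ 0) :
    d c x * x ^ 4 = d₀ c * ((x ^ 2 - Rplus c) * (x ^ 2 - Rminus c)) := by
  have h0 : d₀ c ≠ 0 := by unfold d₀; positivity
  have hD : 0 ≤ d₂ c ^ 2 - 4 * d₀ c * d₄ c := by rw [discr_eq hc]; positivity
  have hs := Real.sq_sqrt hD
  rw [d_mul_pow hx]
  unfold Rplus Rminus
  set D := √(d₂ c ^ 2 - 4 * d₀ c * d₄ c)
  field_simp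
  linear_combination hs

theorem Rminus_lt_Rplus {c : ℝ} (hc : 0 < c) : Rminus c < Rplus c := by
  have h0 : 0 < d₀ c := by unfold d₀; positivity
  have hD : 0 < d₂ c ^ 2 - 4 * d₀ c * d₄ c := by rw [discr_eq hc]; positivity
  have := Real.sqrt_pos.2 hD
  unfold Rplus Rminus
  gcongr
  linarith

theorem mem_S_iff {c x : ℝ} (hc : 0 < c) : x ∈ S c ↔ x ≠ 0 ∧ d c x < 0 := by
  have habs : x ∈ S c ↔ L c < |x| ∧ |x| < U c := by
    have hL : 0 ≤ L c := Real.sqrt_nonneg _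
    unfold S
    simp only [Set.mem_union, Set.mem_Ioo]
    rcases le_or_gt 0 x with h | h
    · rw [abs_of_nonneg h]
      constructor
      · rintro (h1 | h1)
        · exact absurd h1.2 (by linarith)
        · exact h1
      · exact Or.inr
    · rw [abs_of_neg h]
      constructor
      · rintro (h1 | h1)
        · exact ⟨by linarith, by linarith⟩
        · exact absurd h1.1 (by linarith)
      · rintro ⟨h1, h2⟩
        exact Or.inl ⟨by linarith, by linarith⟩
  have h0 : 0 < d₀ c := by unfold d₀; positivity
  have hU : |x| < U c ↔ x ^ 2 < Rplus c := by
    rw [U, Real.lt_sqrt (abs_nonneg x), sq_abs]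
  have hL : L c < |x| ↔ x ≠ 0 ∧ Rminus c < x ^ 2 := by
    unfold L
    split_ifs with h
    · by_cases hx : x = 0
      · simp [hx]
      · rw [Real.sqrt_lt' (abs_pos.2 hx), sq_abs]
        simp [hx]
    · simp
      intro hx
      have : 0 < x ^ 2 := by positivity
      linarith
  rw [habs, hU, hL, and_assoc]
  refine and_congr_right fun hx => ?_
  have h4 : 0 < x ^ 4 := by positivity
  have hd := d_mul_pow_eq hc hx
  have hR := Rminus_lt_Rplus hc
  constructor
  · rintro ⟨h1, h2⟩
    have : (x ^ 2 - Rplus c) * (x ^ 2 - Rminus c) < 0 :=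
      mul_neg_of_neg_of_pos (by linarith) (by linarith)
    have : d c x * x ^ 4 < 0 := by rw [hd]; exact mul_neg_of_pos_of_neg h0 this
    exact neg_of_mul_neg_left this h4.le
  · intro h
    have h1 : d c x * x ^ 4 < 0 := mul_neg_of_neg_of_pos h h4
    rw [hd] at h1
    have h2 : (x ^ 2 - Rplus c) * (x ^ 2 - Rminus c) < 0 := by
      by_contra h3
      exact absurd h1 (not_lt.2 (mul_nonneg h0.le (not_lt.1 h3)))
    constructor
    · by_contra h3
      have : 0 ≤ (x ^ 2 - Rplus c) * (x ^ 2 - Rminus c) :=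
        mul_nonneg_of_nonpos_of_nonpos (by linarith) (by linarith)
      linarith
    · by_contra h3
      have : 0 ≤ (x ^ 2 - Rplus c) * (x ^ 2 - Rminus c) :=
        mul_nonneg (by linarith) (by linarith)
      linarith

theorem density_eq_formula {c x : ℝ} (hc : 0 < c) (hx : x ≠ 0) :
    density c x = densityFormula c x := by
  unfold density
  by_cases h : x ∈ S c
  · rw [Set.indicator_of_mem h]; rfl
  · rw [Set.indicator_of_notMem h]
    rw [mem_S_iff hc] at h
    have hd : 0 ≤ d c x := by
      by_contra h'
      exact h ⟨hx, not_le.1 h'⟩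
    simp [densityFormula, Vplus, Vminus, Real.sqrt_eq_zero_of_nonpos (neg_nonpos.2 hd)]

theorem continuousAt_densityFormula {c x : ℝ} (hx : x ≠ 0) :
    ContinuousAt (densityFormula c) x := by
  have h1 : ContinuousAt (fun x => ‖r c x‖) x := by
    simp_rw [norm_r]
    unfold depressedS
    refine ContinuousAt.abs (ContinuousAt.sub ?_ ?_)
    · exact ContinuousAt.div (by fun_prop) (by fun_prop) hx
    · exact ContinuousAt.div (by fun_prop) (by fun_prop) (pow_ne_zero 3 hx)
  have h2 : ContinuousAt (fun x => √(-d c x)) x := by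
    refine ContinuousAt.sqrt (ContinuousAt.neg ?_)
    unfold d
    refine ContinuousAt.add (ContinuousAt.sub (by fun_prop) ?_) ?_
    · exact ContinuousAt.div (by fun_prop) (by fun_prop) (pow_ne_zero 2 hx)
    · exact ContinuousAt.div (by fun_prop) (by fun_prop) (pow_ne_zero 4 hx)
  unfold densityFormula Vplus Vminus
  exact continuousAt_const.mul (((h1.add h2).rpow_const (Or.inr (by norm_num))).sub
    ((h1.sub h2).rpow_const (Or.inr (by norm_num))))

theorem rpow_third_eq {a b : ℝ} (hb : 0 ≤ b) (h : a = b ^ 3) : a ^ (1 / 3 : ℝ) = b := by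
  rw [h, ← Real.rpow_natCast, ← Real.rpow_mul hb]
  norm_num

/-- A root of the cubic in the upper half-plane, above a real point, exists only where `d < 0`, and
its imaginary part is `π` times the density. -/
theorem im_root_eq {c x : ℝ} (hc : 0 < c) (hx : x ≠ 0) {w : ℂ} (hw : 0 < w.im)
    (h : lsdCubic c x w = 0) : d c x < 0 ∧ w.im = Real.pi * densityFormula c x := by
  obtain ⟨y, rfl⟩ : ∃ y : ℂ, w = y + cubicShift c x := ⟨w - cubicShift c x, by ring⟩
  rw [lsdCubic_eq_depressed hc hx] at h
  have hne : -(c ^ 2 * x : ℂ) ≠ 0 := by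
    have hx' : (x : ℂ) ≠ 0 := by exact_mod_cast hx
    have hc' : (c : ℂ) ≠ 0 := by exact_mod_cast hc.ne'
    simp [hx', hc']
  have h := (mul_eq_zero.1 h).resolve_left hne
  have hd := depressedS_sq_sub hc hx
  have hq := depressedQ_pos hc x
  simp only [densityFormula, Vplus, Vminus, norm_r]
  set q := depressedQ c x
  set s := depressedS c x
  obtain ⟨u, v⟩ := y
  have hv : 0 < v := by simpa using hw
  have him := congrArg Complex.im h
  have hre := congrArg Complex.re h
  simp [pow_succ] at him hre
  have e1 : 3 * u ^ 2 - v ^ 2 = 3 * q := by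
    have : v * (3 * u ^ 2 - v ^ 2 - 3 * q) = 0 := by linear_combination him
    have := (mul_eq_zero.1 this).resolve_left hv.ne'
    linarith
  have e2 : s = u * (u ^ 2 + v ^ 2) := by
    linear_combination hre / 2 - u / 2 * e1
  have e3 : -d c x = v ^ 2 * (3 * u ^ 2 + v ^ 2 / 3) ^ 2 / 3 := by
    rw [← hd, e2]
    have : q = u ^ 2 - v ^ 2 / 3 := by linarith
    rw [this]
    ring
  have h3 : √3 ^ 2 = 3 := Real.sq_sqrt (by norm_num)
  have h3p : 0 < √3 := Real.sqrt_pos.2 (by norm_num)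
  have e4 : √(-d c x) = v * (3 * u ^ 2 + v ^ 2 / 3) / √3 := by
    rw [e3, Real.sqrt_div (by positivity), Real.sqrt_mul (by positivity), Real.sqrt_sq hv.le,
      Real.sqrt_sq (by positivity)]
  have hu : v / √3 ≤ |u| := by
    rw [← pow_le_pow_iff_left₀ (by positivity) (abs_nonneg u) two_ne_zero, div_pow, h3, sq_abs]
    linarith
  have hk : v / √3 = v * √3 / 3 := by
    field_simp
    exact h3.symm
  have hk' : v * (3 * |u| ^ 2 + v ^ 2 / 3) / √3 = (3 * |u| ^ 2 + v ^ 2 / 3) * (v * √3 / 3) := by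
    rw [← hk]; ring
  have hs : |s| = |u| * (|u| ^ 2 + v ^ 2) := by
    rw [e2, abs_mul, sq_abs, abs_of_nonneg (by positivity : 0 ≤ u ^ 2 + v ^ 2)]
  have hP : (|s| + √(-d c x)) = (|u| + v / √3) ^ 3 := by
    rw [hs, e4, ← sq_abs u, hk', hk]
    linear_combination (-(|u| * v ^ 2 / 3) - v ^ 3 * √3 / 27) * h3
  have hM : (|s| - √(-d c x)) = (|u| - v / √3) ^ 3 := by
    rw [hs, e4, ← sq_abs u, hk', hk]
    linear_combination (-(|u| * v ^ 2 / 3) + v ^ 3 * √3 / 27) * h3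
  refine ⟨?_, ?_⟩
  · have : 0 < -d c x := by rw [e3]; positivity
    linarith
  · rw [rpow_third_eq (by positivity) hP, rpow_third_eq (by linarith) hM]
    have := Real.pi_pos
    simp
    field_simp
    ring

/-- A real root of the cubic above a point of the support violates the inequality satisfied by
boundary values of Stieltjes transforms. -/
theorem real_root_ineq {c x : ℝ} (hc : 0 < c) (hx : x ≠ 0) (hd : d c x < 0) {ρ : ℝ}
    (h : lsdCubic c x ρ = 0) :
    (1 - c ^ 2 * ρ ^ 2) ^ 2 < 2 * c * ρ ^ 2 * (1 + c ^ 2 * ρ ^ 2) := by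
  obtain ⟨y, rfl⟩ : ∃ y : ℝ, ρ = y + cubicShift c x := ⟨ρ - cubicShift c x, by ring⟩
  have h0 : (1 + x * (y + cubicShift c x)) * (1 - c ^ 2 * (y + cubicShift c x) ^ 2)
      + 2 * c * (y + cubicShift c x) ^ 2 = 0 := by
    unfold lsdCubic at h
    exact_mod_cast h
  have hne : (c ^ 2 * x) ≠ 0 := by positivity
  have hdep : ∀ y : ℝ, (1 + x * (y + cubicShift c x)) * (1 - c ^ 2 * (y + cubicShift c x) ^ 2)
      + 2 * c * (y + cubicShift c x) ^ 2
      = -(c ^ 2 * x) * (y ^ 3 - 3 * depressedQ c x * y + 2 * depressedS c x) := fun y => by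
    have := lsdCubic_eq_depressed hc hx y
    unfold lsdCubic at this
    exact_mod_cast this
  have hy : y ^ 3 - 3 * depressedQ c x * y + 2 * depressedS c x = 0 := by
    have := hdep y
    rw [h0] at this
    exact (mul_eq_zero.1 this.symm).resolve_left (neg_ne_zero.2 hne)
  have hdd := depressedS_sq_sub hc hx
  have hq := depressedQ_pos hc x
  have hz := hdep (-cubicShift c x)
  have hder : 3 * depressedQ c x = 3 * cubicShift c x ^ 2 + 1 / c ^ 2 := by
    unfold depressedQ cubicShift
    field_simp
    ring
  have ht : 3 * c ^ 2 * x * cubicShift c x = 2 * c - c ^ 2 := by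
    unfold cubicShift; field_simp
  set q := depressedQ c x
  set s := depressedS c x
  set t := cubicShift c x
  have hs : s = -(y ^ 3 - 3 * q * y) / 2 := by linarith
  have hyq : 4 * q < y ^ 2 := by
    have h1 : (y ^ 2 - 4 * q) * (y ^ 2 - q) ^ 2 = 4 * (-d c x) := by rw [← hdd, hs]; ring
    by_contra h2
    have : (y ^ 2 - 4 * q) * (y ^ 2 - q) ^ 2 ≤ 0 :=
      mul_nonpos_of_nonpos_of_nonneg (by linarith) (sq_nonneg _)
    linarith
  have hquad : 0 < t ^ 2 - y * t + y ^ 2 - 3 * q := by nlinarith [sq_nonneg (2 * t - y)]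
  have hxr : 0 < x * (y + t) := by
    have h1 : c ^ 2 * (x * (y + t)) * (t ^ 2 - y * t + y ^ 2 - 3 * q) = 1 := by
      rw [hs] at hz
      ring_nf at hz ⊢
      linear_combination -hz
    by_contra h2
    have : c ^ 2 * (x * (y + t)) * (t ^ 2 - y * t + y ^ 2 - 3 * q) ≤ 0 :=
      mul_nonpos_of_nonpos_of_nonneg
        (mul_nonpos_of_nonneg_of_nonpos (by positivity) (not_lt.1 h2)) hquad.le
    linarith
  set ρ := y + t with hρ
  have hρ0 : ρ ≠ 0 := fun h => by simp [h] at hxr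
  have hQ : 1 - c ^ 2 * ρ ^ 2 < 0 := by
    by_contra h2
    have : 0 ≤ (1 + x * ρ) * (1 - c ^ 2 * ρ ^ 2) := mul_nonneg (by linarith) (not_lt.1 h2)
    have : 0 < 2 * c * ρ ^ 2 := by positivity
    linarith
  -- the derivative of the cubic at `ρ`
  have hp : 0 < ρ * (3 * c ^ 2 * x * ρ ^ 2 - 2 * (2 * c - c ^ 2) * ρ - x) := by
    have : ρ * (3 * c ^ 2 * x * ρ ^ 2 - 2 * (2 * c - c ^ 2) * ρ - x)
        = c ^ 2 * (x * ρ) * (3 * y ^ 2 - 3 * q) := by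
      have hc2 : c ^ 2 * (1 / c ^ 2) = 1 := by field_simp
      rw [← ht, hder, hρ]
      linear_combination x * (y + t) * hc2
    rw [this]
    have : 0 < 3 * y ^ 2 - 3 * q := by linarith
    positivity
  have hfin : ρ * (3 * c ^ 2 * x * ρ ^ 2 - 2 * (2 * c - c ^ 2) * ρ - x) * (1 - c ^ 2 * ρ ^ 2)
      = (1 - c ^ 2 * ρ ^ 2) ^ 2 - 2 * c * ρ ^ 2 * (1 + c ^ 2 * ρ ^ 2) := by
    linear_combination (3 * c ^ 2 * ρ ^ 2 - 1) * h0
  have := mul_neg_of_pos_of_neg hp hQ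
  linarith

/-- The imaginary part of the cubic equation, as an inequality on the upper half-plane. -/
theorem cubic_im_ineq {c : ℝ} {z m : ℂ} (hz : 0 < z.im) (hm : 0 < m.im)
    (h : lsdCubic c z m = 0) :
    2 * c * ‖m‖ ^ 2 * (1 + c ^ 2 * ‖m‖ ^ 2) ≤ ‖1 - (c : ℂ) ^ 2 * m ^ 2‖ ^ 2 := by
  unfold lsdCubic at h
  set W := 1 - (c : ℂ) ^ 2 * m ^ 2 with hW
  have key : z * (m * starRingEnd ℂ m) * (W * starRingEnd ℂ W)
      = -(starRingEnd ℂ m) * (W * starRingEnd ℂ W)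
        - 2 * c * (m * starRingEnd ℂ m)
          * (m - (c : ℂ) ^ 2 * (m * starRingEnd ℂ m) * starRingEnd ℂ m) := by
    have hcW : starRingEnd ℂ W = 1 - (c : ℂ) ^ 2 * (starRingEnd ℂ m) ^ 2 := by
      simp [hW]
    linear_combination (starRingEnd ℂ m) * (starRingEnd ℂ W) * h
      - 2 * c * m ^ 2 * starRingEnd ℂ m * hcW
  rw [Complex.mul_conj, Complex.mul_conj] at key
  have him := congrArg Complex.im key
  rw [← Complex.normSq_eq_norm_sq, ← Complex.normSq_eq_norm_sq]
  have e : z.im * (Complex.normSq m * Complex.normSq W)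
      = m.im * (Complex.normSq W - 2 * c * Complex.normSq m * (1 + c ^ 2 * Complex.normSq m)) := by
    have h2 : ((c : ℂ) ^ 2).re = c ^ 2 ∧ ((c : ℂ) ^ 2).im = 0 := by
      simp [← Complex.ofReal_pow]
    simp [h2.1, h2.2] at him
    linear_combination him
  have h1 : 0 ≤ z.im * (Complex.normSq m * Complex.normSq W) :=
    mul_nonneg hz.le (mul_nonneg (Complex.normSq_nonneg _) (Complex.normSq_nonneg _))
  rw [e] at h1
  have := nonneg_of_mul_nonneg_right h1 hm
  linarith

/-! ### The density near the origin -/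

/-- The bracket in the density formula solves a cubic equation. -/
theorem exists_densityFormula_eq {c x : ℝ} (hc : 0 < c) (hx : x ≠ 0) (hd : d c x ≤ 0) :
    ∃ δ : ℝ, 0 ≤ δ ∧ densityFormula c x = √3 / (2 * Real.pi) * δ ∧
      δ ^ 3 + 3 * depressedQ c x * δ = 2 * √(-d c x) := by
  have hq := depressedQ_pos hc x
  have hs := depressedS_sq_sub hc hx
  have hsq : √(-d c x) ^ 2 = -d c x := Real.sq_sqrt (by linarith)
  have hD := Real.sqrt_nonneg (-d c x)
  simp only [densityFormula, Vplus, Vminus, norm_r]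
  set D := √(-d c x)
  set s := |depressedS c x| with hsdef
  have hs' : s ^ 2 = D ^ 2 + depressedQ c x ^ 3 := by
    rw [hsdef, sq_abs, hsq]; linarith
  set q := depressedQ c x
  have hs0 : 0 ≤ s := abs_nonneg _
  have hle : D ≤ s := by
    rw [← pow_le_pow_iff_left₀ hD hs0 two_ne_zero, hs']
    have := pow_pos hq 3
    linarith
  set α := (s + D) ^ (1 / 3 : ℝ) with hα
  set β := (s - D) ^ (1 / 3 : ℝ) with hβ
  have hcube : ∀ y : ℝ, 0 ≤ y → (y ^ (1 / 3 : ℝ)) ^ 3 = y := fun y hy => by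
    rw [← Real.rpow_natCast, ← Real.rpow_mul hy]; norm_num
  have hα3 : α ^ 3 = s + D := hcube _ (by linarith)
  have hβ3 : β ^ 3 = s - D := hcube _ (by linarith)
  have hαβ : α * β = q := by
    rw [hα, hβ, ← Real.mul_rpow (by linarith) (by linarith)]
    exact rpow_third_eq hq.le (by linear_combination hs')
  refine ⟨α - β, ?_, rfl, ?_⟩
  · have : β ≤ α := Real.rpow_le_rpow (by linarith) (by linarith) (by norm_num)
    linarith
  · rw [← hαβ]
    linear_combination hα3 - hβ3

theorem tendsto_densityFormula_zero {c : ℝ} (hc : 0 < c) (hc2 : c < 2) :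
    Tendsto (densityFormula c) (𝓝[≠] 0) (𝓝 (1 / (Real.pi * √(2 * c - c ^ 2)))) := by
  set N : ℝ → ℝ := fun x => 2 * √(-(d₀ c * x ^ 4 - d₂ c * x ^ 2 + d₄ c)) with hN
  set B : ℝ → ℝ := fun x => x ^ 2 / c ^ 2 + (c - 2) ^ 2 / (3 * c ^ 2) with hB
  have hc2' : 0 < (c - 2) ^ 2 := by
    have : c - 2 ≠ 0 := by linarith
    positivity
  have hBpos : ∀ x, 0 < B x := fun x => by simp only [hB]; positivity
  have hNc : Continuous N := by fun_prop
  have hBc : Continuous B := by fun_prop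
  have hN0 : ∀ x, 0 ≤ N x := fun x => by positivity
  have hd4 : d₄ c < 0 := by
    unfold d₄
    refine div_neg_of_neg_of_pos ?_ (by positivity)
    have : 0 < 2 - c := by linarith
    have := pow_pos this 3
    nlinarith
  have hev : ∀ᶠ x in 𝓝[≠] (0 : ℝ), d c x < 0 := by
    have h1 : Tendsto (fun x : ℝ => d₀ c * x ^ 4 - d₂ c * x ^ 2 + d₄ c) (𝓝[≠] 0) (𝓝 (d₄ c)) := by
      have : Continuous (fun x : ℝ => d₀ c * x ^ 4 - d₂ c * x ^ 2 + d₄ c) := by fun_prop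
      simpa using (this.tendsto 0).mono_left nhdsWithin_le_nhds
    filter_upwards [h1.eventually_lt_const hd4, self_mem_nhdsWithin] with x hx hx0
    have hx0' : x ≠ 0 := hx0
    have h4 : 0 < x ^ 4 := by positivity
    have := d_mul_pow (c := c) hx0'
    rw [← pow_mul] at this
    exact neg_of_mul_neg_left (by rw [this]; exact hx) h4.le
  set κ := √3 / (2 * Real.pi) with hκ
  have hκ0 : 0 ≤ κ := by have := Real.pi_pos; positivity
  have hbounds : ∀ᶠ x in 𝓝[≠] (0 : ℝ),
      κ * (N x / (x ^ 2 * (N x / B x) ^ 2 + B x)) ≤ densityFormula c x ∧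
      densityFormula c x ≤ κ * (N x / B x) := by
    filter_upwards [hev, self_mem_nhdsWithin] with x hx hx0
    have hx0' : x ≠ 0 := hx0
    obtain ⟨δ, hδ, hf, he⟩ := exists_densityFormula_eq hc hx0' hx.le
    have hBx := hBpos x
    have e1 : x ^ 2 * (3 * depressedQ c x) = B x := by
      simp only [hB, depressedQ]
      field_simp
      ring
    have e2 : x ^ 2 * (2 * √(-d c x)) = N x := by
      simp only [hN]
      have h := d_mul_pow (c := c) hx0'
      rw [← pow_mul] at h
      rw [← h, show -(d c x * x ^ 4) = -d c x * (x ^ 2) ^ 2 by ring,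
        Real.sqrt_mul (by linarith), Real.sqrt_sq (by positivity)]
      ring
    have e3 : δ * (x ^ 2 * δ ^ 2 + B x) = N x := by
      rw [← e1, ← e2, ← he]; ring
    have h1 : δ ≤ N x / B x := by
      rw [le_div_iff₀ hBx, ← e3]
      have : 0 ≤ δ * (x ^ 2 * δ ^ 2) := by positivity
      nlinarith
    have h2 : N x / (x ^ 2 * (N x / B x) ^ 2 + B x) ≤ δ := by
      rw [div_le_iff₀ (by positivity), ← e3]
      gcongr
      rwa [e3]
    rw [hf]
    exact ⟨by gcongr, by gcongr⟩
  have hlim : κ * (N 0 / B 0) = 1 / (Real.pi * √(2 * c - c ^ 2)) := by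
    have hpos : 0 < 2 * c - c ^ 2 := by nlinarith
    have e : -d₄ c = (2 * c - c ^ 2) * ((2 - c) / (3 * c ^ 3)) ^ 2 / 3 := by
      unfold d₄
      field_simp
      ring
    have hN0' : N 0 = 2 * (√(2 * c - c ^ 2) * ((2 - c) / (3 * c ^ 3)) / √3) := by
      simp only [hN]
      have hp : 0 ≤ (2 - c) / (3 * c ^ 3) := div_nonneg (by linarith) (by positivity)
      rw [show -(d₀ c * 0 ^ 4 - d₂ c * 0 ^ 2 + d₄ c) = -d₄ c by ring, e,
        Real.sqrt_div (by positivity), Real.sqrt_mul hpos.le, Real.sqrt_sq hp]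
    have hs := Real.sq_sqrt hpos.le
    have hsp := Real.sqrt_pos.2 hpos
    have h3p : 0 < √3 := Real.sqrt_pos.2 (by norm_num)
    have hpi := Real.pi_pos
    have hc3 : c - 2 ≠ 0 := by linarith
    have hc4 : 2 - c ≠ 0 := by linarith
    rw [hN0', hκ]
    simp only [hB]
    set k := √(2 * c - c ^ 2)
    have e5 : (0 : ℝ) ^ 2 / c ^ 2 + (c - 2) ^ 2 / (3 * c ^ 2) = (2 - c) ^ 2 / (3 * c ^ 2) := by
      ring
    rw [e5]
    field_simp
    linear_combination hs
  refine tendsto_of_tendsto_of_tendsto_of_le_of_le' (g := fun x =>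
    κ * (N x / (x ^ 2 * (N x / B x) ^ 2 + B x))) (h := fun x => κ * (N x / B x)) ?_ ?_
    (hbounds.mono fun _ h => h.1) (hbounds.mono fun _ h => h.2)
  · have hcont : Continuous fun x => κ * (N x / (x ^ 2 * (N x / B x) ^ 2 + B x)) := by
      refine continuous_const.mul (hNc.div ?_ fun x => ?_)
      · exact ((continuous_id.pow 2).mul ((hNc.div hBc fun x => (hBpos x).ne').pow 2)).add hBc
      · have := hBpos x
        positivity
    have := (hcont.tendsto 0).mono_left (nhdsWithin_le_nhds (s := {0}ᶜ))
    rw [← hlim]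
    simpa using this
  · have hcont : Continuous fun x => κ * (N x / B x) :=
      continuous_const.mul (hNc.div hBc fun x => (hBpos x).ne')
    have := (hcont.tendsto 0).mono_left (nhdsWithin_le_nhds (s := {0}ᶜ))
    rw [← hlim]
    exact this

theorem tendsto_densityFormula_two :
    Tendsto (densityFormula 2) (𝓝[≠] 0) atTop := by
  rw [tendsto_atTop]
  intro K
  have hpi := Real.pi_pos
  set κ := √3 / (2 * Real.pi) with hκ
  have hκ0 : 0 < κ := by have : 0 < √3 := Real.sqrt_pos.2 (by norm_num); positivity
  set A := |K| / κ with hA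
  have hA0 : 0 ≤ A := by positivity
  have hd0 : ∀ x : ℝ, x ≠ 0 → -d 2 x = (27 - x ^ 2) / (1728 * x ^ 2) := fun x hx => by
    unfold d d₀ d₂ d₄
    field_simp
    ring
  have h1 : Tendsto (fun x : ℝ => 26 / (1728 * x ^ 2)) (𝓝[≠] 0) atTop := by
    have : Tendsto (fun x : ℝ => 1728 * x ^ 2) (𝓝[≠] 0) (𝓝[>] 0) := by
      refine tendsto_nhdsWithin_iff.2 ⟨?_, ?_⟩
      · have : Continuous fun x : ℝ => 1728 * x ^ 2 := by fun_prop
        simpa using (this.tendsto 0).mono_left (nhdsWithin_le_nhds (s := {0}ᶜ))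
      · filter_upwards [self_mem_nhdsWithin] with x hx
        have : x ≠ 0 := hx
        exact Set.mem_Ioi.2 (by positivity)
    simp_rw [div_eq_mul_inv]
    exact (tendsto_inv_nhdsGT_zero.comp this).const_mul_atTop (by norm_num)
  have h2 : ∀ᶠ x : ℝ in 𝓝[≠] 0, |x| < 1 := by
    refine nhdsWithin_le_nhds ?_
    have := (continuous_abs : Continuous fun x : ℝ => |x|).tendsto 0
    rw [abs_zero] at this
    exact this.eventually_lt_const one_pos
  filter_upwards [h1.eventually_gt_atTop ((A ^ 3 + 3 * A) ^ 2), h2, self_mem_nhdsWithin]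
    with x hx hx1 hx0
  have hx0' : x ≠ 0 := hx0
  have hxsq : x ^ 2 < 1 := by rw [← sq_abs]; nlinarith [abs_nonneg x]
  have hD : (A ^ 3 + 3 * A) ^ 2 < -d 2 x := by
    rw [hd0 x hx0']
    refine hx.trans_le ?_
    gcongr
    linarith
  obtain ⟨δ, hδ, hf, he⟩ := exists_densityFormula_eq two_pos hx0'
    (by have := sq_nonneg (A ^ 3 + 3 * A); linarith)
  have hq : depressedQ 2 x = 1 / 12 := by
    unfold depressedQ; norm_num
  rw [hq] at he
  have hsq : A ^ 3 + 3 * A < √(-d 2 x) := Real.lt_sqrt_of_sq_lt hD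
  have hAδ : A ≤ δ := by
    by_contra h
    push Not at h
    have : δ ^ 3 ≤ A ^ 3 := pow_le_pow_left₀ hδ h.le 3
    have := pow_nonneg hA0 3
    nlinarith
  rw [hf]
  calc K ≤ |K| := le_abs_self K
    _ = κ * A := by rw [hA]; field_simp
    _ ≤ κ * δ := by gcongr

/-! ### Measures whose Stieltjes transform solves the cubic equation -/

section Limit

variable {c : ℝ} {F : Measure ℝ} [IsProbabilityMeasure F]

theorem norm_root_le (hc : 0 < c) {a : ℝ} (ha : 0 < a) {z m : ℂ} (hz : a ≤ ‖z‖)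
    (h : lsdCubic c z m = 0) : ‖m‖ ≤ 1 + (|2 * c - c ^ 2| / a + 1 + 1 / a) / c ^ 2 := by
  set A := |2 * c - c ^ 2| with hA
  have hA0 : 0 ≤ A := abs_nonneg _
  by_cases hm : ‖m‖ ≤ 1
  · have : 0 ≤ (A / a + 1 + 1 / a) / c ^ 2 := by positivity
    linarith
  push Not at hm
  have hz0 : 0 < ‖z‖ := ha.trans_le hz
  have h1 : (c : ℂ) ^ 2 * z * m ^ 3 = ((2 * c - c ^ 2 : ℝ) : ℂ) * m ^ 2 + z * m + 1 := by
    unfold lsdCubic at h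
    push_cast
    linear_combination -h
  have h2 : c ^ 2 * ‖z‖ * ‖m‖ ^ 3 ≤ A * ‖m‖ ^ 2 + ‖z‖ * ‖m‖ + 1 := by
    have e : ‖(c : ℂ) ^ 2 * z * m ^ 3‖ = c ^ 2 * ‖z‖ * ‖m‖ ^ 3 := by
      simp
    rw [← e, h1]
    refine (norm_add₃_le).trans ?_
    rw [norm_mul, norm_mul, norm_pow, Complex.norm_real, Real.norm_eq_abs, norm_one]
  have h3 : c ^ 2 * ‖z‖ * ‖m‖ ^ 3 ≤ (A + ‖z‖ + 1) * ‖m‖ ^ 2 := by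
    refine h2.trans ?_
    have : ‖m‖ ≤ ‖m‖ ^ 2 := by nlinarith
    have : 1 ≤ ‖m‖ ^ 2 := by nlinarith
    nlinarith
  have h4 : c ^ 2 * ‖z‖ * ‖m‖ ≤ A + ‖z‖ + 1 := by
    have : 0 < ‖m‖ ^ 2 := by positivity
    refine le_of_mul_le_mul_right ?_ this
    linarith
  have h5 : ‖m‖ ≤ (A / a + 1 + 1 / a) / c ^ 2 := by
    rw [le_div_iff₀ (by positivity)]
    have : ‖m‖ * c ^ 2 ≤ (A + ‖z‖ + 1) / ‖z‖ := by
      rw [le_div_iff₀ hz0]; linarith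
    refine this.trans ?_
    have e : (A + ‖z‖ + 1) / ‖z‖ = A / ‖z‖ + 1 + 1 / ‖z‖ := by field_simp
    rw [e]
    gcongr
  linarith

theorem tendsto_boundary (a : ℝ) :
    Tendsto (fun ε : ℝ => (a : ℂ) + ε * Complex.I) (𝓝[>] 0) (𝓝 (a : ℂ)) := by
  have : Continuous fun ε : ℝ => (a : ℂ) + ε * Complex.I := by fun_prop
  simpa using (this.tendsto 0).mono_left (nhdsWithin_le_nhds (s := Set.Ioi 0))

theorem abs_le_norm_boundary (a ε : ℝ) : |a| ≤ ‖(a : ℂ) + ε * Complex.I‖ := by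
  have := Complex.abs_re_le_norm ((a : ℂ) + ε * Complex.I)
  simpa using this

/-- Boundary values of the imaginary part of the Stieltjes transform. -/
theorem tendsto_im_stieltjes (hc : 0 < c)
    (hF : ∀ z : ℂ, 0 < z.im → lsdCubic c z (stieltjes F z) = 0) {x : ℝ} (hx : x ≠ 0) :
    Tendsto (fun ε : ℝ => (stieltjes F (x + ε * Complex.I)).im) (𝓝[>] 0)
      (𝓝 (Real.pi * densityFormula c x)) := by
  refine tendsto_of_subseq_tendsto fun ε hε => ?_
  rw [tendsto_nhdsWithin_iff] at hε
  obtain ⟨hε0, hεpos⟩ := hε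
  have hax : 0 < |x| := abs_pos.2 hx
  set K := 1 + (|2 * c - c ^ 2| / |x| + 1 + 1 / |x|) / c ^ 2
  have him : ∀ n, 0 < ε n → 0 < ((x : ℂ) + ε n * Complex.I).im := fun n hn => by simpa using hn
  have hmem : ∀ᶠ n in atTop, stieltjes F (x + ε n * Complex.I) ∈ Metric.closedBall (0 : ℂ) K := by
    filter_upwards [hεpos] with n hn
    rw [mem_closedBall_zero_iff]
    exact norm_root_le hc hax (abs_le_norm_boundary x _) (hF _ (him n hn))
  obtain ⟨w, -, φ, hφ, hw⟩ := (isCompact_closedBall (0 : ℂ) K).tendsto_subseq' hmem.frequently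
  refine ⟨φ, ?_⟩
  have hposφ : ∀ᶠ n in atTop, 0 < ε (φ n) := hφ.tendsto_atTop.eventually hεpos
  have hε' : Tendsto (fun n => ε (φ n)) atTop (𝓝[>] 0) :=
    tendsto_nhdsWithin_iff.2 ⟨hε0.comp hφ.tendsto_atTop, hposφ⟩
  have hz := (tendsto_boundary x).comp hε'
  simp only [Function.comp_def] at hw hz
  have hroot : lsdCubic c x w = 0 := by
    have hcont : Continuous fun p : ℂ × ℂ => lsdCubic c p.1 p.2 := by unfold lsdCubic; fun_prop
    have h1 := (hcont.tendsto (x, w)).comp (hz.prodMk_nhds hw)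
    refine tendsto_nhds_unique h1 (tendsto_const_nhds.congr' ?_)
    filter_upwards [hposφ] with n hn
    exact (hF _ (him _ hn)).symm
  have hwim : Tendsto (fun n => (stieltjes F (x + ε (φ n) * Complex.I)).im) atTop (𝓝 w.im) :=
    (Complex.continuous_im.tendsto w).comp hw
  have hw0 : 0 ≤ w.im := by
    refine ge_of_tendsto hwim ?_
    filter_upwards [hposφ] with n hn using (stieltjes_im_pos F (him _ hn)).le
  convert hwim using 2
  rcases hw0.eq_or_lt with h0 | h0
  · rw [← h0]
    have hd : 0 ≤ d c x := by
      by_contra hd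
      obtain ⟨ρ, rfl⟩ : ∃ ρ : ℝ, w = ρ := ⟨w.re, Complex.ext (by simp) (by simp [← h0])⟩
      have h1 := real_root_ineq hc hx (not_le.1 hd) hroot
      have hcont1 : Continuous fun m : ℂ => 2 * c * ‖m‖ ^ 2 * (1 + c ^ 2 * ‖m‖ ^ 2) := by fun_prop
      have hcont2 : Continuous fun m : ℂ => ‖1 - (c : ℂ) ^ 2 * m ^ 2‖ ^ 2 := by fun_prop
      have h2 := le_of_tendsto_of_tendsto ((hcont1.tendsto _).comp hw) ((hcont2.tendsto _).comp hw)
        (by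
          filter_upwards [hposφ] with n hn
          exact cubic_im_ineq (him _ hn) (stieltjes_im_pos F (him _ hn)) (hF _ (him _ hn)))
      have e : ‖1 - (c : ℂ) ^ 2 * (ρ : ℂ) ^ 2‖ ^ 2 = (1 - c ^ 2 * ρ ^ 2) ^ 2 := by
        have : 1 - (c : ℂ) ^ 2 * (ρ : ℂ) ^ 2 = ((1 - c ^ 2 * ρ ^ 2 : ℝ) : ℂ) := by push_cast; ring
        rw [this, Complex.norm_real, Real.norm_eq_abs, sq_abs]
      rw [e, Complex.norm_real, Real.norm_eq_abs, sq_abs] at h2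
      linarith
    simp [densityFormula, Vplus, Vminus, Real.sqrt_eq_zero_of_nonpos (neg_nonpos.2 hd)]
  · exact ((im_root_eq hc hx h0 hroot).2).symm

theorem measure_singleton_eq_zero (hc : 0 < c)
    (hF : ∀ z : ℂ, 0 < z.im → lsdCubic c z (stieltjes F z) = 0) {x : ℝ} (hx : x ≠ 0) :
    F.real {x} = 0 := by
  have h1 := (tendsto_atom F x).norm
  have hax : 0 < |x| := abs_pos.2 hx
  set K := 1 + (|2 * c - c ^ 2| / |x| + 1 + 1 / |x|) / c ^ 2
  have h2 : Tendsto (fun ε : ℝ => |ε| * K) (𝓝[>] 0) (𝓝 0) := by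
    have : Continuous fun ε : ℝ => |ε| * K := by fun_prop
    simpa using (this.tendsto 0).mono_left (nhdsWithin_le_nhds (s := Set.Ioi 0))
  have h3 := le_of_tendsto_of_tendsto h1 h2 (by
    filter_upwards [self_mem_nhdsWithin] with ε hε
    rw [norm_mul]
    gcongr
    · simp
    · exact norm_root_le hc hax (abs_le_norm_boundary x _) (hF _ (by simpa using hε)))
  simpa using h3

theorem continuousOn_stieltjes_line {ε : ℝ} (hε : 0 < ε) :
    Continuous fun t : ℝ => stieltjes F (t + ε * Complex.I) := by
  refine continuous_iff_continuousAt.2 fun t => ?_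
  have h : ContinuousAt (stieltjes F) (t + ε * Complex.I) :=
    (differentiableAt_stieltjes F (by simpa using hε)).continuousAt
  exact ContinuousAt.comp (f := fun t : ℝ => (t : ℂ) + ε * Complex.I) h (by fun_prop)

theorem measureReal_Ioo_eq_integral (hc : 0 < c)
    (hF : ∀ z : ℂ, 0 < z.im → lsdCubic c z (stieltjes F z) = 0) {a b : ℝ} (hab : a < b)
    (h0 : (0 : ℝ) ∉ Set.Icc a b) : F.real (Set.Ioo a b) = ∫ t in a..b, densityFormula c t := by
  have hne : ∀ t ∈ Set.Icc a b, t ≠ 0 := fun t ht h => h0 (h ▸ ht)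
  have hinv := tendsto_integral_im_stieltjes F hab
  rw [measure_singleton_eq_zero hc hF (hne a (Set.left_mem_Icc.2 hab.le)),
    measure_singleton_eq_zero hc hF (hne b (Set.right_mem_Icc.2 hab.le))] at hinv
  obtain ⟨r, hr, hrt⟩ : ∃ r : ℝ, 0 < r ∧ ∀ t ∈ Set.Icc a b, r ≤ |t| := by
    rcases lt_or_ge 0 a with h | h
    · exact ⟨a, h, fun t ht => ht.1.trans (le_abs_self t)⟩
    · have hb : b < 0 := by
        by_contra hb
        exact h0 ⟨h, not_lt.1 hb⟩
      exact ⟨-b, by linarith, fun t ht => by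
        have := neg_abs_le t
        linarith [ht.2]⟩
  set K := 1 + (|2 * c - c ^ 2| / r + 1 + 1 / r) / c ^ 2
  have hdom : Tendsto (fun ε : ℝ => ∫ t in a..b, (stieltjes F (t + ε * Complex.I)).im) (𝓝[>] 0)
      (𝓝 (∫ t in a..b, Real.pi * densityFormula c t)) := by
    refine intervalIntegral.tendsto_integral_filter_of_dominated_convergence (fun _ => K) ?_ ?_
      intervalIntegrable_const ?_
    · filter_upwards [self_mem_nhdsWithin] with ε hε
      exact (Complex.continuous_im.comp (continuousOn_stieltjes_line hε)).aestronglyMeasurable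
    · filter_upwards [self_mem_nhdsWithin] with ε hε
      refine ae_of_all _ fun t ht => ?_
      rw [Set.uIoc_of_le hab.le] at ht
      refine (Complex.abs_im_le_norm _).trans ?_
      exact norm_root_le hc hr ((hrt t ⟨ht.1.le, ht.2⟩).trans (abs_le_norm_boundary t _))
        (hF _ (by simpa using hε))
    · refine ae_of_all _ fun t ht => ?_
      rw [Set.uIoc_of_le hab.le] at ht
      exact tendsto_im_stieltjes hc hF (hne t ⟨ht.1.le, ht.2⟩)
  have h := tendsto_nhds_unique hinv hdom
  rw [intervalIntegral.integral_const_mul] at h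
  have := mul_left_cancel₀ Real.pi_pos.ne' h
  simpa using this

theorem cdf_eq_add_integral (hc : 0 < c)
    (hF : ∀ z : ℂ, 0 < z.im → lsdCubic c z (stieltjes F z) = 0) {a b : ℝ} (hab : a < b)
    (h0 : (0 : ℝ) ∉ Set.Icc a b) : cdf F b = cdf F a + ∫ t in a..b, densityFormula c t := by
  have hb : b ≠ 0 := fun h => h0 ⟨h ▸ hab.le, h.ge⟩
  rw [← measureReal_Ioo_eq_integral hc hF hab h0, cdf_eq_real, cdf_eq_real]
  have e : Set.Iic b = Set.Iic a ∪ (Set.Ioo a b ∪ {b}) := by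
    rw [Set.Ioo_union_right hab, Set.Iic_union_Ioc_eq_Iic hab.le]
  have h1 : F.real (Set.Ioo a b ∪ {b}) = F.real (Set.Ioo a b) := by
    rw [measureReal_union (by simp) (measurableSet_singleton b),
      measure_singleton_eq_zero hc hF hb, add_zero]
  rw [e, measureReal_union, h1]
  · rw [Set.Ioo_union_right hab]
    exact Set.Iic_disjoint_Ioc le_rfl
  · exact measurableSet_Ioo.union (measurableSet_singleton b)

theorem hasDerivAt_cdf (hc : 0 < c)
    (hF : ∀ z : ℂ, 0 < z.im → lsdCubic c z (stieltjes F z) = 0) {x : ℝ} (hx : x ≠ 0) :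
    HasDerivAt (fun t : ℝ => cdf F t) (densityFormula c x) x := by
  obtain ⟨a, hax, b, hxb, h0⟩ : ∃ a, a < x ∧ ∃ b, x < b ∧ (0 : ℝ) ∉ Set.Icc a b := by
    rcases lt_or_gt_of_ne hx with h | h
    · exact ⟨2 * x, by linarith, x / 2, by linarith, fun h' => by linarith [h'.2]⟩
    · exact ⟨x / 2, by linarith, 2 * x, by linarith, fun h' => by linarith [h'.1]⟩
  have hcontOn : ∀ t ∈ Set.Icc a b, ContinuousAt (densityFormula c) t := fun t ht =>
    continuousAt_densityFormula fun h => h0 (h ▸ ht)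
  have hder : HasDerivAt (fun u => cdf F a + ∫ t in a..u, densityFormula c t)
      (densityFormula c x) x := by
    refine HasDerivAt.const_add _ (intervalIntegral.integral_hasDerivAt_right ?_ ?_
      (hcontOn x ⟨hax.le, hxb.le⟩))
    · refine ContinuousOn.intervalIntegrable fun t ht => ?_
      rw [Set.uIcc_of_le hax.le] at ht
      exact (hcontOn t ⟨ht.1, ht.2.trans hxb.le⟩).continuousWithinAt
    · refine ContinuousOn.stronglyMeasurableAtFilter (s := Set.Ioo a b) isOpen_Ioo
        (fun t ht => (hcontOn t ⟨ht.1.le, ht.2.le⟩).continuousWithinAt) x ⟨hax, hxb⟩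
  refine hder.congr_of_eventuallyEq ?_
  filter_upwards [Ioo_mem_nhds hax hxb] with t ht
  exact cdf_eq_add_integral hc hF ht.1 fun h => h0 ⟨h.1, h.2.trans ht.2.le⟩

theorem continuousAt_cdf_iff (F : Measure ℝ) [IsProbabilityMeasure F] (a : ℝ) :
    ContinuousAt (fun t : ℝ => cdf F t) a ↔ F.real {a} = 0 := by
  have h1 : F {a} = ENNReal.ofReal (cdf F a - Function.leftLim (cdf F) a) := by
    conv_lhs => rw [← measure_cdf F]
    exact StieltjesFunction.measure_singleton _ _
  rw [(cdf F).mono.continuousAt_iff_leftLim_eq_rightLim, StieltjesFunction.rightLim_eq,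
    measureReal_eq_zero_iff, h1, ENNReal.ofReal_eq_zero]
  have := (cdf F).mono.leftLim_le (le_refl a)
  constructor
  · intro h; linarith
  · intro h; linarith

/-- The two candidates for the mass at the origin. -/
theorem atom_zero_eq (hF : ∀ z : ℂ, 0 < z.im → lsdCubic c z (stieltjes F z) = 0) :
    c ^ 2 * F.real {0} ^ 3 + (2 * c - c ^ 2) * F.real {0} ^ 2 = 0 := by
  have h1 := tendsto_atom F 0
  set g : ℝ → ℂ := fun ε => -(ε * Complex.I) * stieltjes F ((0 : ℝ) + ε * Complex.I)
  have h2 : Tendsto (fun ε : ℝ => (ε * Complex.I : ℂ)) (𝓝[>] 0) (𝓝 0) := by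
    have : Continuous fun ε : ℝ => (ε * Complex.I : ℂ) := by fun_prop
    simpa using (this.tendsto 0).mono_left (nhdsWithin_le_nhds (s := Set.Ioi 0))
  have h3 : Tendsto (fun ε : ℝ => (c : ℂ) ^ 2 * g ε ^ 3 + (2 * c - c ^ 2) * g ε ^ 2
      - (ε * Complex.I) ^ 2 * g ε + (ε * Complex.I) ^ 2) (𝓝[>] 0)
      (𝓝 ((c : ℂ) ^ 2 * (F.real {0} : ℂ) ^ 3 + (2 * c - c ^ 2) * (F.real {0} : ℂ) ^ 2
        - 0 ^ 2 * (F.real {0} : ℂ) + 0 ^ 2)) :=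
    (((h1.pow 3).const_mul _).add ((h1.pow 2).const_mul _)).sub ((h2.pow 2).mul h1) |>.add
      (h2.pow 2)
  have h4 := tendsto_nhds_unique h3 (tendsto_const_nhds.congr' (f₁ := fun _ => (0 : ℂ)) (by
    filter_upwards [self_mem_nhdsWithin] with ε hε
    have h := hF ((0 : ℝ) + ε * Complex.I) (by simpa using hε)
    unfold lsdCubic at h
    simp only [g]
    simp only [Complex.ofReal_zero, zero_add] at h ⊢
    linear_combination -(ε * Complex.I) ^ 2 * h))
  simp only [ne_eq, OfNat.ofNat_ne_zero, not_false_eq_true, zero_pow, zero_mul, sub_zero,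
    add_zero] at h4
  exact_mod_cast h4

theorem atom_zero_of_lt_two (hc : 0 < c) (hc2 : c < 2)
    (hF : ∀ z : ℂ, 0 < z.im → lsdCubic c z (stieltjes F z) = 0) : F.real {0} = 0 := by
  have h := atom_zero_eq hF
  have h0 : 0 ≤ F.real {0} := measureReal_nonneg
  have h1 : F.real {0} ^ 2 * (c ^ 2 * F.real {0} + (2 * c - c ^ 2)) = 0 := by linear_combination h
  rcases mul_eq_zero.1 h1 with h2 | h2
  · exact pow_eq_zero_iff two_ne_zero |>.1 h2
  · have : 0 < 2 * c - c ^ 2 := by nlinarith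
    have : 0 ≤ c ^ 2 * F.real {0} := by positivity
    linarith

theorem atom_zero_ne_zero (hc2 : 2 < c)
    (hF : ∀ z : ℂ, 0 < z.im → lsdCubic c z (stieltjes F z) = 0) : F.real {0} ≠ 0 := by
  intro h0
  have h1 := tendsto_atom F 0
  rw [h0] at h1
  set m : ℝ → ℂ := fun ε => stieltjes F ((0 : ℝ) + ε * Complex.I) with hm
  set κ : ℝ := c ^ 2 - 2 * c with hκ
  have hκ0 : 0 < κ := by rw [hκ]; nlinarith
  set g : ℝ → ℂ := fun ε => -(ε * Complex.I) * m ε with hg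
  have hden : Tendsto (fun ε => (κ : ℂ) - c ^ 2 * g ε) (𝓝[>] 0) (𝓝 ((κ : ℂ) - c ^ 2 * (0 : ℝ))) :=
    tendsto_const_nhds.sub (h1.const_mul _)
  have hκc : (κ : ℂ) ≠ 0 := by exact_mod_cast hκ0.ne'
  have hden0 : (κ : ℂ) - c ^ 2 * (0 : ℝ) ≠ 0 := by
    rw [Complex.ofReal_zero, mul_zero, sub_zero]
    exact hκc
  have hsq : Tendsto (fun ε => m ε ^ 2) (𝓝[>] 0) (𝓝 ((1 / κ : ℝ) : ℂ)) := by
    have h2 : Tendsto (fun ε => (1 - g ε) / ((κ : ℂ) - c ^ 2 * g ε)) (𝓝[>] 0)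
        (𝓝 ((1 - (0 : ℝ)) / ((κ : ℂ) - c ^ 2 * (0 : ℝ)))) :=
      (tendsto_const_nhds.sub h1).div hden hden0
    have e : ((1 / κ : ℝ) : ℂ) = (1 - (0 : ℝ)) / ((κ : ℂ) - c ^ 2 * (0 : ℝ)) := by simp
    rw [e]
    refine h2.congr' ?_
    filter_upwards [self_mem_nhdsWithin, hden.eventually_ne hden0] with ε hε hne
    have h := hF ((0 : ℝ) + ε * Complex.I) (by simpa using hε)
    rw [div_eq_iff hne]
    unfold lsdCubic at h
    simp only [hg, hm, hκ]
    push_cast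
    simp only [Complex.ofReal_zero, zero_add] at h ⊢
    linear_combination h
  have hlim1 : Tendsto (fun ε => 2 * c * ‖m ε ^ 2‖ * (1 + c ^ 2 * ‖m ε ^ 2‖)) (𝓝[>] 0)
      (𝓝 (2 * c * ‖((1 / κ : ℝ) : ℂ)‖ * (1 + c ^ 2 * ‖((1 / κ : ℝ) : ℂ)‖))) :=
    (hsq.norm.const_mul _).mul (tendsto_const_nhds.add (hsq.norm.const_mul _))
  have hlim2 : Tendsto (fun ε => ‖1 - (c : ℂ) ^ 2 * m ε ^ 2‖ ^ 2) (𝓝[>] 0)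
      (𝓝 (‖1 - (c : ℂ) ^ 2 * ((1 / κ : ℝ) : ℂ)‖ ^ 2)) :=
    ((tendsto_const_nhds.sub (hsq.const_mul _)).norm).pow 2
  have hle := le_of_tendsto_of_tendsto hlim1 hlim2 (by
    filter_upwards [self_mem_nhdsWithin] with ε hε
    have hz : 0 < (((0 : ℝ) : ℂ) + ε * Complex.I).im := by simpa using hε
    have := cubic_im_ineq hz (stieltjes_im_pos F hz) (hF _ hz)
    rw [norm_pow]
    exact this)
  have e : 1 - (c : ℂ) ^ 2 * ((1 / κ : ℝ) : ℂ) = ((1 - c ^ 2 * (1 / κ) : ℝ) : ℂ) := by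
    push_cast; ring
  rw [e, Complex.norm_real, Complex.norm_real, Real.norm_eq_abs, Real.norm_eq_abs, sq_abs,
    abs_of_pos (by positivity)] at hle
  have hc' : 0 < c - 2 := by linarith
  have hκ' : κ = c * (c - 2) := by rw [hκ]; ring
  rw [hκ'] at hle
  have e1 : 2 * c * (1 / (c * (c - 2))) * (1 + c ^ 2 * (1 / (c * (c - 2))))
      = 4 * (c - 1) / (c - 2) ^ 2 := by
    field_simp
    ring
  have e2 : (1 - c ^ 2 * (1 / (c * (c - 2)))) ^ 2 = 4 / (c - 2) ^ 2 := by
    field_simp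
    ring
  rw [e1, e2, div_le_div_iff_of_pos_right (by positivity)] at hle
  linarith

theorem hasDerivAt_cdf_zero (hc : 0 < c) (hc2 : c < 2)
    (hF : ∀ z : ℂ, 0 < z.im → lsdCubic c z (stieltjes F z) = 0) :
    HasDerivAt (fun t : ℝ => cdf F t) (1 / (Real.pi * √(2 * c - c ^ 2))) 0 := by
  set g : ℝ → ℝ := fun x => if x = 0 then 1 / (Real.pi * √(2 * c - c ^ 2)) else densityFormula c x
    with hg
  have h := hasDerivAt_of_hasDerivAt_of_ne (f := fun t : ℝ => cdf F t) (g := g) (x := 0)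
    (fun y hy => by
      simp only [hg, if_neg hy]
      exact hasDerivAt_cdf hc hF hy)
    ((continuousAt_cdf_iff F 0).2 (atom_zero_of_lt_two hc hc2 hF)) (by
      rw [← continuousWithinAt_compl_self]
      refine Tendsto.congr' (f₁ := densityFormula c) ?_ ?_
      · filter_upwards [self_mem_nhdsWithin] with x hx
        have hx' : x ≠ 0 := hx
        simp [hg, hx']
      · simpa [hg] using tendsto_densityFormula_zero hc hc2)
  simpa [hg] using h

theorem not_differentiableAt_cdf_two
    (hF : ∀ z : ℂ, 0 < z.im → lsdCubic 2 z (stieltjes F z) = 0) :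
    ¬ DifferentiableAt ℝ (fun t : ℝ => cdf F t) 0 := by
  intro hdiff
  set D := deriv (fun t : ℝ => cdf F t) 0
  have hslope := hasDerivAt_iff_tendsto_slope.1 hdiff.hasDerivAt
  have h1 : ∀ᶠ x : ℝ in 𝓝[>] 0, slope (fun t : ℝ => cdf F t) 0 x < D + 1 :=
    (hslope.mono_left (nhdsWithin_mono 0 fun x hx => (ne_of_gt hx : x ≠ 0))).eventually_lt_const
      (by linarith)
  have h2 : ∀ᶠ x : ℝ in 𝓝[>] 0, D + 1 < densityFormula 2 x :=
    (tendsto_densityFormula_two.mono_left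
      (nhdsWithin_mono 0 fun x hx => (ne_of_gt hx : x ≠ 0))).eventually_gt_atTop _
  obtain ⟨h, hh, hsub⟩ := mem_nhdsGT_iff_exists_Ioo_subset.1 (h1.and h2)
  have hh0 : 0 < h := hh
  obtain ⟨ξ, hξ, hξe⟩ := exists_hasDerivAt_eq_slope (fun t : ℝ => cdf F t) (densityFormula 2)
    (a := 0) (b := h / 2) (by linarith) (fun t ht => by
      rcases ht.1.eq_or_lt with h | h
      · rw [← h]; exact hdiff.continuousAt.continuousWithinAt
      · exact (hasDerivAt_cdf two_pos hF h.ne').continuousAt.continuousWithinAt)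
    (fun t ht => hasDerivAt_cdf two_pos hF ht.1.ne')
  have a1 := (hsub ⟨by linarith, by linarith⟩ : h / 2 ∈ _).1
  have a2 := (hsub ⟨hξ.1, by linarith [hξ.2]⟩ : ξ ∈ _).2
  simp only [slope_def_field] at a1
  linarith

theorem differentiableAt_cdf_zero_iff (hc : 0 < c)
    (hF : ∀ z : ℂ, 0 < z.im → lsdCubic c z (stieltjes F z) = 0) :
    DifferentiableAt ℝ (fun t : ℝ => cdf F t) 0 ↔ c < 2 := by
  refine ⟨fun h => ?_, fun h => (hasDerivAt_cdf_zero hc h hF).differentiableAt⟩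
  by_contra hc2
  rcases (not_lt.1 hc2).eq_or_lt with rfl | h2
  · exact not_differentiableAt_cdf_two hF h
  · exact atom_zero_ne_zero h2 hF ((continuousAt_cdf_iff F 0).1 h.continuousAt)

theorem continuousAt_deriv_cdf (hc : 0 < c)
    (hF : ∀ z : ℂ, 0 < z.im → lsdCubic c z (stieltjes F z) = 0) {x : ℝ}
    (hx : DifferentiableAt ℝ (fun t : ℝ => cdf F t) x) :
    ContinuousAt (deriv fun t : ℝ => cdf F t) x := by
  by_cases h0 : x = 0
  · subst h0
    have hc2 := (differentiableAt_cdf_zero_iff hc hF).1 hx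
    rw [← continuousWithinAt_compl_self]
    refine Tendsto.congr' (f₁ := densityFormula c) ?_ ?_
    · filter_upwards [self_mem_nhdsWithin] with y hy
      exact (hasDerivAt_cdf hc hF hy).deriv.symm
    · rw [(hasDerivAt_cdf_zero hc hc2 hF).deriv]
      exact tendsto_densityFormula_zero hc hc2
  · refine (continuousAt_densityFormula (c := c) h0).congr ?_
    filter_upwards [isOpen_ne.mem_nhds h0] with y hy
    exact (hasDerivAt_cdf hc hF hy).deriv.symm

end Limit

/-! ### Resolvents of Hermitian matrices -/

section Resolvent

open Matrix

variable {ι : Type*} [Fintype ι]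

/-- The squared Euclidean norm of a complex vector. -/
def sqNorm (u : ι → ℂ) : ℝ := ∑ i, ‖u i‖ ^ 2

theorem sqNorm_nonneg (u : ι → ℂ) : 0 ≤ sqNorm u := Finset.sum_nonneg fun _ _ => sq_nonneg _

theorem star_dotProduct_self (u : ι → ℂ) : star u ⬝ᵥ u = (sqNorm u : ℂ) := by
  simp [dotProduct, sqNorm, ← Complex.conj_mul']

theorem norm_star_dotProduct_sq_le (u w : ι → ℂ) :
    ‖star u ⬝ᵥ w‖ ^ 2 ≤ sqNorm u * sqNorm w := by
  have h1 : ‖star u ⬝ᵥ w‖ ≤ ∑ i, ‖u i‖ * ‖w i‖ := by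
    refine (norm_sum_le _ _).trans_eq (Finset.sum_congr rfl fun i _ => ?_)
    simp
  calc ‖star u ⬝ᵥ w‖ ^ 2 ≤ (∑ i, ‖u i‖ * ‖w i‖) ^ 2 := by gcongr
    _ ≤ _ := Finset.sum_mul_sq_le_sq_mul_sq _ _ _

theorem sqNorm_eq_zero {u : ι → ℂ} (h : sqNorm u = 0) : u = 0 := by
  funext i
  have := (Finset.sum_eq_zero_iff_of_nonneg fun i _ => sq_nonneg ‖u i‖).1 h i (Finset.mem_univ i)
  simpa using this

variable [DecidableEq ι]

/-- The resolvent `(H - z)⁻¹` of a matrix. -/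
def resolv (H : Matrix ι ι ℂ) (z : ℂ) : Matrix ι ι ℂ := (H - z • 1)⁻¹

variable {H : Matrix ι ι ℂ} {z : ℂ}

theorem isUnit_sub_smul (hH : H.IsHermitian) (hz : 0 < z.im) : IsUnit (H - z • 1) := by
  rw [← mulVec_injective_iff_isUnit]
  refine (injective_iff_map_eq_zero (H - z • 1).mulVecLin).2 fun w hw => ?_
  have hw' : H *ᵥ w = z • w := by
    simpa [sub_mulVec, smul_mulVec, sub_eq_zero] using hw
  have h1 := hH.im_star_dotProduct_mulVec_self w
  rw [hw', dotProduct_smul, star_dotProduct_self] at h1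
  simp at h1
  rcases h1 with h1 | h1
  · exact absurd h1 hz.ne'
  · exact sqNorm_eq_zero h1

theorem sub_mul_resolv (hH : H.IsHermitian) (hz : 0 < z.im) :
    (H - z • 1) * resolv H z = 1 :=
  mul_nonsing_inv _ ((isUnit_iff_isUnit_det _).1 (isUnit_sub_smul hH hz))

theorem resolv_mul_sub (hH : H.IsHermitian) (hz : 0 < z.im) :
    resolv H z * (H - z • 1) = 1 :=
  nonsing_inv_mul _ ((isUnit_iff_isUnit_det _).1 (isUnit_sub_smul hH hz))

/-- The Ward identity for the quadratic form of the resolvent. -/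
theorem im_star_dotProduct_resolv (hH : H.IsHermitian) (hz : 0 < z.im) (u : ι → ℂ) :
    (star u ⬝ᵥ (resolv H z *ᵥ u)).im = z.im * sqNorm (resolv H z *ᵥ u) := by
  set w := resolv H z *ᵥ u with hw
  have hu : u = H *ᵥ w - z • w := by
    have : (H - z • 1) *ᵥ w = u := by
      rw [hw, mulVec_mulVec, sub_mul_resolv hH hz, one_mulVec]
    rw [← this, sub_mulVec, smul_mulVec, one_mulVec]
  have h1 := hH.im_star_dotProduct_mulVec_self w
  have h2 : star (H *ᵥ w) ⬝ᵥ w = star w ⬝ᵥ (H *ᵥ w) := by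
    rw [star_mulVec, hH.eq, ← dotProduct_mulVec]
  rw [hu, star_sub, sub_dotProduct, h2, star_smul, smul_dotProduct, star_dotProduct_self]
  simp at h1 ⊢
  rw [h1]

theorem im_star_dotProduct_resolv' (hH : H.IsHermitian) (hz : 0 < z.im) (u : ι → ℂ) :
    (star u ⬝ᵥ (resolv H z *ᵥ u)).im = z.im * sqNorm ((resolv H z)ᴴ *ᵥ u) := by
  set w := (resolv H z)ᴴ *ᵥ u with hw
  have hu : u = H *ᵥ w - star z • w := by
    have h0 := congrArg conjTranspose (resolv_mul_sub hH hz)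
    rw [conjTranspose_mul, conjTranspose_sub, hH.eq, conjTranspose_smul, conjTranspose_one] at h0
    have : (H - star z • 1) *ᵥ w = u := by
      rw [hw, mulVec_mulVec, h0, one_mulVec]
    rw [← this, sub_mulVec, smul_mulVec, one_mulVec]
  have h1 := hH.im_star_dotProduct_mulVec_self w
  have h2 : star u ⬝ᵥ (resolv H z *ᵥ u) = star w ⬝ᵥ u := by
    rw [hw, star_mulVec, conjTranspose_conjTranspose, dotProduct_mulVec]
  rw [h2]
  conv_lhs => rw [hu]
  rw [dotProduct_sub, dotProduct_smul, star_dotProduct_self]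
  simp at h1 ⊢
  rw [h1]

theorem sqNorm_resolv_mulVec_le (hH : H.IsHermitian) (hz : 0 < z.im) (u : ι → ℂ) :
    sqNorm (resolv H z *ᵥ u) ≤ sqNorm u / z.im ^ 2 := by
  have h1 := im_star_dotProduct_resolv hH hz u
  have h2 := norm_star_dotProduct_sq_le u (resolv H z *ᵥ u)
  have h3 := Complex.abs_im_le_norm (star u ⬝ᵥ (resolv H z *ᵥ u))
  set N := sqNorm (resolv H z *ᵥ u)
  have hN : 0 ≤ N := sqNorm_nonneg _
  have hu := sqNorm_nonneg u
  rw [le_div_iff₀ (by positivity)]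
  rw [h1, abs_of_nonneg (by positivity)] at h3
  have h4 : (z.im * N) ^ 2 ≤ sqNorm u * N := (pow_le_pow_left₀ (by positivity) h3 2).trans h2
  rcases hN.eq_or_lt with h0 | h0
  · rw [← h0, zero_mul]; exact hu
  · refine le_of_mul_le_mul_right ?_ h0
    linarith

theorem norm_resolv_form_le (hH : H.IsHermitian) (hz : 0 < z.im) (u w : ι → ℂ) :
    ‖star u ⬝ᵥ (resolv H z *ᵥ w)‖ ≤ (sqNorm u + sqNorm w) / (2 * z.im) := by
  have h1 := norm_star_dotProduct_sq_le u (resolv H z *ᵥ w)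
  have h2 := sqNorm_resolv_mulVec_le hH hz w
  have hu := sqNorm_nonneg u
  have hw := sqNorm_nonneg w
  rw [← pow_le_pow_iff_left₀ (norm_nonneg _) (by positivity) two_ne_zero]
  calc _ ≤ sqNorm u * (sqNorm w / z.im ^ 2) := h1.trans (by gcongr)
    _ ≤ _ := by
      rw [div_pow, ← mul_div_assoc, div_le_div_iff₀ (by positivity) (by positivity)]
      have := sq_nonneg (sqNorm u - sqNorm w)
      have hz2 : 0 < z.im ^ 2 := by positivity
      nlinarith

theorem norm_resolv_apply_le (hH : H.IsHermitian) (hz : 0 < z.im) (i j : ι) :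
    ‖resolv H z i j‖ ≤ 1 / z.im := by
  have h := norm_resolv_form_le hH hz (Pi.single i 1) (Pi.single j 1)
  have hs : ∀ i : ι, sqNorm (Pi.single i (1 : ℂ)) = 1 := fun i => by
    unfold sqNorm
    rw [Finset.sum_eq_single i] <;> simp +contextual
  have e : star (Pi.single i (1 : ℂ)) = (Pi.single i 1 : ι → ℂ) := by
    rw [← Pi.single_star, star_one]
  rw [hs, hs, e, mulVec_single_one, single_one_dotProduct] at h
  refine h.trans_eq ?_
  field_simp
  norm_num

theorem sum_norm_resolv_sq_le (hH : H.IsHermitian) (hz : 0 < z.im) :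
    ∑ i, ∑ j, ‖resolv H z i j‖ ^ 2 ≤ Fintype.card ι / z.im ^ 2 := by
  rw [Finset.sum_comm]
  have h : ∀ j, ∑ i, ‖resolv H z i j‖ ^ 2 ≤ 1 / z.im ^ 2 := fun j => by
    have h := sqNorm_resolv_mulVec_le hH hz (Pi.single j 1)
    have hs : sqNorm (Pi.single j (1 : ℂ)) = 1 := by
      unfold sqNorm
      rw [Finset.sum_eq_single j] <;> simp +contextual
    rw [hs, mulVec_single_one] at h
    exact h
  refine (Finset.sum_le_sum fun j _ => h j).trans_eq ?_
  simp [div_eq_mul_inv]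

/-- A rank one Hermitian perturbation changes the trace of the resolvent by at most `1 / Im z`. -/
theorem norm_trace_resolv_rank_one_le (hH : H.IsHermitian) (hz : 0 < z.im) (t : ℝ) (u : ι → ℂ) :
    ‖(resolv (H + (t : ℂ) • vecMulVec u (star u)) z).trace - (resolv H z).trace‖ ≤ 1 / z.im := by
  have hH' : (H + (t : ℂ) • vecMulVec u (star u)).IsHermitian := by
    refine hH.add ?_
    simp [IsHermitian, conjTranspose_smul, conjTranspose_vecMulVec]
  set H' := H + (t : ℂ) • vecMulVec u (star u) with hH'def
  set G := resolv H z with hG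
  set G' := resolv H' z with hG'
  have hid : G' = G - (t : ℂ) • (G' * vecMulVec u (star u) * G) := by
    have h1 : G' * ((H' - z • 1) - (H - z • 1)) * G = G - G' := by
      rw [Matrix.mul_sub, Matrix.sub_mul, resolv_mul_sub hH' hz, Matrix.mul_assoc,
        sub_mul_resolv hH hz, Matrix.one_mul, Matrix.mul_one]
    have h2 : (H' - z • 1) - (H - z • 1) = (t : ℂ) • vecMulVec u (star u) := by
      rw [hH'def]; abel
    rw [h2, Matrix.mul_smul, Matrix.smul_mul] at h1
    rw [h1]; abel
  set q := star u ⬝ᵥ (G *ᵥ u) with hq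
  have hGu : (1 + t * q) • (G' *ᵥ u) = G *ᵥ u := by
    have h1 : G' *ᵥ u = G *ᵥ u - (t * q) • (G' *ᵥ u) := by
      conv_lhs => rw [hid]
      rw [sub_mulVec, smul_mulVec, ← mulVec_mulVec, ← mulVec_mulVec, vecMulVec_mulVec, ← hq,
        mul_smul]
      simp [mulVec_smul]
    rw [add_smul, one_smul]
    nth_rewrite 1 [h1]
    abel
  have htr : G'.trace - G.trace = -t * (star u ⬝ᵥ (G *ᵥ (G' *ᵥ u))) := by
    have h1 : (G' * vecMulVec u (star u) * G).trace = star u ⬝ᵥ (G *ᵥ (G' *ᵥ u)) := by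
      rw [trace_mul_comm, ← Matrix.mul_assoc, mul_vecMulVec, trace_vecMulVec, dotProduct_comm,
        mulVec_mulVec]
    conv_lhs => rw [hid]
    rw [trace_sub, trace_smul, h1]
    simp
  have hW := im_star_dotProduct_resolv hH hz u
  have hW' := im_star_dotProduct_resolv' hH hz u
  rw [← hG, ← hq] at hW hW'
  have hmul : (1 + t * q) * (star u ⬝ᵥ (G *ᵥ (G' *ᵥ u))) = star (Gᴴ *ᵥ u) ⬝ᵥ (G *ᵥ u) := by
    rw [← smul_eq_mul, ← dotProduct_smul, ← mulVec_smul, hGu, star_mulVec,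
      conjTranspose_conjTranspose, dotProduct_mulVec]
  have hCS := norm_star_dotProduct_sq_le (Gᴴ *ᵥ u) (G *ᵥ u)
  have hsame : sqNorm (Gᴴ *ᵥ u) = sqNorm (G *ᵥ u) :=
    mul_left_cancel₀ hz.ne' (hW'.symm.trans hW)
  set N := sqNorm (G *ᵥ u)
  have hN : 0 ≤ N := sqNorm_nonneg _
  rw [hsame, ← hmul, ← sq] at hCS
  have hCS' : ‖1 + t * q‖ * ‖star u ⬝ᵥ (G *ᵥ (G' *ᵥ u))‖ ≤ N := by
    rw [← norm_mul]
    exact (pow_le_pow_iff_left₀ (norm_nonneg _) hN two_ne_zero).1 hCS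
  have him : |t| * (z.im * N) ≤ ‖1 + t * q‖ := by
    have h := Complex.abs_im_le_norm (1 + t * q)
    have e : (1 + t * q).im = t * (z.im * N) := by
      rw [← hW]; simp
    rw [e, abs_mul, abs_of_nonneg (by positivity : 0 ≤ z.im * N)] at h
    exact h
  have hpos : 0 < ‖1 + t * q‖ := by
    refine norm_pos_iff.2 fun h0 => ?_
    rw [h0, norm_zero] at him
    rw [h0, zero_smul] at hGu
    have : q = 0 := by rw [hq, ← hGu]; simp
    rw [this] at h0
    simp at h0
  rw [htr, norm_mul, norm_neg, Complex.norm_real, Real.norm_eq_abs, le_div_iff₀ hz]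
  refine le_of_mul_le_mul_right ?_ hpos
  calc |t| * ‖star u ⬝ᵥ (G *ᵥ (G' *ᵥ u))‖ * z.im * ‖1 + t * q‖
      = |t| * z.im * (‖1 + t * q‖ * ‖star u ⬝ᵥ (G *ᵥ (G' *ᵥ u))‖) := by ring
    _ ≤ |t| * z.im * N := by gcongr
    _ ≤ 1 * ‖1 + t * q‖ := by linarith

theorem trace_resolv (hH : H.IsHermitian) (hz : 0 < z.im) :
    (resolv H z).trace = ∑ i, ((hH.eigenvalues i : ℂ) - z)⁻¹ := by
  set V : Matrix ι ι ℂ := (hH.eigenvectorUnitary : Matrix ι ι ℂ) with hV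
  have hVV : V * star V = 1 := Unitary.coe_mul_star_self hH.eigenvectorUnitary
  have hVV' : star V * V = 1 := Unitary.coe_star_mul_self hH.eigenvectorUnitary
  have hspec : H = V * diagonal (fun i => (hH.eigenvalues i : ℂ)) * star V := hH.spectral_theorem
  have hsub : H - z • 1 = V * diagonal (fun i => (hH.eigenvalues i : ℂ) - z) * star V := by
    have h1 : diagonal (fun i => (hH.eigenvalues i : ℂ) - z)
        = diagonal (fun i => (hH.eigenvalues i : ℂ)) - z • (1 : Matrix ι ι ℂ) := by
      rw [smul_one_eq_diagonal, diagonal_sub]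
    rw [h1, Matrix.mul_sub, Matrix.sub_mul, ← hspec, Matrix.mul_smul, Matrix.smul_mul,
      Matrix.mul_one, hVV]
  have hinv : resolv H z = V * diagonal (fun i => ((hH.eigenvalues i : ℂ) - z)⁻¹) * star V := by
    refine inv_eq_right_inv ?_
    rw [hsub]
    calc V * diagonal (fun i => (hH.eigenvalues i : ℂ) - z) * star V
          * (V * diagonal (fun i => ((hH.eigenvalues i : ℂ) - z)⁻¹) * star V)
        = V * (diagonal (fun i => (hH.eigenvalues i : ℂ) - z) * (star V * V)
          * diagonal (fun i => ((hH.eigenvalues i : ℂ) - z)⁻¹)) * star V := by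
          simp only [Matrix.mul_assoc]
      _ = 1 := by
          rw [hVV', Matrix.mul_one, diagonal_mul_diagonal]
          have : (fun i => ((hH.eigenvalues i : ℂ) - z) * ((hH.eigenvalues i : ℂ) - z)⁻¹)
              = fun _ => 1 := funext fun i => mul_inv_cancel₀ (ofReal_sub_ne_zero hz _)
          rw [this, diagonal_one, Matrix.mul_one, hVV]
  rw [hinv, trace_mul_comm, ← Matrix.mul_assoc, hVV', Matrix.one_mul, trace_diagonal]

theorem norm_trace_resolv_le (hH : H.IsHermitian) (hz : 0 < z.im) :
    ‖(resolv H z).trace‖ ≤ Fintype.card ι / z.im := by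
  rw [trace_resolv hH hz]
  refine (norm_sum_le_of_le _ fun i _ => norm_inv_ofReal_sub_le hz _).trans_eq ?_
  simp [div_eq_mul_inv]

end Resolvent

/-! ### The leave-one-column-out analysis -/

section Columns

open Matrix

variable {p n : ℕ}

/-- The Hermitian matrix `-i (x yᴴ - y xᴴ)` built from a pair of columns. -/
def pairMatrix (ξ : Fin 2 × Fin p → ℂ) : Matrix (Fin p) (Fin p) ℂ :=
  (-Complex.I) • (vecMulVec (fun a => ξ (0, a)) (star fun a => ξ (1, a))
    - vecMulVec (fun a => ξ (1, a)) (star fun a => ξ (0, a)))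

/-- The Hermitian matrix `-i n⁻¹ (X₁ X₂ᴴ - X₂ X₁ᴴ)` as a function of the pairs of columns. -/
def columnMatrix (x : Fin n → Fin 2 × Fin p → ℂ) : Matrix (Fin p) (Fin p) ℂ :=
  ((n : ℝ)⁻¹ : ℂ) • ∑ j, pairMatrix (x j)

theorem isHermitian_pairMatrix (ξ : Fin 2 × Fin p → ℂ) : (pairMatrix ξ).IsHermitian := by
  unfold pairMatrix
  simp [IsHermitian, conjTranspose_smul, conjTranspose_sub, conjTranspose_vecMulVec, ← smul_neg]

theorem pairMatrix_zero : pairMatrix (0 : Fin 2 × Fin p → ℂ) = 0 := by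
  ext i j
  simp [pairMatrix]

theorem isHermitian_columnMatrix (x : Fin n → Fin 2 × Fin p → ℂ) :
    (columnMatrix x).IsHermitian := by
  unfold columnMatrix IsHermitian
  rw [conjTranspose_smul, conjTranspose_sum]
  simp [(isHermitian_pairMatrix _).eq]

theorem columnMatrix_update (x : Fin n → Fin 2 × Fin p → ℂ) (j : Fin n) (e : Fin 2 × Fin p → ℂ) :
    columnMatrix (Function.update x j e)
      = columnMatrix (Function.update x j 0) + ((n : ℝ)⁻¹ : ℂ) • pairMatrix e := by
  unfold columnMatrix
  rw [← smul_add]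
  congr 1
  rw [← Finset.add_sum_erase _ _ (Finset.mem_univ j),
    ← Finset.add_sum_erase Finset.univ (fun i => pairMatrix (Function.update x j 0 i))
      (Finset.mem_univ j)]
  simp only [Function.update_self, pairMatrix_zero, zero_add]
  rw [add_comm]
  congr 1
  refine Finset.sum_congr rfl fun i hi => ?_
  rw [Function.update_of_ne (Finset.ne_of_mem_erase hi),
    Function.update_of_ne (Finset.ne_of_mem_erase hi)]

theorem pairMatrix_eq_rank_one (ξ : Fin 2 × Fin p → ℂ) :
    pairMatrix ξ
      = ((1 / 2 : ℝ) : ℂ) • vecMulVec (fun a => ξ (0, a) + Complex.I * ξ (1, a))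
          (star fun a => ξ (0, a) + Complex.I * ξ (1, a))
        + ((-(1 / 2) : ℝ) : ℂ) • vecMulVec (fun a => ξ (0, a) - Complex.I * ξ (1, a))
          (star fun a => ξ (0, a) - Complex.I * ξ (1, a)) := by
  ext i j
  simp [pairMatrix, vecMulVec_apply]
  ring

/-- Replacing a pair of columns changes the trace of the resolvent by at most `2 / Im z` compared
with deleting it. -/
theorem norm_trace_update_sub_le {z : ℂ} (hz : 0 < z.im) (x : Fin n → Fin 2 × Fin p → ℂ)
    (j : Fin n) (e : Fin 2 × Fin p → ℂ) :
    ‖(resolv (columnMatrix (Function.update x j e)) z).trace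
      - (resolv (columnMatrix (Function.update x j 0)) z).trace‖ ≤ 2 / z.im := by
  rw [columnMatrix_update x j e, pairMatrix_eq_rank_one, smul_add, smul_smul, smul_smul,
    ← add_assoc,
    ← Complex.ofReal_inv, ← Complex.ofReal_mul, ← Complex.ofReal_mul]
  set H := columnMatrix (Function.update x j 0)
  have hH : H.IsHermitian := isHermitian_columnMatrix _
  set u : Fin p → ℂ := fun a => e (0, a) + Complex.I * e (1, a)
  set w : Fin p → ℂ := fun a => e (0, a) - Complex.I * e (1, a)
  set t := (n : ℝ)⁻¹ * (1 / 2)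
  set t' := (n : ℝ)⁻¹ * -(1 / 2)
  have hH' : (H + (t : ℂ) • vecMulVec u (star u)).IsHermitian := by
    refine hH.add ?_
    simp [IsHermitian, conjTranspose_smul, conjTranspose_vecMulVec]
  have h1 := norm_trace_resolv_rank_one_le hH hz t u
  have h2 := norm_trace_resolv_rank_one_le hH' hz t' w
  have e2 : (2 : ℝ) / z.im = 1 / z.im + 1 / z.im := by ring
  rw [e2]
  refine (norm_sub_le_norm_sub_add_norm_sub _ _ _).trans (add_le_add h2 h1)

/-- The fixed point equation for the forms in the resolvent when a pair of columns is added. -/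
theorem resolv_form_eq {H : Matrix (Fin p) (Fin p) ℂ} {z : ℂ} (hH : H.IsHermitian) (hz : 0 < z.im)
    (τ : ℝ) (ξ : Fin 2 × Fin p → ℂ) (u w : Fin p → ℂ) :
    star u ⬝ᵥ (resolv (H + (τ : ℂ) • pairMatrix ξ) z *ᵥ w)
      = star u ⬝ᵥ (resolv H z *ᵥ w)
        + τ * Complex.I * ((star u ⬝ᵥ (resolv H z *ᵥ fun a => ξ (0, a)))
          * ((star fun a => ξ (1, a)) ⬝ᵥ (resolv (H + (τ : ℂ) • pairMatrix ξ) z *ᵥ w))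
          - (star u ⬝ᵥ (resolv H z *ᵥ fun a => ξ (1, a)))
          * ((star fun a => ξ (0, a)) ⬝ᵥ (resolv (H + (τ : ℂ) • pairMatrix ξ) z *ᵥ w))) := by
  have hH' : (H + (τ : ℂ) • pairMatrix ξ).IsHermitian := by
    refine hH.add ?_
    rw [IsHermitian, conjTranspose_smul, (isHermitian_pairMatrix ξ).eq]
    simp
  set H' := H + (τ : ℂ) • pairMatrix ξ with hH'def
  set G := resolv H z with hG
  set G' := resolv H' z with hG'
  have hid : G' = G - (τ : ℂ) • (G * (pairMatrix ξ * G')) := by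
    have h1 : G * ((H' - z • 1) - (H - z • 1)) * G' = G - G' := by
      rw [Matrix.mul_sub, Matrix.sub_mul, resolv_mul_sub hH hz, Matrix.mul_assoc,
        sub_mul_resolv hH' hz, Matrix.one_mul, Matrix.mul_one]
    have h2 : (H' - z • 1) - (H - z • 1) = (τ : ℂ) • pairMatrix ξ := by
      rw [hH'def]; abel
    rw [h2, Matrix.mul_smul, Matrix.smul_mul, Matrix.mul_assoc] at h1
    rw [h1]; abel
  have hw : pairMatrix ξ *ᵥ (G' *ᵥ w)
      = (-Complex.I) • (((star fun a => ξ (1, a)) ⬝ᵥ (G' *ᵥ w)) • (fun a => ξ (0, a))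
        - ((star fun a => ξ (0, a)) ⬝ᵥ (G' *ᵥ w)) • fun a => ξ (1, a)) := by
    unfold pairMatrix
    rw [smul_mulVec, sub_mulVec, vecMulVec_mulVec, vecMulVec_mulVec]
    simp
  nth_rewrite 1 [hid]
  rw [sub_mulVec, smul_mulVec, ← mulVec_mulVec, ← mulVec_mulVec, hw, mulVec_smul, mulVec_sub,
    mulVec_smul, mulVec_smul, dotProduct_sub, dotProduct_smul, dotProduct_smul, dotProduct_sub,
    dotProduct_smul, dotProduct_smul]
  simp only [smul_eq_mul]
  ring

theorem trace_pairMatrix_mul (ξ : Fin 2 × Fin p → ℂ) (G : Matrix (Fin p) (Fin p) ℂ) :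
    (pairMatrix ξ * G).trace
      = -Complex.I * ((star fun a => ξ (1, a)) ⬝ᵥ (G *ᵥ fun a => ξ (0, a))
        - (star fun a => ξ (0, a)) ⬝ᵥ (G *ᵥ fun a => ξ (1, a))) := by
  have h : ∀ x y : Fin p → ℂ, (vecMulVec x (star y) * G).trace = star y ⬝ᵥ (G *ᵥ x) := fun x y => by
    rw [trace_mul_comm, mul_vecMulVec, trace_vecMulVec, dotProduct_comm]
  unfold pairMatrix
  rw [Matrix.smul_mul, Matrix.sub_mul, trace_smul, trace_sub, h, h, smul_eq_mul]

/-- The Stieltjes transform of the spectral distribution of `columnMatrix x`. -/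
def colStieltjes (z : ℂ) (x : Fin n → Fin 2 × Fin p → ℂ) : ℂ :=
  (p : ℂ)⁻¹ * (resolv (columnMatrix x) z).trace

/-- The residual in the self-consistent equation. -/
def residual (κ : ℝ) (z m : ℂ) : ℂ := 1 + z * m + 2 * κ * m ^ 2 / (1 - (κ * m) ^ 2)

/-- The error made by replacing the forms in a fixed matrix `G` by normalized traces. -/
def formError (n : ℕ) (G : Matrix (Fin p) (Fin p) ℂ) (ξ : Fin 2 × Fin p → ℂ) : ℝ :=
  ‖(n : ℂ)⁻¹ * ((star fun a => ξ (0, a)) ⬝ᵥ (G *ᵥ fun a => ξ (0, a))) - (n : ℂ)⁻¹ * G.trace‖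
  + ‖(n : ℂ)⁻¹ * ((star fun a => ξ (0, a)) ⬝ᵥ (G *ᵥ fun a => ξ (1, a)))‖
  + ‖(n : ℂ)⁻¹ * ((star fun a => ξ (1, a)) ⬝ᵥ (G *ᵥ fun a => ξ (0, a)))‖
  + ‖(n : ℂ)⁻¹ * ((star fun a => ξ (1, a)) ⬝ᵥ (G *ᵥ fun a => ξ (1, a))) - (n : ℂ)⁻¹ * G.trace‖
  + |(n : ℝ)⁻¹ * sqNorm (fun a => ξ (0, a)) - p / n|
  + |(n : ℝ)⁻¹ * sqNorm (fun a => ξ (1, a)) - p / n|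

theorem three_quarters_le {s : ℂ} (hs : ‖s‖ ≤ 1 / 2) : 3 / 4 ≤ ‖1 - s ^ 2‖ := by
  have h1 : ‖s ^ 2‖ ≤ 1 / 4 := by
    rw [norm_pow]; nlinarith [norm_nonneg s]
  have h2 := norm_sub_norm_le (1 : ℂ) (s ^ 2)
  rw [norm_one] at h2
  linarith

/-- Stability of the `2 × 2` system satisfied by the forms in the resolvent. -/
theorem system_stability {σ s a b g d α γ : ℂ} {X Y κ K : ℝ} (hσ : σ ^ 2 = -1) (hs : ‖s‖ ≤ 1 / 2)
    (hα : α = a + σ * (a * γ - b * α)) (hγ : γ = g + σ * (g * γ - d * α))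
    (hκ : 0 ≤ κ) (hκK : κ ≤ K)
    (hαb : ‖α‖ ≤ X + Y) (hγb : ‖γ‖ ≤ X + Y) :
    ‖γ - -σ * s ^ 2 / (1 - s ^ 2)‖
      ≤ (4 * K + 6) * (‖a - s‖ + ‖b‖ + ‖g‖ + ‖d - s‖ + |X - κ| + |Y - κ|) := by
  have hσn : ‖σ‖ = 1 := by
    have h : ‖σ‖ ^ 2 = 1 := by rw [← norm_pow, hσ]; simp
    exact (pow_eq_one_iff_of_nonneg (norm_nonneg _) two_ne_zero).1 h
  have h34 := three_quarters_le hs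
  have hne : 1 - s ^ 2 ≠ 0 := norm_pos_iff.1 (by linarith)
  set Δ := ‖a - s‖ + ‖b‖ + ‖g‖ + ‖d - s‖ + |X - κ| + |Y - κ| with hΔ
  have n1 := norm_nonneg (a - s)
  have n2 := norm_nonneg b
  have n3 := norm_nonneg g
  have n4 := norm_nonneg (d - s)
  have n5 := abs_nonneg (X - κ)
  have n6 := abs_nonneg (Y - κ)
  by_cases hcase : X ≤ κ + 1 ∧ Y ≤ κ + 1
  · set e1 := (a - s) + σ * ((a - s) * γ - b * α) with he1
    set e2 := g + σ * (g * γ - (d - s) * α) with he2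
    have hK1 : ‖α‖ ≤ 2 * K + 2 := by linarith [hcase.1, hcase.2]
    have hK2 : ‖γ‖ ≤ 2 * K + 2 := by linarith [hcase.1, hcase.2]
    have key : (γ - -σ * s ^ 2 / (1 - s ^ 2)) * (1 - s ^ 2) = e2 - σ * s * e1 := by
      have : (γ - -σ * s ^ 2 / (1 - s ^ 2)) * (1 - s ^ 2) = γ * (1 - s ^ 2) + σ * s ^ 2 := by
        field_simp
        ring
      rw [this, he1, he2]
      linear_combination hγ - σ * s * hα + (-(s ^ 2) * γ) * hσ
    have b1 : ‖e1‖ ≤ (2 * K + 3) * (‖a - s‖ + ‖b‖) := by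
      calc ‖e1‖ ≤ ‖a - s‖ + 1 * (‖a - s‖ * ‖γ‖ + ‖b‖ * ‖α‖) := by
            rw [he1]
            refine (norm_add_le _ _).trans ?_
            rw [norm_mul, hσn]
            gcongr
            refine (norm_sub_le _ _).trans ?_
            rw [norm_mul, norm_mul]
        _ ≤ ‖a - s‖ + 1 * (‖a - s‖ * (2 * K + 2) + ‖b‖ * (2 * K + 2)) := by gcongr
        _ ≤ _ := by nlinarith
    have b2 : ‖e2‖ ≤ (2 * K + 3) * (‖g‖ + ‖d - s‖) := by
      calc ‖e2‖ ≤ ‖g‖ + 1 * (‖g‖ * ‖γ‖ + ‖d - s‖ * ‖α‖) := by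
            rw [he2]
            refine (norm_add_le _ _).trans ?_
            rw [norm_mul, hσn]
            gcongr
            refine (norm_sub_le _ _).trans ?_
            rw [norm_mul, norm_mul]
        _ ≤ ‖g‖ + 1 * (‖g‖ * (2 * K + 2) + ‖d - s‖ * (2 * K + 2)) := by gcongr
        _ ≤ _ := by nlinarith
    have b3 : ‖γ - -σ * s ^ 2 / (1 - s ^ 2)‖ * ‖1 - s ^ 2‖ ≤ (2 * K + 3) * Δ := by
      rw [← norm_mul, key]
      calc ‖e2 - σ * s * e1‖ ≤ ‖e2‖ + ‖σ * s * e1‖ := norm_sub_le _ _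
        _ = ‖e2‖ + ‖s‖ * ‖e1‖ := by rw [norm_mul, norm_mul, hσn, one_mul]
        _ ≤ ‖e2‖ + 1 * ‖e1‖ := by gcongr; linarith
        _ ≤ (2 * K + 3) * (‖g‖ + ‖d - s‖) + 1 * ((2 * K + 3) * (‖a - s‖ + ‖b‖)) := by gcongr
        _ = (2 * K + 3) * (‖a - s‖ + ‖b‖ + ‖g‖ + ‖d - s‖) := by ring
        _ ≤ _ := by
          have : 0 ≤ 2 * K + 3 := by linarith
          gcongr
          linarith
    have b4 : ‖γ - -σ * s ^ 2 / (1 - s ^ 2)‖ * (3 / 4)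
        ≤ ‖γ - -σ * s ^ 2 / (1 - s ^ 2)‖ * ‖1 - s ^ 2‖ := by gcongr
    have hΔ0 : 0 ≤ Δ := by positivity
    nlinarith [norm_nonneg (γ - -σ * s ^ 2 / (1 - s ^ 2))]
  · have h0 : ‖-σ * s ^ 2 / (1 - s ^ 2)‖ ≤ 1 := by
      rw [norm_div, norm_mul, norm_neg, hσn, one_mul, norm_pow, div_le_one (by linarith)]
      nlinarith [norm_nonneg s]
    have hXa := le_abs_self (X - κ)
    have hYa := le_abs_self (Y - κ)
    have hD : |X - κ| + |Y - κ| ≤ Δ := by linarith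
    have hone : 1 ≤ |X - κ| + |Y - κ| := by
      by_contra h
      exact hcase ⟨by linarith, by linarith⟩
    have h1 : ‖γ‖ ≤ (2 * K + 1) * (|X - κ| + |Y - κ|) := by
      have : 2 * κ ≤ 2 * K * (|X - κ| + |Y - κ|) := by nlinarith
      linarith
    calc _ ≤ ‖γ‖ + ‖-σ * s ^ 2 / (1 - s ^ 2)‖ := norm_sub_le _ _
      _ ≤ (2 * K + 1) * (|X - κ| + |Y - κ|) + (|X - κ| + |Y - κ|) := by linarith
      _ = (2 * K + 2) * (|X - κ| + |Y - κ|) := by ring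
      _ ≤ (4 * K + 6) * Δ := by
        have : 0 ≤ K := hκ.trans hκK
        gcongr
        · linarith
        · linarith

theorem norm_colStieltjes_le {z : ℂ} (hz : 0 < z.im) (hp : 0 < p)
    (x : Fin n → Fin 2 × Fin p → ℂ) : ‖colStieltjes z x‖ ≤ 1 / z.im := by
  unfold colStieltjes
  have h := norm_trace_resolv_le (isHermitian_columnMatrix x) hz
  rw [Fintype.card_fin] at h
  rw [norm_mul, norm_inv, Complex.norm_natCast]
  have hp' : (0 : ℝ) < p := by exact_mod_cast hp
  rw [inv_mul_le_iff₀ hp']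
  refine h.trans_eq (by ring)

theorem residual_lipschitz {κ : ℝ} {m m' : ℂ} (hm : ‖κ * m‖ ≤ 1 / 2)
    (hm' : ‖κ * m'‖ ≤ 1 / 2) :
    ‖2 * κ * m ^ 2 / (1 - (κ * m) ^ 2) - 2 * κ * m' ^ 2 / (1 - (κ * m') ^ 2)‖ ≤ 4 * ‖m - m'‖ := by
  have h1 := three_quarters_le hm
  have h2 := three_quarters_le hm'
  have hne1 : 1 - (κ * m) ^ 2 ≠ 0 := norm_pos_iff.1 (by linarith)
  have hne2 : 1 - (κ * m') ^ 2 ≠ 0 := norm_pos_iff.1 (by linarith)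
  have e : 2 * κ * m ^ 2 / (1 - (κ * m) ^ 2) - 2 * κ * m' ^ 2 / (1 - (κ * m') ^ 2)
      = 2 * (m - m') * (κ * m + κ * m') / ((1 - (κ * m) ^ 2) * (1 - (κ * m') ^ 2)) := by
    rw [div_sub_div _ _ hne1 hne2]
    congr 1
    ring
  rw [e, norm_div, norm_mul, norm_mul, norm_mul, div_le_iff₀ (by positivity)]
  have h3 : ‖(κ * m + κ * m' : ℂ)‖ ≤ 1 := (norm_add_le _ _).trans (by linarith)
  have h4 : (9 / 16 : ℝ) ≤ ‖1 - (κ * m) ^ 2‖ * ‖1 - (κ * m') ^ 2‖ := by nlinarith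
  have hn := norm_nonneg (m - m')
  have h5 : ‖m - m'‖ * ‖(κ * m + κ * m' : ℂ)‖ ≤ ‖m - m'‖ * 1 := by gcongr
  have h6 : ‖m - m'‖ * (9 / 16) ≤ ‖m - m'‖ * (‖1 - (κ * m) ^ 2‖ * ‖1 - (κ * m') ^ 2‖) := by gcongr
  simp only [Complex.norm_ofNat]
  nlinarith

/-- The residual is bounded by the average error in the quadratic forms. -/
theorem norm_residual_le {z : ℂ} {K : ℝ} (hp : 0 < p) (hn : 0 < n) (hK : (p : ℝ) / n ≤ K)
    (hz1 : 1 ≤ z.im) (hzK : 2 * K ≤ z.im) (x : Fin n → Fin 2 × Fin p → ℂ) :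
    ‖residual ((p : ℝ) / n) z (colStieltjes z x)‖
      ≤ (p : ℝ)⁻¹ * ∑ j, 2 * (4 * K + 6) *
        (formError n (resolv (columnMatrix (Function.update x j 0)) z) (x j) + 4 / n) := by
  have hz : 0 < z.im := by linarith
  have hp' : (0 : ℝ) < p := by exact_mod_cast hp
  have hn' : (0 : ℝ) < n := by exact_mod_cast hn
  have hpc : (p : ℂ) ≠ 0 := by exact_mod_cast hp.ne'
  have hnc : (n : ℂ) ≠ 0 := by exact_mod_cast hn.ne'
  set κ : ℝ := (p : ℝ) / n with hκ
  have hκ0 : 0 < κ := by positivity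
  set m := colStieltjes z x with hm
  set s : ℂ := κ * m with hs
  have hHx := isHermitian_columnMatrix x
  set G := resolv (columnMatrix x) z with hG
  have hsG : s = (n : ℂ)⁻¹ * G.trace := by
    rw [hs, hm, hκ, colStieltjes]
    push_cast
    rw [← hG]
    field_simp
  have hsb : ‖s‖ ≤ 1 / 2 := by
    have := norm_colStieltjes_le hz hp x
    rw [hs, norm_mul, Complex.norm_real, Real.norm_of_nonneg hκ0.le]
    calc κ * ‖m‖ ≤ K * (1 / z.im) := by gcongr; linarith
      _ ≤ 1 / 2 := by
        rw [mul_one_div, div_le_div_iff₀ hz two_pos]; linarith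
  have hne : 1 - s ^ 2 ≠ 0 := norm_pos_iff.1 (by linarith [three_quarters_le hsb])
  -- the forms in the full resolvent
  set γ : Fin n → ℂ := fun j =>
    (n : ℂ)⁻¹ * ((star fun a => x j (1, a)) ⬝ᵥ (G *ᵥ fun a => x j (0, a))) with hγ
  set β : Fin n → ℂ := fun j =>
    (n : ℂ)⁻¹ * ((star fun a => x j (0, a)) ⬝ᵥ (G *ᵥ fun a => x j (1, a))) with hβ
  have htrace : (p : ℂ) + z * G.trace = ∑ j, -Complex.I * (γ j - β j) := by
    have h1 : (columnMatrix x * G).trace = p + z * G.trace := by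
      have h := sub_mul_resolv hHx hz
      rw [Matrix.sub_mul, Matrix.smul_mul, Matrix.one_mul, sub_eq_iff_eq_add] at h
      rw [h, trace_add, trace_one, trace_smul, Fintype.card_fin, smul_eq_mul]
    rw [← h1, columnMatrix, Matrix.smul_mul, Finset.sum_mul, trace_smul, trace_sum, Finset.smul_sum]
    refine Finset.sum_congr rfl fun j _ => ?_
    rw [trace_pairMatrix_mul, hγ, hβ]
    simp only [smul_eq_mul]
    push_cast
    ring
  have hres : residual κ z m = (p : ℂ)⁻¹ * ∑ j, -Complex.I *
      ((γ j - -Complex.I * s ^ 2 / (1 - s ^ 2)) - (β j - -(-Complex.I) * s ^ 2 / (1 - s ^ 2))) := by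
    have h1 : ∀ j, -Complex.I *
      ((γ j - -Complex.I * s ^ 2 / (1 - s ^ 2)) - (β j - -(-Complex.I) * s ^ 2 / (1 - s ^ 2)))
        = -Complex.I * (γ j - β j) + 2 * s ^ 2 / (1 - s ^ 2) := fun j => by
      field_simp
      linear_combination (-2 * s ^ 2) * Complex.I_sq
    simp_rw [h1]
    rw [Finset.sum_add_distrib, ← htrace]
    simp only [Finset.sum_const, Finset.card_univ, Fintype.card_fin, nsmul_eq_mul]
    unfold residual
    have hG2 : G.trace = p * m := by
      rw [hm, colStieltjes]; field_simp
      rfl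
    have hκc : (κ : ℂ) = p / n := by rw [hκ]; push_cast; rfl
    rw [hG2, ← hs]
    have : s ^ 2 = κ * m * (κ * m) := by rw [hs]; ring
    rw [mul_div_assoc, mul_div_assoc]
    have e : (p : ℂ)⁻¹ * (p + z * (p * m) + n * (2 * (s ^ 2 / (1 - s ^ 2))))
        = 1 + z * m + (n / p) * 2 * s ^ 2 / (1 - s ^ 2) := by
      field_simp
    rw [e, this, hκc]
    field_simp
  rw [hres, norm_mul, norm_inv, Complex.norm_natCast]
  gcongr
  refine (norm_sum_le _ _).trans (Finset.sum_le_sum fun j _ => ?_)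
  rw [norm_mul, norm_neg, Complex.norm_I, one_mul]
  refine (norm_sub_le _ _).trans ?_
  -- leave out column `j`
  set H₀ := columnMatrix (Function.update x j 0) with hH₀
  have hH₀h : H₀.IsHermitian := isHermitian_columnMatrix _
  set G₀ := resolv H₀ z with hG₀
  have hxH : columnMatrix x = H₀ + (((n : ℝ)⁻¹ : ℝ) : ℂ) • pairMatrix (x j) := by
    have h := columnMatrix_update x j (x j)
    rw [Function.update_eq_self] at h
    rw [h, Complex.ofReal_inv]
  set X := (n : ℝ)⁻¹ * sqNorm (fun a => x j (0, a)) with hX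
  set Y := (n : ℝ)⁻¹ * sqNorm (fun a => x j (1, a)) with hY
  have hX0 : 0 ≤ X := mul_nonneg (by positivity) (sqNorm_nonneg _)
  have hY0 : 0 ≤ Y := mul_nonneg (by positivity) (sqNorm_nonneg _)
  set a := (n : ℂ)⁻¹ * ((star fun a => x j (0, a)) ⬝ᵥ (G₀ *ᵥ fun a => x j (0, a))) with ha
  set b := (n : ℂ)⁻¹ * ((star fun a => x j (0, a)) ⬝ᵥ (G₀ *ᵥ fun a => x j (1, a))) with hb
  set g := (n : ℂ)⁻¹ * ((star fun a => x j (1, a)) ⬝ᵥ (G₀ *ᵥ fun a => x j (0, a))) with hg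
  set dd := (n : ℂ)⁻¹ * ((star fun a => x j (1, a)) ⬝ᵥ (G₀ *ᵥ fun a => x j (1, a))) with hdd
  set α := (n : ℂ)⁻¹ * ((star fun a => x j (0, a)) ⬝ᵥ (G *ᵥ fun a => x j (0, a))) with hα
  set δ := (n : ℂ)⁻¹ * ((star fun a => x j (1, a)) ⬝ᵥ (G *ᵥ fun a => x j (1, a))) with hδ
  have hform := fun u w => resolv_form_eq hH₀h hz ((n : ℝ)⁻¹) (x j) u w
  rw [← hxH, ← hG, ← hG₀] at hform
  have hfn : ∀ u w : Fin p → ℂ, (n : ℂ)⁻¹ * (star u ⬝ᵥ (G *ᵥ w))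
      = (n : ℂ)⁻¹ * (star u ⬝ᵥ (G₀ *ᵥ w)) + Complex.I *
        (((n : ℂ)⁻¹ * (star u ⬝ᵥ (G₀ *ᵥ fun a => x j (0, a))))
          * ((n : ℂ)⁻¹ * ((star fun a => x j (1, a)) ⬝ᵥ (G *ᵥ w)))
        - ((n : ℂ)⁻¹ * (star u ⬝ᵥ (G₀ *ᵥ fun a => x j (1, a))))
          * ((n : ℂ)⁻¹ * ((star fun a => x j (0, a)) ⬝ᵥ (G *ᵥ w)))) := fun u w => by
    conv_lhs => rw [hform u w]
    push_cast
    ring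
  have hbound : ∀ u w : Fin p → ℂ, ‖(n : ℂ)⁻¹ * (star u ⬝ᵥ (G *ᵥ w))‖
      ≤ (n : ℝ)⁻¹ * sqNorm u / 2 + (n : ℝ)⁻¹ * sqNorm w / 2 := fun u w => by
    have h := norm_resolv_form_le hHx hz u w
    rw [norm_mul, norm_inv, Complex.norm_natCast]
    have hu := sqNorm_nonneg u
    have hw := sqNorm_nonneg w
    have h' : (sqNorm u + sqNorm w) / (2 * z.im) ≤ (sqNorm u + sqNorm w) / 2 := by
      gcongr
      linarith
    calc (n : ℝ)⁻¹ * _ ≤ (n : ℝ)⁻¹ * ((sqNorm u + sqNorm w) / 2) := by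
          gcongr; exact h.trans h'
      _ = _ := by ring
  have hI : Complex.I ^ 2 = -1 := Complex.I_sq
  have hI' : (-Complex.I) ^ 2 = -1 := by rw [neg_sq, hI]
  have S1 := system_stability (κ := κ) (K := K) (X := X) (Y := Y) hI hsb
    (hfn _ _ : α = a + Complex.I * (a * γ j - b * α))
    (hfn _ _ : γ j = g + Complex.I * (g * γ j - dd * α)) hκ0.le hK
    ((hbound _ _).trans (by linarith)) ((hbound _ _).trans (by linarith))
  have S2 := system_stability (κ := κ) (K := K) (X := X) (Y := Y) hI' hsb
    (show δ = dd + -Complex.I * (dd * β j - g * δ) by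
      have := (hfn _ _ : δ = dd + Complex.I * (g * δ - dd * β j))
      linear_combination this)
    (show β j = b + -Complex.I * (b * β j - a * δ) by
      have := (hfn _ _ : β j = b + Complex.I * (a * δ - b * β j))
      linear_combination this) hκ0.le hK
    ((hbound _ _).trans (by linarith)) ((hbound _ _).trans (by linarith))
  have hK0 : 0 ≤ K := hκ0.le.trans hK
  -- compare the normalized traces
  have htr : ‖(n : ℂ)⁻¹ * G₀.trace - s‖ ≤ 2 / n := by
    have h := norm_trace_update_sub_le hz x j (x j)
    rw [Function.update_eq_self, ← hG, ← hH₀, ← hG₀] at h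
    rw [hsG, ← mul_sub, norm_mul, norm_inv, Complex.norm_natCast, norm_sub_rev]
    calc (n : ℝ)⁻¹ * _ ≤ (n : ℝ)⁻¹ * (2 / z.im) := by gcongr
      _ ≤ (n : ℝ)⁻¹ * (2 / 1) := by gcongr
      _ = 2 / n := by ring
  have ha' : ‖a - s‖ ≤ ‖a - (n : ℂ)⁻¹ * G₀.trace‖ + 2 / n :=
    (norm_sub_le_norm_sub_add_norm_sub _ _ _).trans (by linarith)
  have hd' : ‖dd - s‖ ≤ ‖dd - (n : ℂ)⁻¹ * G₀.trace‖ + 2 / n :=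
    (norm_sub_le_norm_sub_add_norm_sub _ _ _).trans (by linarith)
  have hE : ‖a - s‖ + ‖b‖ + ‖g‖ + ‖dd - s‖ + |X - κ| + |Y - κ| ≤ formError n G₀ (x j) + 4 / n := by
    have e4 : (4 : ℝ) / n = 2 / n + 2 / n := by ring
    unfold formError
    rw [e4]
    linarith
  have hC : 0 ≤ 4 * K + 6 := by linarith
  calc _ ≤ (4 * K + 6) * (‖a - s‖ + ‖b‖ + ‖g‖ + ‖dd - s‖ + |X - κ| + |Y - κ|)
        + (4 * K + 6) * (‖dd - s‖ + ‖g‖ + ‖b‖ + ‖a - s‖ + |X - κ| + |Y - κ|) :=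
        add_le_add S1 S2
    _ = 2 * (4 * K + 6) * (‖a - s‖ + ‖b‖ + ‖g‖ + ‖dd - s‖ + |X - κ| + |Y - κ|) := by ring
    _ ≤ _ := by gcongr

end Columns

/-! ### Moment bounds under product measures -/

section ProductMeasure

variable {ι : Type*} [Fintype ι] [DecidableEq ι]

/-- Resampling one coordinate preserves a product of probability measures. -/
theorem measurePreserving_update {E : Type*} [MeasurableSpace E] (ν : ι → Measure E)
    [∀ i, IsProbabilityMeasure (ν i)] (j : ι) :
    MeasurePreserving (fun q : E × (ι → E) => Function.update q.2 j q.1)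
      ((ν j).prod (Measure.pi ν)) (Measure.pi ν) := by
  have hmeas : Measurable fun q : E × (ι → E) => Function.update q.2 j q.1 := by
    refine measurable_pi_iff.2 fun i => ?_
    by_cases h : i = j
    · subst h; simpa using measurable_fst
    · simp only [Function.update_of_ne h]
      exact (measurable_pi_apply i).comp measurable_snd
  refine ⟨hmeas, (Measure.pi_eq fun s hs => ?_).symm⟩
  rw [Measure.map_apply hmeas (MeasurableSet.univ_pi hs)]
  have hpre : (fun q : E × (ι → E) => Function.update q.2 j q.1) ⁻¹' Set.univ.pi s
      = s j ×ˢ Set.univ.pi (Function.update s j Set.univ) := by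
    ext q
    simp only [Set.mem_preimage, Set.mem_pi, Set.mem_univ, true_implies, Set.mem_prod]
    constructor
    · intro h
      refine ⟨by simpa using h j, fun i => ?_⟩
      by_cases hi : i = j
      · subst hi; simp
      · simpa [Function.update_of_ne hi] using h i
    · rintro ⟨h1, h2⟩ i
      by_cases hi : i = j
      · subst hi; simpa using h1
      · simpa [Function.update_of_ne hi] using h2 i
  rw [hpre, Measure.prod_prod, Measure.pi_pi, ← Finset.mul_prod_erase _ _ (Finset.mem_univ j),
    ← Finset.mul_prod_erase Finset.univ (fun i => ν i (s i)) (Finset.mem_univ j)]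
  simp only [Function.update_self, measure_univ, one_mul]
  congr 1
  refine Finset.prod_congr rfl fun i hi => ?_
  rw [Function.update_of_ne (Finset.ne_of_mem_erase hi)]

/-- A coordinate splits off from a function of the other coordinates. -/
theorem integral_pi_mul {𝕜 : Type*} [RCLike 𝕜] {E : Type*} [MeasurableSpace E] (ν : ι → Measure E)
    [∀ i, IsProbabilityMeasure (ν i)] (j : ι) {φ : E → 𝕜} {h : (ι → E) → 𝕜} (hφ : Measurable φ)
    (hh : Measurable h) (hind : ∀ ξ e, h (Function.update ξ j e) = h ξ) :
    ∫ ξ, φ (ξ j) * h ξ ∂(Measure.pi ν) = (∫ e, φ e ∂(ν j)) * ∫ ξ, h ξ ∂(Measure.pi ν) := by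
  have hmp := measurePreserving_update ν j
  rw [← integral_prod_mul, ← hmp.map_eq, integral_map hmp.measurable.aemeasurable]
  · rw [hmp.map_eq]
    simp [hind]
  · exact ((hφ.comp (measurable_pi_apply j)).mul hh).aestronglyMeasurable

/-- The second moment of a finite sum in which every term is orthogonal to all but itself and one
partner. -/
theorem integral_norm_sum_sq_le {Ω κ : Type*} [MeasurableSpace Ω] {μ : Measure Ω} [Fintype κ]
    [DecidableEq κ] (T : κ → Ω → ℂ) (hT : ∀ a, Measurable (T a))
    (hT2 : ∀ a, Integrable (fun ω => ‖T a ω‖ ^ 2) μ) (π : Equiv.Perm κ)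
    (horth : ∀ a b, b ≠ a → b ≠ π a → ∫ ω, T a ω * starRingEnd ℂ (T b ω) ∂μ = 0) :
    Integrable (fun ω => ‖∑ a, T a ω‖ ^ 2) μ ∧
      ∫ ω, ‖∑ a, T a ω‖ ^ 2 ∂μ ≤ 2 * ∑ a, ∫ ω, ‖T a ω‖ ^ 2 ∂μ := by
  have hint : ∀ a b, Integrable (fun ω => T a ω * starRingEnd ℂ (T b ω)) μ := fun a b => by
    refine Integrable.mono' ((hT2 a).add (hT2 b))
      ((hT a).mul (Complex.continuous_conj.measurable.comp (hT b))).aestronglyMeasurable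
      (ae_of_all _ fun ω => ?_)
    simp only [norm_mul, RCLike.norm_conj, Pi.add_apply]
    nlinarith [sq_nonneg (‖T a ω‖ - ‖T b ω‖), sq_nonneg ‖T a ω‖, sq_nonneg ‖T b ω‖]
  have hexp : ∀ ω, ((‖∑ a, T a ω‖ ^ 2 : ℝ) : ℂ) = ∑ a, ∑ b, T a ω * starRingEnd ℂ (T b ω) :=
    fun ω => by
      rw [← Finset.sum_mul_sum, ← map_sum, Complex.mul_conj, Complex.normSq_eq_norm_sq]
  have hintS : Integrable (fun ω => ∑ a, ∑ b, T a ω * starRingEnd ℂ (T b ω)) μ :=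
    integrable_finsetSum _ fun a _ => integrable_finsetSum _ fun b _ => hint a b
  have hintR : Integrable (fun ω => ‖∑ a, T a ω‖ ^ 2) μ := by
    refine hintS.re.congr (ae_of_all _ fun ω => ?_)
    simp only [RCLike.re_to_complex]
    rw [← hexp, Complex.ofReal_re]
  refine ⟨hintR, ?_⟩
  set t : κ → ℝ := fun a => ∫ ω, ‖T a ω‖ ^ 2 ∂μ with ht
  have hcross : ∀ a b, ‖∫ ω, T a ω * starRingEnd ℂ (T b ω) ∂μ‖ ≤ (t a + t b) / 2 := fun a b => by
    refine (norm_integral_le_integral_norm _).trans ?_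
    rw [ht]
    simp only
    rw [← integral_add (hT2 a) (hT2 b), ← integral_div]
    refine integral_mono (hint a b).norm (((hT2 a).add (hT2 b)).div_const 2) fun ω => ?_
    simp only [norm_mul, RCLike.norm_conj]
    nlinarith [sq_nonneg (‖T a ω‖ - ‖T b ω‖)]
  have ht0 : ∀ a, 0 ≤ t a := fun a => integral_nonneg fun ω => by positivity
  have hrow : ∀ a, ‖∑ b, ∫ ω, T a ω * starRingEnd ℂ (T b ω) ∂μ‖ ≤ t a + (t a + t (π a)) / 2 := by
    intro a
    have hsub : ∑ b, ∫ ω, T a ω * starRingEnd ℂ (T b ω) ∂μ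
        = ∑ b ∈ {a, π a}, ∫ ω, T a ω * starRingEnd ℂ (T b ω) ∂μ := by
      symm
      refine Finset.sum_subset (Finset.subset_univ _) fun b _ hb => ?_
      simp only [Finset.mem_insert, Finset.mem_singleton, not_or] at hb
      exact horth a b hb.1 hb.2
    rw [hsub]
    refine (norm_sum_le _ _).trans ?_
    by_cases ha : a = π a
    · rw [← ha]
      simp only [Finset.insert_eq_of_mem (Finset.mem_singleton_self a), Finset.sum_singleton]
      have := hcross a a
      have := ht0 a
      linarith
    · rw [Finset.sum_pair ha]
      have := hcross a a
      have := hcross a (π a)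
      linarith
  have hmain : ((∫ ω, ‖∑ a, T a ω‖ ^ 2 ∂μ : ℝ) : ℂ)
      = ∑ a, ∑ b, ∫ ω, T a ω * starRingEnd ℂ (T b ω) ∂μ := by
    rw [← integral_complex_ofReal]
    simp_rw [hexp]
    rw [integral_finsetSum _ fun a _ => integrable_finsetSum _ fun b _ => hint a b]
    refine Finset.sum_congr rfl fun a _ => ?_
    rw [integral_finsetSum _ fun b _ => hint a b]
  have hnorm : ∫ ω, ‖∑ a, T a ω‖ ^ 2 ∂μ = ‖((∫ ω, ‖∑ a, T a ω‖ ^ 2 ∂μ : ℝ) : ℂ)‖ := by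
    rw [Complex.norm_real, Real.norm_of_nonneg (integral_nonneg fun ω => by positivity)]
  rw [hnorm, hmain]
  refine (norm_sum_le _ _).trans ((Finset.sum_le_sum fun a _ => hrow a).trans_eq ?_)
  rw [Finset.sum_add_distrib, ← Finset.sum_div, Finset.sum_add_distrib, Equiv.sum_comp π t]
  ring

theorem integral_norm_le_sqrt {Ω : Type*} [MeasurableSpace Ω] {μ : Measure Ω}
    [IsProbabilityMeasure μ] {f : Ω → ℂ} (hf : Measurable f)
    (h2 : Integrable (fun ω => ‖f ω‖ ^ 2) μ) {A : ℝ} (hA : ∫ ω, ‖f ω‖ ^ 2 ∂μ ≤ A) :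
    Integrable f μ ∧ ∫ ω, ‖f ω‖ ∂μ ≤ √A := by
  have hmem : MemLp f 2 μ := (memLp_two_iff_integrable_sq_norm hf.aestronglyMeasurable).2 h2
  have hint : Integrable f μ := hmem.integrable one_le_two
  refine ⟨hint, ?_⟩
  refine Real.le_sqrt_of_sq_le (le_trans ?_ hA)
  have hvar := variance_nonneg (fun ω => ‖f ω‖) μ
  rw [variance_eq_sub hmem.norm] at hvar
  simp only [Pi.pow_apply] at hvar
  linarith

/-- Centered, standardized entries. -/
structure IsStandardFamily (ν : ι → Measure ℂ) : Prop where
  prob : ∀ i, IsProbabilityMeasure (ν i)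
  mean_zero : ∀ i, ∫ e, e ∂(ν i) = 0
  variance_one : ∀ i, ∫ e, ‖e‖ ^ 2 ∂(ν i) = 1

variable {ν : ι → Measure ℂ}

theorem IsStandardFamily.integral_sq_mul_sq (hν : IsStandardFamily ν) {i j : ι} (hij : i ≠ j) :
    ∫ ξ : ι → ℂ, ‖ξ i‖ ^ 2 * ‖ξ j‖ ^ 2 ∂(Measure.pi ν) = 1 := by
  have := hν.prob
  have h1 := integral_pi_mul (𝕜 := ℝ) ν i (φ := fun e => ‖e‖ ^ 2) (h := fun ξ => ‖ξ j‖ ^ 2)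
    (by fun_prop) (by fun_prop) (fun ξ e => by rw [Function.update_of_ne hij.symm])
  have h2 := integral_pi_mul (𝕜 := ℝ) ν j (φ := fun e => ‖e‖ ^ 2) (h := fun _ => 1)
    (by fun_prop) (by fun_prop) (fun ξ e => rfl)
  simp only [mul_one, integral_const, probReal_univ, smul_eq_mul] at h2
  rw [h1, h2, hν.variance_one, hν.variance_one, one_mul]

/-- The off-diagonal part of a quadratic form. -/
theorem IsStandardFamily.offDiag_bound (hν : IsStandardFamily ν) (Q : Matrix ι ι ℂ) :
    Integrable (fun ξ : ι → ℂ => ∑ a : ι × ι, if a.1 = a.2 then 0 else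
        starRingEnd ℂ (ξ a.1) * Q a.1 a.2 * ξ a.2) (Measure.pi ν) ∧
      ∫ ξ : ι → ℂ, ‖∑ a : ι × ι, if a.1 = a.2 then 0 else
        starRingEnd ℂ (ξ a.1) * Q a.1 a.2 * ξ a.2‖ ∂(Measure.pi ν)
      ≤ √(2 * ∑ i, ∑ j, ‖Q i j‖ ^ 2) := by
  have := hν.prob
  set T : ι × ι → (ι → ℂ) → ℂ := fun a ξ => if a.1 = a.2 then 0 else
        starRingEnd ℂ (ξ a.1) * Q a.1 a.2 * ξ a.2 with hTdef
  have hconj : ∀ i, Measurable fun ξ : ι → ℂ => starRingEnd ℂ (ξ i) := fun i =>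
    Complex.continuous_conj.measurable.comp (measurable_pi_apply i)
  have hT : ∀ a, Measurable (T a) := fun a => by
    simp only [hTdef]
    split_ifs
    · exact measurable_const
    · exact ((hconj _).mul_const _).mul (measurable_pi_apply _)
  have hsq : ∀ a ξ, ‖T a ξ‖ ^ 2
      = if a.1 = a.2 then 0 else ‖Q a.1 a.2‖ ^ 2 * (‖ξ a.1‖ ^ 2 * ‖ξ a.2‖ ^ 2) := fun a ξ => by
    simp only [hTdef]
    split_ifs
    · simp
    · simp only [norm_mul, RCLike.norm_conj]; ring
  have hT2 : ∀ a, Integrable (fun ξ => ‖T a ξ‖ ^ 2) (Measure.pi ν) := fun a => by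
    simp_rw [hsq]
    split_ifs with h
    · exact integrable_zero _ _ _
    · exact (Integrable.of_integral_ne_zero (by
        rw [hν.integral_sq_mul_sq h]; exact one_ne_zero)).const_mul _
  have hval : ∀ a, ∫ ξ, ‖T a ξ‖ ^ 2 ∂(Measure.pi ν) ≤ ‖Q a.1 a.2‖ ^ 2 := fun a => by
    simp_rw [hsq]
    split_ifs with h
    · simp
    · rw [integral_const_mul, hν.integral_sq_mul_sq h, mul_one]
  have hcm : ∀ i, ∫ e, starRingEnd ℂ e ∂(ν i) = 0 := fun i => by
    rw [integral_conj, hν.mean_zero]; simp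
  have horth : ∀ a b, b ≠ a → b ≠ (Equiv.prodComm ι ι) a →
      ∫ ξ, T a ξ * starRingEnd ℂ (T b ξ) ∂(Measure.pi ν) = 0 := by
    rintro ⟨i, j⟩ ⟨k, l⟩ h1 h2
    simp only [Equiv.prodComm_apply, Prod.swap_prod_mk, ne_eq, Prod.mk.injEq] at h1 h2
    simp only [hTdef]
    by_cases hij : i = j
    · simp [hij]
    by_cases hkl : k = l
    · simp [hkl]
    simp only [if_neg hij, if_neg hkl]
    have hmem : (i ≠ k ∧ i ≠ l) ∨ (j ≠ k ∧ j ≠ l) := by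
      by_contra hcon
      push Not at hcon
      rcases eq_or_ne i k with rfl | hik
      · rcases eq_or_ne j i with rfl | hji
        · exact hij rfl
        · exact h1 ⟨rfl, (hcon.2 hji).symm⟩
      · have hil := hcon.1 hik
        subst hil
        rcases eq_or_ne j k with rfl | hjk
        · exact h2 ⟨rfl, rfl⟩
        · exact hij (hcon.2 hjk).symm
    rcases hmem with ⟨hk, hl⟩ | ⟨hk, hl⟩
    · have h := integral_pi_mul (𝕜 := ℂ) ν i (φ := fun e => starRingEnd ℂ e)
        (h := fun ξ => Q i j * ξ j * starRingEnd ℂ (starRingEnd ℂ (ξ k) * Q k l * ξ l))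
        Complex.continuous_conj.measurable
        (((measurable_pi_apply j).const_mul _).mul (Complex.continuous_conj.measurable.comp
          (((hconj k).mul_const _).mul (measurable_pi_apply l))))
        (fun ξ e => by
          rw [Function.update_of_ne (Ne.symm hij), Function.update_of_ne hk.symm,
            Function.update_of_ne hl.symm])
      rw [hcm, zero_mul] at h
      rw [← h]
      refine integral_congr_ae (ae_of_all _ fun ξ => ?_)
      simp only
      ring
    · have h := integral_pi_mul (𝕜 := ℂ) ν j (φ := fun e => e)
        (h := fun ξ => starRingEnd ℂ (ξ i) * Q i j
          * starRingEnd ℂ (starRingEnd ℂ (ξ k) * Q k l * ξ l))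
        measurable_id
        (((hconj i).mul_const _).mul (Complex.continuous_conj.measurable.comp
          (((hconj k).mul_const _).mul (measurable_pi_apply l))))
        (fun ξ e => by
          rw [Function.update_of_ne hij, Function.update_of_ne hk.symm,
            Function.update_of_ne hl.symm])
      rw [hν.mean_zero, zero_mul] at h
      rw [← h]
      refine integral_congr_ae (ae_of_all _ fun ξ => ?_)
      simp only
      ring
  obtain ⟨hi, hb⟩ := integral_norm_sum_sq_le T hT hT2 (Equiv.prodComm ι ι) horth
  refine integral_norm_le_sqrt (Finset.measurable_sum _ fun a _ => hT a) hi (hb.trans ?_)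
  rw [← Finset.sum_product' Finset.univ Finset.univ fun i j => ‖Q i j‖ ^ 2]
  gcongr
  rw [Finset.univ_product_univ]
  exact Finset.sum_le_sum fun a _ => hval a

/-- The diagonal part of a quadratic form, truncated. -/
theorem IsStandardFamily.truncated_bound (hν : IsStandardFamily ν) (q : ι → ℂ) {B t : ℝ}
    (ht : 0 ≤ t) (hq : ∀ i, ‖q i‖ ≤ B) :
    Integrable (fun ξ : ι → ℂ => ∑ i, q i *
        ((min (‖ξ i‖ ^ 2) t - ∫ e, min (‖e‖ ^ 2) t ∂(ν i) : ℝ) : ℂ)) (Measure.pi ν) ∧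
      ∫ ξ : ι → ℂ, ‖∑ i, q i *
        ((min (‖ξ i‖ ^ 2) t - ∫ e, min (‖e‖ ^ 2) t ∂(ν i) : ℝ) : ℂ)‖ ∂(Measure.pi ν)
      ≤ √(2 * (Fintype.card ι * (B * t) ^ 2)) := by
  have := hν.prob
  set μ₀ : ι → ℝ := fun i => ∫ e, min (‖e‖ ^ 2) t ∂(ν i) with hμ₀
  set T : ι → (ι → ℂ) → ℂ := fun i ξ => q i * ((min (‖ξ i‖ ^ 2) t - μ₀ i : ℝ) : ℂ) with hTdef
  have hmin : ∀ e : ℂ, 0 ≤ min (‖e‖ ^ 2) t ∧ min (‖e‖ ^ 2) t ≤ t := fun e =>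
    ⟨le_min (by positivity) ht, min_le_right _ _⟩
  have hminm : Measurable fun e : ℂ => min (‖e‖ ^ 2) t := by fun_prop
  have hmini : ∀ i, Integrable (fun e : ℂ => min (‖e‖ ^ 2) t) (ν i) := fun i =>
    Integrable.of_bound hminm.aestronglyMeasurable t (ae_of_all _ fun e => by
      rw [Real.norm_of_nonneg (hmin e).1]; exact (hmin e).2)
  have hμb : ∀ i, 0 ≤ μ₀ i ∧ μ₀ i ≤ t := fun i => by
    refine ⟨integral_nonneg fun e => (hmin e).1, ?_⟩
    have := integral_mono (hmini i) (integrable_const t) fun e => (hmin e).2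
    simpa using this
  have hTm : ∀ i, Measurable (T i) := fun i => by
    simp only [hTdef]
    have : Measurable fun ξ : ι → ℂ => min (‖ξ i‖ ^ 2) t := hminm.comp (measurable_pi_apply i)
    fun_prop
  have hTb : ∀ i ξ, ‖T i ξ‖ ^ 2 ≤ (B * t) ^ 2 := fun i ξ => by
    have h1 : ‖((min (‖ξ i‖ ^ 2) t - μ₀ i : ℝ) : ℂ)‖ ≤ t := by
      rw [Complex.norm_real, Real.norm_eq_abs, abs_le]
      have := hmin (ξ i)
      have := hμb i
      constructor <;> linarith
    simp only [hTdef, norm_mul]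
    gcongr
    · exact (norm_nonneg _).trans (hq i)
    · exact hq i
  have hT2 : ∀ i, Integrable (fun ξ => ‖T i ξ‖ ^ 2) (Measure.pi ν) := fun i =>
    Integrable.of_bound ((hTm i).norm.pow_const 2).aestronglyMeasurable ((B * t) ^ 2)
      (ae_of_all _ fun ξ => by rw [Real.norm_of_nonneg (by positivity)]; exact hTb i ξ)
  have horth : ∀ a b, b ≠ a → b ≠ (Equiv.refl ι) a →
      ∫ ξ, T a ξ * starRingEnd ℂ (T b ξ) ∂(Measure.pi ν) = 0 := by
    intro a b hab _
    have h := integral_pi_mul (𝕜 := ℂ) ν a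
      (φ := fun e => q a * ((min (‖e‖ ^ 2) t - μ₀ a : ℝ) : ℂ))
      (h := fun ξ => starRingEnd ℂ (T b ξ)) (by fun_prop)
      (Complex.continuous_conj.measurable.comp (hTm b)) (fun ξ e => by
        simp only [hTdef, Function.update_of_ne hab])
    have h0 : ∫ e, q a * ((min (‖e‖ ^ 2) t - μ₀ a : ℝ) : ℂ) ∂(ν a) = 0 := by
      rw [integral_const_mul, integral_complex_ofReal,
        integral_sub (hmini a) (integrable_const _)]
      simp [hμ₀]
    rw [h0, zero_mul] at h
    exact h
  obtain ⟨hi, hb⟩ := integral_norm_sum_sq_le T hTm hT2 (Equiv.refl ι) horth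
  refine integral_norm_le_sqrt (Finset.measurable_sum _ fun a _ => hTm a) hi (hb.trans ?_)
  gcongr
  calc ∑ i, ∫ ξ, ‖T i ξ‖ ^ 2 ∂(Measure.pi ν) ≤ ∑ _i : ι, (B * t) ^ 2 := by
        refine Finset.sum_le_sum fun i _ => ?_
        have := integral_mono (hT2 i) (integrable_const ((B * t) ^ 2)) (hTb i)
        simpa using this
    _ = _ := by simp

end ProductMeasure

/-! ### Concentration of quadratic forms -/

section QuadraticForm

open Matrix

variable {ι : Type*} [Fintype ι] [DecidableEq ι] {ν : ι → Measure ℂ}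

theorem sq_sub_min_le {a t η : ℝ} (ha : 0 ≤ a) (ht : 0 < t) (hη : 0 < η) :
    a ^ 2 - min (a ^ 2) t ≤ a ^ (2 + η) * t ^ (-(η / 2)) := by
  rcases le_or_gt (a ^ 2) t with h | h
  · rw [min_eq_left h, sub_self]; positivity
  · have ha' : 0 < a := by
      rcases ha.eq_or_lt with rfl | h'
      · norm_num at h; linarith
      · exact h'
    have h1 : t ^ (η / 2) ≤ a ^ η := by
      calc t ^ (η / 2) ≤ (a ^ 2) ^ (η / 2) := Real.rpow_le_rpow ht.le h.le (by positivity)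
        _ = a ^ η := by
          rw [← Real.rpow_natCast, ← Real.rpow_mul ha]; congr 1; push_cast; ring
    have h2 : 1 ≤ a ^ η * t ^ (-(η / 2)) := by
      rw [Real.rpow_neg ht.le, ← div_eq_mul_inv, one_le_div (by positivity)]
      exact h1
    have h3 : a ^ (2 + η) = a ^ 2 * a ^ η := by
      rw [Real.rpow_add ha']; norm_num
    have h4 : 0 ≤ min (a ^ 2) t := le_min (by positivity) ht.le
    rw [h3, mul_assoc]
    nlinarith [sq_nonneg a]

/-- The tail of the truncated second moment. -/
theorem integral_sq_sub_min_le {μ : Measure ℂ} {η : ℝ} (hη : 0 < η) {M : ℝ≥0}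
    (hM : ∫⁻ e, ‖e‖ₑ ^ (2 + η) ∂μ ≤ M) {t : ℝ} (ht : 0 < t) :
    Integrable (fun e => ‖e‖ ^ 2 - min (‖e‖ ^ 2) t) μ ∧
      ∫ e, (‖e‖ ^ 2 - min (‖e‖ ^ 2) t) ∂μ ≤ M * t ^ (-(η / 2)) := by
  have hpow : ∀ e : ℂ, ‖e‖ₑ ^ (2 + η) = ENNReal.ofReal (‖e‖ ^ (2 + η)) := fun e => by
    rw [← ofReal_norm, ENNReal.ofReal_rpow_of_nonneg (norm_nonneg _) (by positivity)]
  simp_rw [hpow] at hM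
  have hmeas : Measurable fun e : ℂ => ‖e‖ ^ (2 + η) := by fun_prop
  have hi : Integrable (fun e : ℂ => ‖e‖ ^ (2 + η)) μ := by
    refine ⟨hmeas.aestronglyMeasurable, ?_⟩
    rw [hasFiniteIntegral_iff_ofReal (ae_of_all _ fun e => by positivity)]
    exact hM.trans_lt ENNReal.coe_lt_top
  have hle : ∫ e, ‖e‖ ^ (2 + η) ∂μ ≤ M := by
    rw [integral_eq_lintegral_of_nonneg_ae (ae_of_all _ fun e => by positivity)
      hmeas.aestronglyMeasurable]
    exact ENNReal.toReal_le_coe_of_le_coe hM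
  have hnn : ∀ e : ℂ, 0 ≤ ‖e‖ ^ 2 - min (‖e‖ ^ 2) t := fun e => sub_nonneg.2 (min_le_left _ _)
  have hgi : Integrable (fun e : ℂ => ‖e‖ ^ 2 - min (‖e‖ ^ 2) t) μ := by
    refine (hi.mul_const (t ^ (-(η / 2)))).mono' (by fun_prop) (ae_of_all _ fun e => ?_)
    rw [Real.norm_of_nonneg (hnn e)]
    exact sq_sub_min_le (norm_nonneg _) ht hη
  refine ⟨hgi, ?_⟩
  calc _ ≤ ∫ e, ‖e‖ ^ (2 + η) * t ^ (-(η / 2)) ∂μ :=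
        integral_mono hgi (hi.mul_const _) fun e => sq_sub_min_le (norm_nonneg _) ht hη
    _ ≤ _ := by
        rw [integral_mul_const]
        gcongr

/-- The bound for the mean deviation of a quadratic form of size `N`. -/
def quadBound (η M N : ℝ) : ℝ :=
  √(2 * N) + √(2 * (N * (N ^ (1 / 4 : ℝ)) ^ 2)) + N * (2 * (M * (N ^ (1 / 4 : ℝ)) ^ (-(η / 2))))

theorem IsStandardFamily.quadForm_bound (hν : IsStandardFamily ν) {η : ℝ} (hη : 0 < η) {M : ℝ≥0}
    (hM : ∀ i, ∫⁻ e, ‖e‖ₑ ^ (2 + η) ∂(ν i) ≤ M) (Q : Matrix ι ι ℂ)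
    (hQ : ∑ i, ∑ j, ‖Q i j‖ ^ 2 ≤ Fintype.card ι) (hq : ∀ i, ‖Q i i‖ ≤ 1)
    (hι : 0 < Fintype.card ι) :
    Integrable (fun ξ : ι → ℂ => star ξ ⬝ᵥ (Q *ᵥ ξ) - Q.trace) (Measure.pi ν) ∧
      ∫ ξ : ι → ℂ, ‖star ξ ⬝ᵥ (Q *ᵥ ξ) - Q.trace‖ ∂(Measure.pi ν)
      ≤ quadBound η M (Fintype.card ι) := by
  have := hν.prob
  set N : ℝ := (Fintype.card ι : ℝ) with hN
  have hN0 : 0 < N := by rw [hN]; exact_mod_cast hι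
  set t : ℝ := N ^ (1 / 4 : ℝ) with ht
  have ht0 : 0 < t := by positivity
  set g : ℂ → ℝ := fun e => ‖e‖ ^ 2 - min (‖e‖ ^ 2) t with hg
  have hgm : Measurable g := by simp only [hg]; fun_prop
  have hnn : ∀ e : ℂ, 0 ≤ g e := fun e => sub_nonneg.2 (min_le_left _ _)
  have hgi : ∀ i, Integrable g (ν i) := fun i => (integral_sq_sub_min_le hη (hM i) ht0).1
  have hgb : ∀ i, ∫ e, g e ∂(ν i) ≤ M * t ^ (-(η / 2)) := fun i =>
    (integral_sq_sub_min_le hη (hM i) ht0).2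
  obtain ⟨oi, ob⟩ := hν.offDiag_bound Q
  obtain ⟨ti, tb⟩ := hν.truncated_bound (fun i => Q i i) ht0.le hq
  set A : (ι → ℂ) → ℂ := fun ξ => ∑ a : ι × ι, if a.1 = a.2 then 0 else
        starRingEnd ℂ (ξ a.1) * Q a.1 a.2 * ξ a.2 with hA
  set C : (ι → ℂ) → ℂ := fun ξ => ∑ i, Q i i *
        ((min (‖ξ i‖ ^ 2) t - ∫ e, min (‖e‖ ^ 2) t ∂(ν i) : ℝ) : ℂ) with hC
  set D : (ι → ℂ) → ℂ := fun ξ => ∑ i, Q i i * ((g (ξ i) - ∫ e, g e ∂(ν i) : ℝ) : ℂ) with hD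
  have hgpi : ∀ i, Integrable (fun ξ : ι → ℂ => g (ξ i)) (Measure.pi ν) := fun i =>
    (measurePreserving_eval ν i).integrable_comp_of_integrable (hgi i)
  have hgpv : ∀ i, ∫ ξ : ι → ℂ, g (ξ i) ∂(Measure.pi ν) = ∫ e, g e ∂(ν i) := fun i => by
    rw [← (measurePreserving_eval ν i).map_eq,
      integral_map (measurable_pi_apply i).aemeasurable hgm.aestronglyMeasurable]
  have hDi : Integrable D (Measure.pi ν) :=
    integrable_finsetSum _ fun i _ =>
      (((hgpi i).sub (integrable_const _)).ofReal).const_mul _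
  have hDb : ∫ ξ, ‖D ξ‖ ∂(Measure.pi ν) ≤ N * (2 * (M * t ^ (-(η / 2)))) := by
    have hpt : ∀ ξ, ‖D ξ‖ ≤ ∑ i, (g (ξ i) + ∫ e, g e ∂(ν i)) := fun ξ => by
      refine (norm_sum_le _ _).trans (Finset.sum_le_sum fun i _ => ?_)
      have h0 : 0 ≤ ∫ e, g e ∂(ν i) := integral_nonneg hnn
      have h1 := hnn (ξ i)
      rw [norm_mul, Complex.norm_real]
      have h2 : ‖g (ξ i) - ∫ e, g e ∂(ν i)‖ ≤ g (ξ i) + ∫ e, g e ∂(ν i) := by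
        rw [Real.norm_eq_abs, abs_le]; constructor <;> linarith
      nlinarith [hq i, norm_nonneg (Q i i), norm_nonneg (g (ξ i) - ∫ e, g e ∂(ν i))]
    have hsi : ∀ i, Integrable (fun ξ : ι → ℂ => g (ξ i) + ∫ e, g e ∂(ν i)) (Measure.pi ν) :=
      fun i => (hgpi i).add (integrable_const _)
    calc ∫ ξ, ‖D ξ‖ ∂(Measure.pi ν)
        ≤ ∫ ξ : ι → ℂ, ∑ i, (g (ξ i) + ∫ e, g e ∂(ν i)) ∂(Measure.pi ν) :=
          integral_mono hDi.norm (integrable_finsetSum _ fun i _ => hsi i) hpt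
      _ = ∑ i, 2 * ∫ e, g e ∂(ν i) := by
          rw [integral_finsetSum _ fun i _ => hsi i]
          refine Finset.sum_congr rfl fun i _ => ?_
          rw [integral_add (hgpi i) (integrable_const _), hgpv]
          simp; ring
      _ ≤ ∑ _i : ι, 2 * (M * t ^ (-(η / 2))) := by
          refine Finset.sum_le_sum fun i _ => ?_
          have := hgb i
          linarith
      _ = _ := by simp [hN]
  have hmini : ∀ i, Integrable (fun e : ℂ => min (‖e‖ ^ 2) t) (ν i) := fun i =>
    Integrable.of_bound (C := t) (by fun_prop) (ae_of_all _ fun e => by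
      rw [Real.norm_of_nonneg (le_min (by positivity) ht0.le)]; exact min_le_right _ _)
  have hone : ∀ i, (∫ e, min (‖e‖ ^ 2) t ∂(ν i)) + ∫ e, g e ∂(ν i) = 1 := fun i => by
    rw [← integral_add (hmini i) (hgi i), ← hν.variance_one i]
    refine integral_congr_ae (ae_of_all _ fun e => ?_)
    simp [hg]
  have hdec : ∀ ξ : ι → ℂ, star ξ ⬝ᵥ (Q *ᵥ ξ) - Q.trace = A ξ + C ξ + D ξ := fun ξ => by
    have h1 : star ξ ⬝ᵥ (Q *ᵥ ξ) = A ξ + ∑ i, Q i i * ((‖ξ i‖ ^ 2 : ℝ) : ℂ) := by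
      have e1 : star ξ ⬝ᵥ (Q *ᵥ ξ)
          = ∑ a : ι × ι, starRingEnd ℂ (ξ a.1) * Q a.1 a.2 * ξ a.2 := by
        rw [← Finset.univ_product_univ, Finset.sum_product]
        simp only [dotProduct, mulVec, Finset.mul_sum, Pi.star_apply, RCLike.star_def, mul_assoc]
      have e2 : ∑ i, Q i i * ((‖ξ i‖ ^ 2 : ℝ) : ℂ)
          = ∑ a : ι × ι, if a.1 = a.2 then starRingEnd ℂ (ξ a.1) * Q a.1 a.2 * ξ a.2 else 0 := by
        rw [← Finset.univ_product_univ, Finset.sum_product]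
        refine Finset.sum_congr rfl fun i _ => ?_
        simp only [Finset.sum_ite_eq, Finset.mem_univ, if_true]
        rw [← Complex.normSq_eq_norm_sq, ← Complex.mul_conj]
        ring
      rw [e1, e2, hA, ← Finset.sum_add_distrib]
      refine Finset.sum_congr rfl fun a _ => ?_
      split_ifs <;> simp
    have h2 : ∑ i, Q i i * ((‖ξ i‖ ^ 2 : ℝ) : ℂ) - Q.trace = C ξ + D ξ := by
      rw [hC, hD, trace, ← Finset.sum_sub_distrib, ← Finset.sum_add_distrib]
      refine Finset.sum_congr rfl fun i _ => ?_
      have h3 := hone i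
      rw [diag_apply, ← mul_add, ← Complex.ofReal_add]
      have h4 : (min (‖ξ i‖ ^ 2) t - ∫ e, min (‖e‖ ^ 2) t ∂(ν i)) + (g (ξ i) - ∫ e, g e ∂(ν i))
          = ‖ξ i‖ ^ 2 - 1 := by
        rw [← h3]; simp only [hg]; ring
      rw [h4]; push_cast; ring
    rw [h1, add_sub_assoc, h2, add_assoc]
  simp_rw [hdec]
  refine ⟨(oi.add ti).add hDi, ?_⟩
  have hpt : ∀ ξ, ‖A ξ + C ξ + D ξ‖ ≤ ‖A ξ‖ + ‖C ξ‖ + ‖D ξ‖ := fun ξ => norm_add₃_le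
  have hAC : Integrable (fun ξ => ‖A ξ‖ + ‖C ξ‖) (Measure.pi ν) := oi.norm.add ti.norm
  calc _ ≤ ∫ ξ, (‖A ξ‖ + ‖C ξ‖ + ‖D ξ‖) ∂(Measure.pi ν) :=
        integral_mono ((oi.add ti).add hDi).norm (hAC.add hDi.norm) hpt
    _ = (∫ ξ, ‖A ξ‖ ∂(Measure.pi ν)) + (∫ ξ, ‖C ξ‖ ∂(Measure.pi ν))
          + ∫ ξ, ‖D ξ‖ ∂(Measure.pi ν) := by
        rw [integral_add hAC hDi.norm, integral_add oi.norm ti.norm]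
    _ ≤ _ := by
        unfold quadBound
        rw [one_mul] at tb
        gcongr
        exact ob.trans (Real.sqrt_le_sqrt (by linarith))

theorem tendsto_quadBound_div {η : ℝ} (hη : 0 < η) (M : ℝ) :
    Tendsto (fun N : ℝ => quadBound η M N / N) atTop (𝓝 0) := by
  have h1 : Tendsto (fun N : ℝ => √2 * N ^ (-(1 / 2 : ℝ)) + √2 * N ^ (-(1 / 4 : ℝ))
      + 2 * M * N ^ (-(η / 8))) atTop (𝓝 (√2 * 0 + √2 * 0 + 2 * M * 0)) :=
    (((tendsto_rpow_neg_atTop (by norm_num)).const_mul _).add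
      ((tendsto_rpow_neg_atTop (by norm_num)).const_mul _)).add
      ((tendsto_rpow_neg_atTop (by positivity)).const_mul _)
  simp only [mul_zero, add_zero] at h1
  refine h1.congr' ?_
  filter_upwards [eventually_gt_atTop (0 : ℝ)] with N hN
  unfold quadBound
  have e1 : √(2 * N) = √2 * N ^ (1 / 2 : ℝ) := by
    rw [Real.sqrt_mul (by norm_num), Real.sqrt_eq_rpow N]
  have e2 : √(2 * (N * (N ^ (1 / 4 : ℝ)) ^ 2)) = √2 * N ^ (3 / 4 : ℝ) := by
    rw [Real.sqrt_mul (by norm_num)]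
    congr 1
    rw [Real.sqrt_eq_iff_eq_sq (by positivity) (by positivity), ← Real.rpow_natCast,
      ← Real.rpow_mul hN.le, ← Real.rpow_natCast, ← Real.rpow_mul hN.le]
    nth_rewrite 1 [← Real.rpow_one N]
    rw [← Real.rpow_add hN]
    norm_num
  have e3 : (N ^ (1 / 4 : ℝ)) ^ (-(η / 2)) = N ^ (-(η / 8)) := by
    rw [← Real.rpow_mul hN.le]; congr 1; ring
  rw [e1, e2, e3, eq_div_iff hN.ne', add_mul, add_mul]
  have e4 : N ^ (-(1 / 2 : ℝ)) * N = N ^ (1 / 2 : ℝ) := by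
    rw [← Real.rpow_add_one hN.ne']; norm_num
  have e5 : N ^ (-(1 / 4 : ℝ)) * N = N ^ (3 / 4 : ℝ) := by
    rw [← Real.rpow_add_one hN.ne']; norm_num
  rw [mul_assoc, mul_assoc, e4, e5]
  ring

end QuadraticForm

/-! ### McDiarmid's inequality -/

section BoundedDifferences

theorem integrable_of_measurable_of_abs_le {Ω : Type*} [MeasurableSpace Ω] {μ : Measure Ω}
    [IsFiniteMeasure μ] {f : Ω → ℝ} (hf : Measurable f) {C : ℝ} (hC : ∀ ω, |f ω| ≤ C) :
    Integrable f μ :=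
  Integrable.of_bound hf.aestronglyMeasurable C (ae_of_all _ hC)

theorem integrable_exp_mul_of_abs_le {Ω : Type*} [MeasurableSpace Ω] {μ : Measure Ω}
    [IsFiniteMeasure μ] {f : Ω → ℝ} (hf : Measurable f) {C : ℝ} (hC : ∀ ω, |f ω| ≤ C) (t : ℝ) :
    Integrable (fun ω => Real.exp (t * f ω)) μ := by
  refine integrable_of_measurable_of_abs_le (C := Real.exp (|t| * C)) (by fun_prop) fun ω => ?_
  rw [abs_of_pos (Real.exp_pos _), Real.exp_le_exp]
  refine (le_abs_self _).trans ?_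
  rw [abs_mul]
  exact mul_le_mul_of_nonneg_left (hC ω) (abs_nonneg t)

/-- Hoeffding's lemma for a function of oscillation at most `δ`. -/
theorem integral_exp_mul_sub_le {E : Type*} [MeasurableSpace E] (μ : Measure E)
    [IsProbabilityMeasure μ] {F : E → ℝ} (hF : Measurable F) {δ : ℝ}
    (hosc : ∀ e e', |F e - F e'| ≤ δ) (t : ℝ) :
    ∫ e, Real.exp (t * (F e - ∫ e', F e' ∂μ)) ∂μ ≤ Real.exp (δ ^ 2 * t ^ 2 / 2) := by
  obtain ⟨e₀⟩ : Nonempty E := nonempty_of_isProbabilityMeasure μ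
  have h := hasSubgaussianMGF_of_mem_Icc (μ := μ) (X := F) (a := F e₀ - δ) (b := F e₀ + δ)
    hF.aemeasurable (ae_of_all _ fun e => by
      have := abs_le.1 (hosc e e₀)
      constructor <;> linarith)
  refine (h.mgf_le t).trans_eq ?_
  congr 2
  have h1 : F e₀ + δ - (F e₀ - δ) = 2 * δ := by ring
  rw [h1]
  push_cast
  rw [Real.norm_eq_abs, abs_mul, abs_two, mul_div_cancel_left₀ _ (two_ne_zero), sq_abs]

theorem integral_exp_bounded_differences {E : Type*} [MeasurableSpace E] {n : ℕ}
    (ν : Fin n → Measure E) [∀ i, IsProbabilityMeasure (ν i)] {f : (Fin n → E) → ℝ}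
    (hf : Measurable f) {C δ : ℝ} (hC : ∀ x, |f x| ≤ C)
    (hδ : ∀ x j e, |f (Function.update x j e) - f x| ≤ δ) (t : ℝ) :
    ∫ x, Real.exp (t * (f x - ∫ y, f y ∂(Measure.pi ν))) ∂(Measure.pi ν)
      ≤ Real.exp (n * δ ^ 2 * t ^ 2 / 2) := by
  induction n with
  | zero =>
    have h0 : ∀ x, f x = f Fin.elim0 := fun x => by rw [Subsingleton.elim x Fin.elim0]
    have : ∀ x, f x - ∫ y, f y ∂(Measure.pi ν) = 0 := fun x => by
      simp_rw [h0]; simp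
    simp_rw [this]
    simp
  | succ n ih =>
    set ν' : Fin n → Measure E := fun j => ν ((0 : Fin (n + 1)).succAbove j) with hν'
    have hmp := (measurePreserving_piFinSuccAbove ν 0).symm
    set φ : E × (Fin n → E) → (Fin (n + 1) → E) := fun q => Fin.insertNth 0 q.1 q.2 with hφ
    have hφe : ⇑(MeasurableEquiv.piFinSuccAbove (fun _ : Fin (n + 1) => E) 0).symm = φ := rfl
    rw [hφe] at hmp
    have hchange : ∀ g : (Fin (n + 1) → E) → ℝ, Measurable g → ∫ x, g x ∂(Measure.pi ν)
        = ∫ q, g (φ q) ∂((ν 0).prod (Measure.pi ν')) := fun g hg => by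
      rw [← hmp.map_eq, integral_map hmp.measurable.aemeasurable hg.aestronglyMeasurable]
    have hfφ : Measurable fun q => f (φ q) := hf.comp hmp.measurable
    have hsec : ∀ e, Measurable fun y => f (φ (e, y)) := fun e =>
      hfφ.comp measurable_prodMk_left
    have hupd0 : ∀ e e' y, φ (e, y) = Function.update (φ (e', y)) 0 e := fun e e' y => by
      simp [hφ]
    have hupd : ∀ e y j e', φ (e, Function.update y j e')
        = Function.update (φ (e, y)) ((0 : Fin (n + 1)).succAbove j) e' := fun e y j e' => by
      simp [hφ]
    set F : E → ℝ := fun e => ∫ y, f (φ (e, y)) ∂(Measure.pi ν') with hF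
    have hFm : Measurable F := by
      have := hfφ.stronglyMeasurable.integral_prod_right' (ν := Measure.pi ν')
      exact this.measurable
    have hi : ∀ e, Integrable (fun y => f (φ (e, y))) (Measure.pi ν') := fun e =>
      integrable_of_measurable_of_abs_le (hsec e) fun y => hC _
    have hFosc : ∀ e e', |F e - F e'| ≤ δ := fun e e' => by
      simp only [hF]
      rw [← integral_sub (hi e) (hi e')]
      have := norm_integral_le_of_norm_le_const (μ := Measure.pi ν') (C := δ)
        (f := fun y => f (φ (e, y)) - f (φ (e', y))) (ae_of_all _ fun y => by
          rw [hupd0 e e' y]; exact hδ _ _ _)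
      simpa using this
    have hFC : ∀ e, |F e| ≤ C := fun e => by
      have := norm_integral_le_of_norm_le_const (μ := Measure.pi ν') (C := C)
        (f := fun y => f (φ (e, y))) (ae_of_all _ fun y => hC _)
      simpa using this
    have hifφ : Integrable (fun q => f (φ q)) ((ν 0).prod (Measure.pi ν')) :=
      integrable_of_measurable_of_abs_le hfφ fun q => hC _
    have hmean : ∫ y, f y ∂(Measure.pi ν) = ∫ e, F e ∂(ν 0) := by
      rw [hchange f hf, integral_prod _ hifφ]
    set m : ℝ := ∫ e, F e ∂(ν 0) with hm
    have hmC : |m| ≤ C := by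
      have := norm_integral_le_of_norm_le_const (μ := ν 0) (C := C) (f := F) (ae_of_all _ hFC)
      simpa using this
    rw [hmean, hchange _ (by fun_prop), integral_prod]
    · have hinner : ∀ e, ∫ y, Real.exp (t * (f (φ (e, y)) - m)) ∂(Measure.pi ν')
          ≤ Real.exp (t * (F e - m)) * Real.exp (n * δ ^ 2 * t ^ 2 / 2) := fun e => by
        have h1 := ih ν' (f := fun y => f (φ (e, y))) (hsec e) (fun y => hC _)
          (fun y j e' => by rw [hupd]; exact hδ _ _ _)
        calc _ = ∫ y, Real.exp (t * (F e - m)) * Real.exp (t * (f (φ (e, y)) - F e))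
              ∂(Measure.pi ν') := by
              refine integral_congr_ae (ae_of_all _ fun y => ?_)
              simp only
              rw [← Real.exp_add]; congr 1; ring
          _ = Real.exp (t * (F e - m)) * ∫ y, Real.exp (t * (f (φ (e, y)) - F e))
              ∂(Measure.pi ν') := integral_const_mul _ _
          _ ≤ _ := by gcongr
      have hb : ∀ e, |F e - m| ≤ C + C := fun e => by
        have := abs_sub (F e) m
        linarith [hFC e]
      have hint : Integrable (fun e => Real.exp (t * (F e - m))
          * Real.exp (n * δ ^ 2 * t ^ 2 / 2)) (ν 0) :=
        (integrable_exp_mul_of_abs_le (hFm.sub_const m) hb t).mul_const _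
      calc _ ≤ ∫ e, Real.exp (t * (F e - m)) * Real.exp (n * δ ^ 2 * t ^ 2 / 2) ∂(ν 0) :=
            integral_mono_of_nonneg (ae_of_all _ fun e => integral_nonneg fun y =>
              (Real.exp_pos _).le) hint (ae_of_all _ hinner)
        _ ≤ Real.exp (δ ^ 2 * t ^ 2 / 2) * Real.exp (n * δ ^ 2 * t ^ 2 / 2) := by
            rw [integral_mul_const]
            gcongr
            exact integral_exp_mul_sub_le (ν 0) hFm hFosc t
        _ = _ := by
            rw [← Real.exp_add]; congr 1; push_cast; ring
    · refine integrable_exp_mul_of_abs_le (C := C + C) (f := fun q => f (φ q) - m)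
        (hfφ.sub_const m) (fun q => ?_) t
      have := abs_sub (f (φ q)) m
      linarith [hC (φ q)]

/-- McDiarmid's inequality. -/
theorem measure_ge_le_of_bounded_differences {E : Type*} [MeasurableSpace E] {n : ℕ}
    (ν : Fin n → Measure E) [∀ i, IsProbabilityMeasure (ν i)] {f : (Fin n → E) → ℝ}
    (hf : Measurable f) {C δ : ℝ} (hC : ∀ x, |f x| ≤ C)
    (hδ : ∀ x j e, |f (Function.update x j e) - f x| ≤ δ) {ε : ℝ} (hε : 0 ≤ ε) :
    (Measure.pi ν).real {x | ε ≤ f x - ∫ y, f y ∂(Measure.pi ν)}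
      ≤ Real.exp (-ε ^ 2 / (2 * (n * δ ^ 2))) := by
  have hb : ∀ x, |f x - ∫ y, f y ∂(Measure.pi ν)| ≤ C + C := fun x => by
    have h1 := abs_sub (f x) (∫ y, f y ∂(Measure.pi ν))
    have h2 := norm_integral_le_of_norm_le_const (μ := Measure.pi ν) (C := C) (f := f)
      (ae_of_all _ hC)
    simp only [probReal_univ, mul_one, Real.norm_eq_abs] at h2
    linarith [hC x]
  have h : HasSubgaussianMGF (fun x => f x - ∫ y, f y ∂(Measure.pi ν))
      (⟨n * δ ^ 2, by positivity⟩ : ℝ≥0) (Measure.pi ν) :=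
    ⟨fun t => integrable_exp_mul_of_abs_le (hf.sub_const _) hb t,
      fun t => integral_exp_bounded_differences ν hf hC hδ t⟩
  exact h.measure_ge_le hε

end BoundedDifferences

/-! ### The residual is small -/

section Residual

open Matrix

variable {p n : ℕ}

/-- The matrix of the form `ξ ↦ ξ(k)ᴴ G ξ(l)`. -/
def blockForm (k l : Fin 2) (G : Matrix (Fin p) (Fin p) ℂ) :
    Matrix (Fin 2 × Fin p) (Fin 2 × Fin p) ℂ :=
  fun a b => if a.1 = k ∧ b.1 = l then G a.2 b.2 else 0

theorem star_dotProduct_blockForm (k l : Fin 2) (G : Matrix (Fin p) (Fin p) ℂ)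
    (ξ : Fin 2 × Fin p → ℂ) :
    star ξ ⬝ᵥ (blockForm k l G *ᵥ ξ)
      = (star fun a => ξ (k, a)) ⬝ᵥ (G *ᵥ fun a => ξ (l, a)) := by
  simp only [dotProduct, mulVec, Fintype.sum_prod_type, blockForm, Pi.star_apply]
  fin_cases k <;> fin_cases l <;> simp

theorem trace_blockForm (k l : Fin 2) (G : Matrix (Fin p) (Fin p) ℂ) :
    (blockForm k l G).trace = if k = l then G.trace else 0 := by
  simp only [trace, diag_apply, Fintype.sum_prod_type, blockForm]
  fin_cases k <;> fin_cases l <;> simp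

theorem sum_norm_blockForm_sq (k l : Fin 2) (G : Matrix (Fin p) (Fin p) ℂ) :
    ∑ a, ∑ b, ‖blockForm k l G a b‖ ^ 2 = ∑ i, ∑ j, ‖G i j‖ ^ 2 := by
  simp only [Fintype.sum_prod_type, blockForm]
  fin_cases k <;> fin_cases l <;> simp

/-- The deviation of a block quadratic form from its mean. -/
def blockDeviation (k l : Fin 2) (G : Matrix (Fin p) (Fin p) ℂ) (ξ : Fin 2 × Fin p → ℂ) : ℂ :=
  star ξ ⬝ᵥ (blockForm k l G *ᵥ ξ) - (blockForm k l G).trace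

theorem formError_eq (G : Matrix (Fin p) (Fin p) ℂ) (ξ : Fin 2 × Fin p → ℂ) :
    formError n G ξ = (n : ℝ)⁻¹ * (‖blockDeviation 0 0 G ξ‖ + ‖blockDeviation 0 1 G ξ‖
      + ‖blockDeviation 1 0 G ξ‖ + ‖blockDeviation 1 1 G ξ‖ + ‖blockDeviation 0 0 1 ξ‖
      + ‖blockDeviation 1 1 1 ξ‖) := by
  have hn : ‖(n : ℂ)⁻¹‖ = (n : ℝ)⁻¹ := by simp
  have hsq : ∀ k : Fin 2, |(n : ℝ)⁻¹ * sqNorm (fun a => ξ (k, a)) - p / n|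
      = (n : ℝ)⁻¹ * ‖((sqNorm fun a => ξ (k, a) : ℝ) : ℂ) - (p : ℂ)‖ := fun k => by
    have h1 : ((sqNorm fun a => ξ (k, a) : ℝ) : ℂ) - (p : ℂ)
        = ((sqNorm (fun a => ξ (k, a)) - p : ℝ) : ℂ) := by push_cast; rfl
    have h2 : (n : ℝ)⁻¹ * sqNorm (fun a => ξ (k, a)) - p / n
        = (n : ℝ)⁻¹ * (sqNorm (fun a => ξ (k, a)) - p) := by ring
    rw [h1, h2, Complex.norm_real, abs_mul, Real.norm_eq_abs, abs_of_nonneg (by positivity)]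
  unfold formError blockDeviation
  simp only [star_dotProduct_blockForm, trace_blockForm, hsq, ← mul_sub, norm_mul, hn,
    one_mulVec, star_dotProduct_self, trace_one, Fintype.card_fin]
  simp
  ring

theorem blockDeviation_bound {ν : Fin 2 × Fin p → Measure ℂ} (hν : IsStandardFamily ν) {η : ℝ}
    (hη : 0 < η) {M : ℝ≥0} (hM : ∀ i, ∫⁻ e, ‖e‖ₑ ^ (2 + η) ∂(ν i) ≤ M) (hp : 0 < p) (k l : Fin 2)
    {G : Matrix (Fin p) (Fin p) ℂ} (hG : ∑ i, ∑ j, ‖G i j‖ ^ 2 ≤ p) (hg : ∀ i, ‖G i i‖ ≤ 1) :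
    Integrable (blockDeviation k l G) (Measure.pi ν) ∧
      ∫ ξ, ‖blockDeviation k l G ξ‖ ∂(Measure.pi ν) ≤ quadBound η M (2 * p) := by
  have hcard : Fintype.card (Fin 2 × Fin p) = 2 * p := by simp
  have h := hν.quadForm_bound hη hM (blockForm k l G)
    (by
      rw [sum_norm_blockForm_sq, hcard]
      push_cast
      have : (0 : ℝ) ≤ p := by positivity
      linarith)
    (fun i => by
      unfold blockForm
      split_ifs
      · exact hg _
      · simp)
    (by rw [hcard]; omega)
  rw [hcard] at h
  push_cast at h
  exact h

theorem integral_formError_le {ν : Fin 2 × Fin p → Measure ℂ} (hν : IsStandardFamily ν) {η : ℝ}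
    (hη : 0 < η) {M : ℝ≥0} (hM : ∀ i, ∫⁻ e, ‖e‖ₑ ^ (2 + η) ∂(ν i) ≤ M) (hp : 0 < p)
    {G : Matrix (Fin p) (Fin p) ℂ} (hG : ∑ i, ∑ j, ‖G i j‖ ^ 2 ≤ p) (hg : ∀ i, ‖G i i‖ ≤ 1) :
    Integrable (formError n G) (Measure.pi ν) ∧
      ∫ ξ, formError n G ξ ∂(Measure.pi ν) ≤ (n : ℝ)⁻¹ * (6 * quadBound η M (2 * p)) := by
  have h1 := fun k l => blockDeviation_bound hν hη hM hp k l hG hg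
  have hone : ∑ i, ∑ j, ‖(1 : Matrix (Fin p) (Fin p) ℂ) i j‖ ^ 2 ≤ (p : ℝ) := by
    refine le_of_eq ?_
    have : ∀ i j, ‖(1 : Matrix (Fin p) (Fin p) ℂ) i j‖ ^ 2 = if i = j then 1 else 0 := by
      intro i j
      rw [one_apply]; split_ifs <;> simp
    simp [this]
  have h2 := fun k l => blockDeviation_bound hν hη hM hp k l hone (fun i => by simp)
  have hfe : formError n G = _ := funext fun ξ => formError_eq (n := n) G ξ
  rw [hfe]
  have i4 := (((h1 0 0).1.norm.add (h1 0 1).1.norm).add (h1 1 0).1.norm).add (h1 1 1).1.norm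
  have i5 := i4.add (h2 0 0).1.norm
  refine ⟨(i5.add (h2 1 1).1.norm).const_mul _, ?_⟩
  rw [integral_const_mul]
  refine mul_le_mul_of_nonneg_left ?_ (by positivity)
  have e6 := integral_add i5 (h2 1 1).1.norm
  have e5 := integral_add i4 (h2 0 0).1.norm
  have e4 := integral_add (((h1 0 0).1.norm.add (h1 0 1).1.norm).add (h1 1 0).1.norm)
    (h1 1 1).1.norm
  have e3 := integral_add ((h1 0 0).1.norm.add (h1 0 1).1.norm) (h1 1 0).1.norm
  have e2 := integral_add (h1 0 0).1.norm (h1 0 1).1.norm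
  simp only [Pi.add_apply] at e2 e3 e4 e5 e6
  rw [e6, e5, e4, e3, e2]
  linarith [(h1 0 0).2, (h1 0 1).2, (h1 1 0).2, (h1 1 1).2, (h2 0 0).2, (h2 1 1).2]

theorem continuous_pairMatrix :
    Continuous (pairMatrix : (Fin 2 × Fin p → ℂ) → Matrix (Fin p) (Fin p) ℂ) := by
  refine continuous_matrix fun i j => ?_
  simp only [pairMatrix, Matrix.smul_apply, Matrix.sub_apply, vecMulVec_apply, Pi.star_apply]
  fun_prop

theorem continuous_columnMatrix :
    Continuous (columnMatrix : (Fin n → Fin 2 × Fin p → ℂ) → Matrix (Fin p) (Fin p) ℂ) := by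
  have h : Continuous fun x : Fin n → Fin 2 × Fin p → ℂ => ∑ j, pairMatrix (x j) :=
    continuous_finsetSum _ fun j _ => continuous_pairMatrix.comp (continuous_apply j)
  exact h.const_smul ((n : ℝ)⁻¹ : ℂ)

theorem continuous_resolv_columnMatrix {z : ℂ} (hz : 0 < z.im) :
    Continuous fun x : Fin n → Fin 2 × Fin p → ℂ => resolv (columnMatrix x) z := by
  unfold resolv
  have hc : Continuous fun x : Fin n → Fin 2 × Fin p → ℂ =>
      columnMatrix x - z • (1 : Matrix (Fin p) (Fin p) ℂ) :=
    continuous_columnMatrix.sub continuous_const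
  simp_rw [Matrix.inv_def, Ring.inverse_eq_inv']
  refine Continuous.smul (hc.matrix_det.inv₀ fun x => ?_) hc.matrix_adjugate
  have := isUnit_sub_smul (isHermitian_columnMatrix x) hz
  exact ((isUnit_iff_isUnit_det _).1 this).ne_zero

theorem continuous_formError :
    Continuous fun q : Matrix (Fin p) (Fin p) ℂ × (Fin 2 × Fin p → ℂ) => formError n q.1 q.2 := by
  unfold formError sqNorm
  have hf : ∀ k : Fin 2, Continuous fun q : Matrix (Fin p) (Fin p) ℂ × (Fin 2 × Fin p → ℂ) =>
      fun a => q.2 (k, a) := fun k => by fun_prop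
  have hform : ∀ k l : Fin 2,
      Continuous fun q : Matrix (Fin p) (Fin p) ℂ × (Fin 2 × Fin p → ℂ) =>
        (star fun a => q.2 (k, a)) ⬝ᵥ (q.1 *ᵥ fun a => q.2 (l, a)) := fun k l =>
    (hf k).star.dotProduct (continuous_fst.matrix_mulVec (hf l))
  have htr : Continuous fun q : Matrix (Fin p) (Fin p) ℂ × (Fin 2 × Fin p → ℂ) => q.1.trace :=
    continuous_fst.matrix_trace
  have h00 := hform 0 0
  have h01 := hform 0 1
  have h10 := hform 1 0
  have h11 := hform 1 1
  fun_prop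

theorem measurable_colStieltjes {z : ℂ} (hz : 0 < z.im) :
    Measurable (colStieltjes z : (Fin n → Fin 2 × Fin p → ℂ) → ℂ) := by
  unfold colStieltjes
  exact (continuous_const.mul (continuous_resolv_columnMatrix hz).matrix_trace).measurable

/-- The mean of the residual of the limiting equation. -/
theorem integral_norm_residual_le {ν : Fin n → Fin 2 × Fin p → Measure ℂ}
    (hν : ∀ j, IsStandardFamily (ν j)) {η : ℝ} (hη : 0 < η) {M : ℝ≥0}
    (hM : ∀ j i, ∫⁻ e, ‖e‖ₑ ^ (2 + η) ∂(ν j i) ≤ M) {z : ℂ} {K : ℝ} (hp : 0 < p) (hn : 0 < n)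
    (hK : (p : ℝ) / n ≤ K) (hz1 : 1 ≤ z.im) (hzK : 2 * K ≤ z.im) :
    ∫ x, ‖residual ((p : ℝ) / n) z (colStieltjes z x)‖ ∂(Measure.pi fun j => Measure.pi (ν j))
      ≤ 2 * (4 * K + 6) * (12 * (quadBound η M (2 * p) / (2 * p)) + 4 / p) := by
  have hz : 0 < z.im := by linarith
  have hprob := fun j => (hν j).prob
  have hp' : (0 : ℝ) < p := by exact_mod_cast hp
  have hn' : (0 : ℝ) < n := by exact_mod_cast hn
  have hK0 : 0 ≤ K := le_trans (by positivity) hK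
  set μ : Fin n → Measure (Fin 2 × Fin p → ℂ) := fun j => Measure.pi (ν j) with hμ
  have hQ0 : 0 ≤ quadBound η M (2 * p) := by unfold quadBound; positivity
  have hfe0 : ∀ G ξ, 0 ≤ formError (p := p) n G ξ := fun G ξ => by unfold formError; positivity
  have hfeM : ∀ j, Measurable fun x : Fin n → Fin 2 × Fin p → ℂ =>
      formError n (resolv (columnMatrix (Function.update x j 0)) z) (x j) := fun j => by
    refine (continuous_formError.comp (Continuous.prodMk
      ((continuous_resolv_columnMatrix hz).comp ?_) (continuous_apply j))).measurable
    exact continuous_id.update j continuous_const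
  have hlin : ∀ j, ∫⁻ x, ENNReal.ofReal
      (formError n (resolv (columnMatrix (Function.update x j 0)) z) (x j)) ∂(Measure.pi μ)
      ≤ ENNReal.ofReal ((n : ℝ)⁻¹ * (6 * quadBound η M (2 * p))) := fun j => by
    have hmp := measurePreserving_update μ j
    have hcomp : Measurable fun q : (Fin 2 × Fin p → ℂ) × (Fin n → Fin 2 × Fin p → ℂ) =>
        ENNReal.ofReal (formError n (resolv (columnMatrix (Function.update
          (Function.update q.2 j q.1) j 0)) z) (Function.update q.2 j q.1 j)) :=
      (hfeM j).ennreal_ofReal.comp hmp.measurable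
    rw [← hmp.map_eq, lintegral_map (hfeM j).ennreal_ofReal hmp.measurable,
      lintegral_prod_symm' _ hcomp]
    refine (lintegral_mono (g := fun _ => ENNReal.ofReal
      ((n : ℝ)⁻¹ * (6 * quadBound η M (2 * p)))) fun x => ?_).trans (by simp)
    simp only [Function.update_idem, Function.update_self]
    have hH := isHermitian_columnMatrix (Function.update x j 0)
    have hb := integral_formError_le (n := n) (hν j) hη (hM j) hp
      (G := resolv (columnMatrix (Function.update x j 0)) z)
      ((sum_norm_resolv_sq_le hH hz).trans (by
        rw [Fintype.card_fin]
        exact div_le_self hp'.le (one_le_pow₀ hz1)))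
      (fun i => (norm_resolv_apply_le hH hz i i).trans (by
        rw [div_le_one hz]; exact hz1))
    rw [← ofReal_integral_eq_lintegral_ofReal hb.1 (ae_of_all _ fun ξ => hfe0 _ ξ)]
    exact ENNReal.ofReal_le_ofReal hb.2
  set B : ℝ := 2 * (4 * K + 6) * (12 * (quadBound η M (2 * p) / (2 * p)) + 4 / p) with hB
  have hB0 : 0 ≤ B := by positivity
  have hpt : ∀ x : Fin n → Fin 2 × Fin p → ℂ,
      ENNReal.ofReal ‖residual ((p : ℝ) / n) z (colStieltjes z x)‖
        ≤ ∑ j, ENNReal.ofReal ((p : ℝ)⁻¹ * (2 * (4 * K + 6))) * (ENNReal.ofReal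
          (formError n (resolv (columnMatrix (Function.update x j 0)) z) (x j))
            + ENNReal.ofReal (4 / n)) := fun x => by
    refine (ENNReal.ofReal_le_ofReal (norm_residual_le hp hn hK hz1 hzK x)).trans_eq ?_
    rw [Finset.mul_sum, ENNReal.ofReal_sum_of_nonneg]
    · refine Finset.sum_congr rfl fun j _ => ?_
      rw [← mul_assoc, ENNReal.ofReal_mul (by positivity),
        ENNReal.ofReal_add (hfe0 _ _) (by positivity)]
    · intro j _
      have := hfe0 (resolv (columnMatrix (Function.update x j 0)) z) (x j)
      positivity
  have htot : ∫⁻ x, ENNReal.ofReal ‖residual ((p : ℝ) / n) z (colStieltjes z x)‖ ∂(Measure.pi μ)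
      ≤ ENNReal.ofReal B := by
    refine (lintegral_mono hpt).trans ?_
    rw [lintegral_finsetSum _ fun j _ => ((hfeM j).ennreal_ofReal.add_const _).const_mul _]
    calc _ ≤ ∑ _j : Fin n, ENNReal.ofReal ((p : ℝ)⁻¹ * (2 * (4 * K + 6)))
          * (ENNReal.ofReal ((n : ℝ)⁻¹ * (6 * quadBound η M (2 * p)))
            + ENNReal.ofReal (4 / n)) := by
          refine Finset.sum_le_sum fun j _ => ?_
          rw [lintegral_const_mul _ ((hfeM j).ennreal_ofReal.add_const _),
            lintegral_add_right _ measurable_const]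
          gcongr
          · exact hlin j
          · simp
      _ = ENNReal.ofReal B := by
          rw [Finset.sum_const, Finset.card_univ, Fintype.card_fin, nsmul_eq_mul,
            ← ENNReal.ofReal_add (by positivity) (by positivity),
            ← ENNReal.ofReal_mul (by positivity), ← ENNReal.ofReal_natCast,
            ← ENNReal.ofReal_mul (by positivity)]
          congr 1
          rw [hB]
          field_simp
          ring
  rw [integral_eq_lintegral_of_nonneg_ae (ae_of_all _ fun x => norm_nonneg _)]
  · exact ENNReal.toReal_le_of_le_ofReal hB0 htot
  · have := measurable_colStieltjes (p := p) (n := n) hz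
    unfold residual
    exact (by fun_prop : Measurable fun x : Fin n → Fin 2 × Fin p → ℂ => _).aestronglyMeasurable

end Residual

/-! ### Almost sure convergence of the residual -/

section AlmostSure

open Matrix

variable {p n : ℕ}

/-- The pairs of columns of two data matrices. -/
def columns (Z : Fin 2 → Matrix (Fin p) (Fin n) ℂ) : Fin n → Fin 2 × Fin p → ℂ :=
  fun j a => Z a.1 a.2 j

theorem neg_I_smul_sampleCommutator (Z : Fin 2 → Matrix (Fin p) (Fin n) ℂ) :
    (-Complex.I) • sampleCommutator (Z 0) (Z 1) = columnMatrix (columns Z) := by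
  ext i k
  simp only [sampleCommutator, columnMatrix, pairMatrix, columns, Matrix.smul_apply,
    Matrix.sub_apply, Matrix.mul_apply, Matrix.sum_apply, conjTranspose_apply, vecMulVec_apply,
    Pi.star_apply, smul_eq_mul, ← Finset.mul_sum, Finset.sum_sub_distrib]
  push_cast
  ring

theorem stieltjes_skewESD {S : Matrix (Fin p) (Fin p) ℂ} (hS : S.conjTranspose = -S) {z : ℂ}
    (hz : 0 < z.im) :
    stieltjes (skewESD S hS) z = (p : ℂ)⁻¹ * (resolv ((-Complex.I) • S) z).trace := by
  rw [trace_resolv (isHermitian_neg_I_smul hS) hz, stieltjes, skewESD, integral_smul_measure,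
    integral_finsetSum_measure fun i _ => integrable_dirac (by simp)]
  simp [ENNReal.toReal_inv]

theorem isProbabilityMeasure_skewESD {S : Matrix (Fin p) (Fin p) ℂ} (hS : S.conjTranspose = -S)
    (hp : 0 < p) : IsProbabilityMeasure (skewESD S hS) := by
  refine ⟨?_⟩
  simp only [skewESD, Measure.smul_apply, Measure.finsetSum_apply, measure_univ,
    Finset.sum_const, Finset.card_univ, Fintype.card_fin, smul_eq_mul, nsmul_eq_mul, mul_one]
  exact ENNReal.inv_mul_cancel (by exact_mod_cast hp.ne') (ENNReal.natCast_ne_top p)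

theorem stieltjes_skewESD_eq_colStieltjes (Z : Fin 2 → Matrix (Fin p) (Fin n) ℂ) {z : ℂ}
    (hz : 0 < z.im) :
    stieltjes (skewESD (sampleCommutator (Z 0) (Z 1)) (sampleCommutator_conjTranspose _ _)) z
      = colStieltjes z (columns Z) := by
  rw [stieltjes_skewESD _ hz, neg_I_smul_sampleCommutator, colStieltjes]

theorem norm_ofReal_mul_colStieltjes_le {z : ℂ} {κ K : ℝ} (hp : 0 < p) (hκ : 0 ≤ κ) (hK : κ ≤ K)
    (hz1 : 1 ≤ z.im) (hzK : 2 * K ≤ z.im) (x : Fin n → Fin 2 × Fin p → ℂ) :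
    ‖(κ : ℂ) * colStieltjes z x‖ ≤ 1 / 2 := by
  have hz : 0 < z.im := by linarith
  have h := norm_colStieltjes_le hz hp x
  rw [norm_mul, Complex.norm_real, Real.norm_of_nonneg hκ]
  calc κ * ‖colStieltjes z x‖ ≤ (z.im / 2) * (1 / z.im) := by
        gcongr; linarith
    _ = 1 / 2 := by field_simp

theorem norm_residual_sub_le {z : ℂ} {κ : ℝ} {m m' : ℂ} (hm : ‖κ * m‖ ≤ 1 / 2)
    (hm' : ‖κ * m'‖ ≤ 1 / 2) : ‖residual κ z m - residual κ z m'‖ ≤ (‖z‖ + 4) * ‖m - m'‖ := by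
  have h := residual_lipschitz hm hm'
  have e : residual κ z m - residual κ z m' = z * (m - m')
      + (2 * κ * m ^ 2 / (1 - (κ * m) ^ 2) - 2 * κ * m' ^ 2 / (1 - (κ * m') ^ 2)) := by
    unfold residual; ring
  rw [e, add_mul]
  refine (norm_add_le _ _).trans ?_
  rw [norm_mul]
  linarith

theorem norm_colStieltjes_update_sub_le {z : ℂ} (hz : 0 < z.im) (hp : 0 < p)
    (x : Fin n → Fin 2 × Fin p → ℂ) (j : Fin n) (e : Fin 2 × Fin p → ℂ) :
    ‖colStieltjes z (Function.update x j e) - colStieltjes z x‖ ≤ 4 / (p * z.im) := by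
  have hp' : (0 : ℝ) < p := by exact_mod_cast hp
  have h1 := norm_trace_update_sub_le hz x j e
  have h2 := norm_trace_update_sub_le hz x j (x j)
  rw [Function.update_eq_self] at h2
  unfold colStieltjes
  rw [← mul_sub, norm_mul, norm_inv, Complex.norm_natCast]
  have h3 := norm_sub_le_norm_sub_add_norm_sub
    (resolv (columnMatrix (Function.update x j e)) z).trace
    (resolv (columnMatrix (Function.update x j 0)) z).trace (resolv (columnMatrix x) z).trace
  rw [norm_sub_rev (resolv (columnMatrix (Function.update x j 0)) z).trace] at h3
  calc _ ≤ (p : ℝ)⁻¹ * (2 / z.im + 2 / z.im) := by gcongr; linarith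
    _ = _ := by field_simp; norm_num

/-- Deviation of the residual from its mean bound. -/
theorem measure_residual_ge_le {ν : Fin n → Fin 2 × Fin p → Measure ℂ}
    [∀ j i, IsProbabilityMeasure (ν j i)] {z : ℂ} {κ K : ℝ} (hp : 0 < p) (hκ : 0 ≤ κ) (hK : κ ≤ K)
    (hz1 : 1 ≤ z.im) (hzK : 2 * K ≤ z.im) {ε : ℝ} (hε : 0 ≤ ε) :
    (Measure.pi fun j => Measure.pi (ν j)).real {x | ε ≤ ‖residual κ z (colStieltjes z x)‖
      - ∫ y, ‖residual κ z (colStieltjes z y)‖ ∂(Measure.pi fun j => Measure.pi (ν j))}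
      ≤ Real.exp (-ε ^ 2 / (2 * (n * ((‖z‖ + 4) * (4 / p)) ^ 2))) := by
  have hz : 0 < z.im := by linarith
  have hp' : (0 : ℝ) < p := by exact_mod_cast hp
  have hhalf := norm_ofReal_mul_colStieltjes_le (n := n) hp hκ hK hz1 hzK
  have hmeas : Measurable fun x : Fin n → Fin 2 × Fin p → ℂ =>
      ‖residual κ z (colStieltjes z x)‖ := by
    have := measurable_colStieltjes (p := p) (n := n) hz
    unfold residual
    fun_prop
  refine measure_ge_le_of_bounded_differences _ hmeas (C := 1 + (‖z‖ + 4) * 1) (fun x => ?_)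
    (fun x j e => ?_) hε
  · rw [abs_norm]
    have h1 := norm_residual_sub_le (z := z) (hhalf x) (m' := 0) (by simp)
    have h2 : residual κ z 0 = 1 := by simp [residual]
    have h3 := norm_sub_norm_le (residual κ z (colStieltjes z x)) (residual κ z 0)
    have h4 : ‖colStieltjes z x‖ ≤ 1 := (norm_colStieltjes_le hz hp x).trans (by
      rw [div_le_one hz]; exact hz1)
    rw [sub_zero] at h1
    rw [h2] at h1 h3
    rw [norm_one] at h3
    have h5 : (‖z‖ + 4) * ‖colStieltjes z x‖ ≤ (‖z‖ + 4) * 1 := by gcongr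
    linarith
  · refine (abs_norm_sub_norm_le _ _).trans ((norm_residual_sub_le (hhalf _) (hhalf _)).trans ?_)
    gcongr
    refine (norm_colStieltjes_update_sub_le hz hp x j e).trans ?_
    gcongr
    exact le_mul_of_one_le_right hp'.le hz1

/-- Grouping the coordinates of a product measure. -/
theorem map_group_pi {α β E : Type*} [Fintype α] [Fintype β] [MeasurableSpace E]
    (ρ : α × β → Measure E) [∀ e, IsProbabilityMeasure (ρ e)] :
    Measure.map (fun (y : α × β → E) a b => y (a, b)) (Measure.pi ρ)
      = Measure.pi fun a => Measure.pi fun b => ρ (a, b) := by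
  set Φ : (α → β → E) → α × β → E := fun x e => x e.1 e.2 with hΦ
  have hΦm : Measurable Φ := measurable_pi_iff.2 fun e =>
    (measurable_pi_apply e.2).comp (measurable_pi_apply e.1)
  have hΨm : Measurable fun (y : α × β → E) a b => y (a, b) := measurable_pi_iff.2 fun a =>
    measurable_pi_iff.2 fun b => measurable_pi_apply (a, b)
  have h : Measure.pi ρ = Measure.map Φ (Measure.pi fun a => Measure.pi fun b => ρ (a, b)) := by
    refine Measure.pi_eq fun s hs => ?_
    rw [Measure.map_apply hΦm (MeasurableSet.univ_pi hs)]
    have hpre : Φ ⁻¹' Set.univ.pi s = Set.univ.pi fun a => Set.univ.pi fun b => s (a, b) := by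
      ext x
      simp [hΦ, Set.mem_pi]
    rw [hpre, Measure.pi_pi]
    simp_rw [Measure.pi_pi]
    rw [Fintype.prod_prod_type]
  rw [h, Measure.map_map hΨm hΦm]
  exact Measure.map_id

end AlmostSure

section Model

open Matrix

variable {Ω : Type*} [MeasurableSpace Ω] {P : Measure Ω} [IsProbabilityMeasure P] {p : ℕ → ℕ}
  {Z : (n : ℕ) → Fin 2 → Ω → Matrix (Fin (p n)) (Fin n) ℂ}

/-- The law of one entry. -/
def entryLaw (P : Measure Ω) (Z : (n : ℕ) → Fin 2 → Ω → Matrix (Fin (p n)) (Fin n) ℂ) (n : ℕ)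
    (j : Fin n) (a : Fin 2 × Fin (p n)) : Measure ℂ :=
  P.map fun ω => Z n a.1 ω a.2 j

theorem IsInnovationArray.isStandardFamily (hZ : IsInnovationArray P p Z) (n : ℕ) (j : Fin n) :
    IsStandardFamily (entryLaw P Z n j) where
  prob a := Measure.isProbabilityMeasure_map (hZ.measurable_entry n a.1 a.2 j).aemeasurable
  mean_zero a := by
    rw [entryLaw, integral_map (hZ.measurable_entry n a.1 a.2 j).aemeasurable
      (measurable_id' (α := ℂ)).aestronglyMeasurable]
    exact hZ.mean_zero n a.1 a.2 j
  variance_one a := by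
    rw [entryLaw, integral_map (hZ.measurable_entry n a.1 a.2 j).aemeasurable
      (by fun_prop : Measurable fun e : ℂ => ‖e‖ ^ 2).aestronglyMeasurable]
    exact hZ.variance_one n a.1 a.2 j

theorem IsInnovationArray.map_columns (hZ : IsInnovationArray P p Z) (n : ℕ) :
    Measurable (fun ω => columns fun k => Z n k ω) ∧
      P.map (fun ω => columns fun k => Z n k ω)
        = Measure.pi fun j => Measure.pi (entryLaw P Z n j) := by
  set X : Fin n × (Fin 2 × Fin (p n)) → Ω → ℂ := fun e ω => Z n e.2.1 ω e.2.2 e.1 with hX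
  have hXm : ∀ e, Measurable (X e) := fun e => hZ.measurable_entry n e.2.1 e.2.2 e.1
  have hind : iIndepFun X P := by
    have h := (hZ.indep n).precomp
      (g := fun e : Fin n × (Fin 2 × Fin (p n)) => (e.2.1, e.2.2, e.1)) (by
        rintro ⟨a, b, c⟩ ⟨a', b', c'⟩ h
        simp only [Prod.mk.injEq] at h
        obtain ⟨rfl, rfl, rfl⟩ := h
        rfl)
    exact h
  have hlaw := hind.map_fun_eq_pi_map fun e => (hXm e).aemeasurable
  have hprob : ∀ e, IsProbabilityMeasure (P.map (X e)) := fun e =>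
    Measure.isProbabilityMeasure_map (hXm e).aemeasurable
  have hg := map_group_pi (fun e => P.map (X e))
  have hΨm : Measurable fun (y : Fin n × (Fin 2 × Fin (p n)) → ℂ) a b => y (a, b) :=
    measurable_pi_iff.2 fun a => measurable_pi_iff.2 fun b => measurable_pi_apply (a, b)
  have hXX : Measurable fun ω e => X e ω := measurable_pi_iff.2 hXm
  rw [← hlaw, Measure.map_map hΨm hXX] at hg
  exact ⟨hΨm.comp hXX, hg⟩

theorem IsInnovationArray.ae_tendsto_residual {c : ℝ} (hc : 0 < c) (hZ : IsInnovationArray P p Z)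
    (hpc : Tendsto (fun n : ℕ => (p n : ℝ) / (n : ℝ)) atTop (𝓝 c)) {z : ℂ} (hz1 : 1 ≤ z.im)
    (hzK : 2 * (c + 1) ≤ z.im) :
    ∀ᵐ ω ∂P, Tendsto (fun n => residual ((p n : ℝ) / n) z
      (colStieltjes z (columns fun k => Z n k ω))) atTop (𝓝 0) := by
  obtain ⟨η, hη, M, hM⟩ := hZ.moment_bound
  set K : ℝ := c + 1 with hKdef
  set f : (n : ℕ) → (Fin n → Fin 2 × Fin (p n) → ℂ) → ℝ := fun n x =>
    ‖residual ((p n : ℝ) / n) z (colStieltjes z x)‖ with hf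
  set Q : (n : ℕ) → Measure (Fin n → Fin 2 × Fin (p n) → ℂ) := fun n =>
    Measure.pi fun j => Measure.pi (entryLaw P Z n j) with hQ
  have hprob : ∀ n j a, IsProbabilityMeasure (entryLaw P Z n j a) := fun n j =>
    (hZ.isStandardFamily n j).prob
  have hmom : ∀ n j a, ∫⁻ e, ‖e‖ₑ ^ (2 + η) ∂(entryLaw P Z n j a) ≤ M := fun n j a => by
    rw [entryLaw, lintegral_map (by fun_prop) (hZ.measurable_entry n a.1 a.2 j)]
    exact hM n a.1 a.2 j
  have hlow : ∀ᶠ n : ℕ in atTop, c / 2 < (p n : ℝ) / n := hpc.eventually_const_lt (by linarith)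
  have hup : ∀ᶠ n : ℕ in atTop, (p n : ℝ) / n < K := hpc.eventually_lt_const (by linarith)
  have hgood : ∀ᶠ n : ℕ in atTop, 0 < n ∧ 0 < p n ∧ c / 2 * n ≤ p n ∧ (p n : ℝ) / n ≤ K := by
    filter_upwards [hlow, hup, eventually_gt_atTop 0] with n h1 h2 h3
    have hn' : (0 : ℝ) < n := by exact_mod_cast h3
    have h4 : c / 2 * n < p n := (lt_div_iff₀ hn').1 h1
    refine ⟨h3, ?_, h4.le, h2.le⟩
    have : (0 : ℝ) < p n := lt_of_le_of_lt (by positivity) h4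
    exact_mod_cast this
  have hpinf : Tendsto (fun n : ℕ => (p n : ℝ)) atTop atTop := by
    have h1 : Tendsto (fun n : ℕ => c / 2 * (n : ℝ)) atTop atTop :=
      tendsto_natCast_atTop_atTop.const_mul_atTop (by positivity)
    exact tendsto_atTop_mono' _ (hgood.mono fun n h => h.2.2.1) h1
  -- the means tend to zero
  have hmean : Tendsto (fun n => ∫ x, f n x ∂(Q n)) atTop (𝓝 0) := by
    have hbnd : Tendsto (fun n : ℕ => 2 * (4 * K + 6)
        * (12 * (quadBound η M (2 * p n) / (2 * p n)) + 4 / (p n : ℝ))) atTop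
        (𝓝 (2 * (4 * K + 6) * (12 * 0 + 0))) := by
      refine Tendsto.const_mul _ (Tendsto.add (Tendsto.const_mul _ ?_) ?_)
      · exact (tendsto_quadBound_div hη M).comp (hpinf.const_mul_atTop (by norm_num))
      · exact hpinf.const_div_atTop 4
    simp only [mul_zero, add_zero] at hbnd
    refine tendsto_of_tendsto_of_tendsto_of_le_of_le' tendsto_const_nhds hbnd
      (Eventually.of_forall fun n => integral_nonneg fun x => norm_nonneg _) ?_
    filter_upwards [hgood] with n hn
    exact integral_norm_residual_le (fun j => hZ.isStandardFamily n j) hη (hmom n) hn.2.1 hn.1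
      hn.2.2.2 hz1 hzK
  -- the deviations tend to zero
  have hdev : ∀ k : ℕ, ∀ᵐ ω ∂P, ∀ᶠ n in atTop,
      f n (columns fun k => Z n k ω) < ∫ x, f n x ∂(Q n) + 1 / ((k : ℝ) + 1) := fun k => by
    set ε : ℝ := 1 / ((k : ℝ) + 1) with hε
    have hε0 : 0 < ε := by positivity
    have hz : 0 < z.im := by linarith
    set A : (n : ℕ) → Set Ω := fun n =>
      {ω | ε ≤ f n (columns fun k => Z n k ω) - ∫ x, f n x ∂(Q n)} with hA
    have hfm : ∀ n, Measurable (f n) := fun n => by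
      have := measurable_colStieltjes (p := p n) (n := n) hz
      simp only [hf]
      unfold residual
      fun_prop
    have hPA : ∀ n, P.real (A n) = (Q n).real {x | ε ≤ f n x - ∫ y, f n y ∂(Q n)} := fun n => by
      obtain ⟨hm, hl⟩ := hZ.map_columns n
      simp only [hQ]
      rw [← hl, map_measureReal_apply hm
        (measurableSet_le measurable_const ((hfm n).sub_const _)), hl]
      rfl
    set b : ℝ := ε ^ 2 * c ^ 2 / (128 * (‖z‖ + 4) ^ 2) with hb
    have hb0 : 0 < b := by positivity
    have hbound : ∀ᶠ n in atTop, P.real (A n) ≤ Real.exp (n * (-b)) := by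
      filter_upwards [hgood] with n hn
      have hn' : (0 : ℝ) < n := by exact_mod_cast hn.1
      have hp' : (0 : ℝ) < p n := by exact_mod_cast hn.2.1
      rw [hPA]
      refine (measure_residual_ge_le hn.2.1 (by positivity) hn.2.2.2 hz1 hzK hε0.le).trans ?_
      rw [Real.exp_le_exp, neg_div, mul_neg, neg_le_neg_iff, le_div_iff₀ (by positivity), hb]
      have h1 : (c / 2 * n) ^ 2 ≤ (p n : ℝ) ^ 2 := by
        have := hn.2.2.1
        gcongr
      have e1 : (n : ℝ) * (ε ^ 2 * c ^ 2 / (128 * (‖z‖ + 4) ^ 2))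
          * (2 * (n * ((‖z‖ + 4) * (4 / p n)) ^ 2))
          = ε ^ 2 * ((c / 2 * n) ^ 2 / (p n : ℝ) ^ 2) := by
        have : ‖z‖ + 4 ≠ 0 := by positivity
        field_simp
        norm_num
      rw [e1]
      have h2 : (c / 2 * n) ^ 2 / (p n : ℝ) ^ 2 ≤ 1 := by
        rw [div_le_one (by positivity)]; exact h1
      nlinarith [sq_nonneg ε]
    have hsum : Summable fun n => P.real (A n) := by
      refine Summable.of_norm_bounded_eventually_nat
        (Real.summable_exp_nat_mul_iff.2 (neg_lt_zero.2 hb0)) ?_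
      filter_upwards [hbound] with n hn
      rwa [Real.norm_of_nonneg measureReal_nonneg]
    have htsum : ∑' n, P (A n) ≠ ⊤ := by
      have : ∀ n, P (A n) = ENNReal.ofReal (P.real (A n)) := fun n => by
        rw [ofReal_measureReal]
      simp_rw [this]
      exact hsum.tsum_ofReal_ne_top
    filter_upwards [ae_eventually_notMem htsum] with ω hω
    filter_upwards [hω] with n hn
    simp only [hA, Set.mem_ofPred_eq, not_le] at hn
    linarith
  filter_upwards [ae_all_iff.2 hdev] with ω hω
  rw [tendsto_zero_iff_norm_tendsto_zero]
  refine Metric.tendsto_atTop'.2 fun ε hε => ?_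
  obtain ⟨k, hk⟩ := exists_nat_one_div_lt (half_pos hε)
  have h1 := hmean.eventually_lt_const (half_pos hε)
  obtain ⟨N, hN⟩ := eventually_atTop.1 ((hω k).and h1)
  refine ⟨N, fun n hn => ?_⟩
  obtain ⟨h2, h3⟩ := hN n hn.le
  rw [Real.dist_eq, sub_zero, abs_norm]
  simp only [hf] at h2
  linarith

end Model

/-! ### Passage to the limit -/

section Limit

theorem lsdCubic_eq_residual_mul {κ : ℝ} {z m : ℂ} (hm : ‖κ * m‖ ≤ 1 / 2) :
    lsdCubic κ z m = residual κ z m * (1 - (κ * m) ^ 2) := by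
  have h := three_quarters_le hm
  have hne : 1 - (κ * m : ℂ) ^ 2 ≠ 0 := norm_pos_iff.1 (by linarith)
  unfold lsdCubic residual
  rw [add_mul _ _ (1 - (κ * m : ℂ) ^ 2), div_mul_cancel₀ _ hne]
  ring

theorem norm_ofReal_mul_stieltjes_le (μ : Measure ℝ) [IsProbabilityMeasure μ] {κ : ℝ} {z : ℂ}
    (hκ : 0 ≤ κ) (hz : 0 < z.im) (hκz : 2 * κ ≤ z.im) : ‖κ * stieltjes μ z‖ ≤ 1 / 2 := by
  have h := norm_stieltjes_le μ hz
  rw [norm_mul, Complex.norm_real, Real.norm_of_nonneg hκ]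
  calc κ * ‖stieltjes μ z‖ ≤ (z.im / 2) * z.im⁻¹ := by
        gcongr; linarith
    _ = 1 / 2 := by field_simp

/-- A probability measure whose Stieltjes transform solves the cubic equation is unique. -/
theorem eq_of_lsdCubic {c : ℝ} (hc : 0 < c) (F G : Measure ℝ) [IsProbabilityMeasure F]
    [IsProbabilityMeasure G] (hF : ∀ z : ℂ, 0 < z.im → lsdCubic c z (stieltjes F z) = 0)
    (hG : ∀ z : ℂ, 0 < z.im → lsdCubic c z (stieltjes G z) = 0) : F = G := by
  refine measure_eq_of_stieltjes_eq F G fun z hz => ?_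
  refine eq_of_eq_on_line (analyticOnNhd_stieltjes F) (analyticOnNhd_stieltjes G)
    (v := 2 * c + 5) (by positivity) (fun t => ?_) hz
  set w : ℂ := t + (2 * c + 5 : ℝ) * Complex.I with hw
  have hwim : w.im = 2 * c + 5 := by simp [hw]
  have hw0 : 0 < w.im := by rw [hwim]; positivity
  have h1 := norm_ofReal_mul_stieltjes_le F (κ := c) hc.le hw0 (by linarith)
  have h2 := norm_ofReal_mul_stieltjes_le G (κ := c) hc.le hw0 (by linarith)
  have hne : ∀ m : ℂ, ‖c * m‖ ≤ 1 / 2 → lsdCubic c w m = 0 → residual c w m = 0 := fun m hm h => by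
    rw [lsdCubic_eq_residual_mul hm] at h
    refine (mul_eq_zero.1 h).resolve_right (norm_pos_iff.1 ?_)
    have := three_quarters_le hm
    linarith
  have r1 := hne _ h1 (hF w hw0)
  have r2 := hne _ h2 (hG w hw0)
  have hl := residual_lipschitz h1 h2
  unfold residual at r1 r2
  have e : w * (stieltjes F w - stieltjes G w)
      = -(2 * c * stieltjes F w ^ 2 / (1 - (c * stieltjes F w) ^ 2)
        - 2 * c * stieltjes G w ^ 2 / (1 - (c * stieltjes G w) ^ 2)) := by
    linear_combination r1 - r2
  rw [← norm_neg, ← e, norm_mul] at hl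
  have h5 : 5 ≤ ‖w‖ := by
    have := Complex.im_le_norm w
    linarith
  rw [← sub_eq_zero, ← norm_eq_zero]
  nlinarith [norm_nonneg (stieltjes F w - stieltjes G w)]

/-- A sequence of probability measures whose Stieltjes transforms solve the limiting equation
asymptotically at the points of a countable set. -/
structure IsAsymptoticSolution (c : ℝ) (κ : ℕ → ℝ) (μ : ℕ → ProbabilityMeasure ℝ) : Prop where
  pos : 0 < c
  tendsto_ratio : Tendsto κ atTop (𝓝 c)
  nonneg : ∀ n, 0 ≤ κ n
  tendsto_residual : ∀ (q : ℚ) (N : ℕ), 2 * (c + 1) ≤ N → 1 ≤ N →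
    Tendsto (fun n => residual (κ n) (q + (N : ℝ) * Complex.I)
      (stieltjes (μ n) (q + (N : ℝ) * Complex.I))) atTop (𝓝 0)

variable {c : ℝ} {κ : ℕ → ℝ} {μ : ℕ → ProbabilityMeasure ℝ}

theorem IsAsymptoticSolution.comp (h : IsAsymptoticSolution c κ μ) {φ : ℕ → ℕ}
    (hφ : Tendsto φ atTop atTop) : IsAsymptoticSolution c (κ ∘ φ) (μ ∘ φ) where
  pos := h.pos
  tendsto_ratio := h.tendsto_ratio.comp hφ
  nonneg _ := h.nonneg _
  tendsto_residual q N h1 h2 := (h.tendsto_residual q N h1 h2).comp hφ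

/-- Weak limits of asymptotic solutions are solutions. -/
theorem IsAsymptoticSolution.lsdCubic_limit (h : IsAsymptoticSolution c κ μ)
    {F : ProbabilityMeasure ℝ} (hF : Tendsto μ atTop (𝓝 F)) {z : ℂ} (hz : 0 < z.im) :
    lsdCubic c z (stieltjes F z) = 0 := by
  obtain ⟨N, hN⟩ := exists_nat_ge (2 * (c + 1))
  have hc := h.pos
  have hN1 : (1 : ℝ) ≤ N := by linarith
  have hN1' : 1 ≤ N := by exact_mod_cast hN1
  have han : AnalyticOnNhd ℂ (fun z => lsdCubic c z (stieltjes F z)) {z | 0 < z.im} := by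
    have h1 := analyticOnNhd_stieltjes (F : Measure ℝ)
    unfold lsdCubic
    exact ((analyticOnNhd_const.add (analyticOnNhd_id.mul h1)).mul
      (analyticOnNhd_const.sub (analyticOnNhd_const.mul (h1.pow 2)))).add
      (analyticOnNhd_const.mul (h1.pow 2))
  refine eq_of_eq_on_line (g := fun _ => 0) han analyticOnNhd_const (v := N) (by linarith)
    (fun t => ?_) hz
  have him : ∀ t : ℝ, ((t : ℂ) + (N : ℝ) * Complex.I).im = N := fun t => by simp
  have hcont : Continuous fun t : ℝ =>
      lsdCubic c (t + (N : ℝ) * Complex.I) (stieltjes F (t + (N : ℝ) * Complex.I)) := by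
    rw [← continuousOn_univ]
    refine han.continuousOn.comp (f := fun t : ℝ => (t : ℂ) + (N : ℝ) * Complex.I)
      (by fun_prop) fun t _ => ?_
    have := him t
    simp only [Set.mem_ofPred_eq]
    linarith
  have hrat : ∀ q : ℚ, lsdCubic c ((q : ℝ) + (N : ℝ) * Complex.I)
      (stieltjes F ((q : ℝ) + (N : ℝ) * Complex.I)) = 0 := fun q => by
    set w : ℂ := ((q : ℝ) : ℂ) + (N : ℝ) * Complex.I with hw
    have hwN : w.im = N := him q
    have hw0 : 0 < w.im := by linarith
    have hm := tendsto_stieltjes hF hw0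
    have hκ : Tendsto (fun n => (κ n : ℂ)) atTop (𝓝 (c : ℂ)) :=
      (Complex.continuous_ofReal.tendsto c).comp h.tendsto_ratio
    have h1 : Tendsto (fun n => lsdCubic (κ n) w (stieltjes (μ n) w)) atTop
        (𝓝 (lsdCubic c w (stieltjes F w))) := by
      unfold lsdCubic
      exact ((tendsto_const_nhds.add (tendsto_const_nhds.mul hm)).mul
        (tendsto_const_nhds.sub ((hκ.pow 2).mul (hm.pow 2)))).add
        ((tendsto_const_nhds.mul hκ).mul (hm.pow 2))
    have h2 : Tendsto (fun n => residual (κ n) w (stieltjes (μ n) w)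
        * (1 - (κ n * stieltjes (μ n) w) ^ 2)) atTop
        (𝓝 (0 * (1 - (c * stieltjes F w) ^ 2))) := by
      refine Tendsto.mul ?_ (tendsto_const_nhds.sub ((hκ.mul hm).pow 2))
      have := h.tendsto_residual q N hN hN1'
      simpa [hw] using this
    rw [zero_mul] at h2
    refine tendsto_nhds_unique (h1.congr' ?_) h2
    filter_upwards [h.tendsto_ratio.eventually_lt_const (lt_add_one c)] with n hn
    exact lsdCubic_eq_residual_mul
      (norm_ofReal_mul_stieltjes_le _ (h.nonneg n) hw0 (by linarith))
  have hdense := Rat.denseRange_cast (𝕜 := ℝ)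
  exact congrFun (hdense.equalizer hcont continuous_const (funext fun q => hrat q)) t

theorem norm_one_add_mul_le {κ : ℝ} {z m : ℂ} (hκ : 0 ≤ κ) (hm : ‖κ * m‖ ≤ 1 / 2) :
    ‖1 + z * m‖ ≤ ‖residual κ z m‖ + 3 * κ * ‖m‖ ^ 2 := by
  have h := three_quarters_le hm
  have e : 1 + z * m = residual κ z m - 2 * κ * m ^ 2 / (1 - (κ * m) ^ 2) := by
    unfold residual; ring
  rw [e]
  refine (norm_sub_le _ _).trans ?_
  gcongr
  rw [norm_div, div_le_iff₀ (by linarith), norm_mul, norm_mul, norm_pow, Complex.norm_real,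
    Real.norm_of_nonneg hκ, Complex.norm_ofNat]
  have : 0 ≤ κ * ‖m‖ ^ 2 := by positivity
  nlinarith

/-- Asymptotic solutions are tight. -/
theorem IsAsymptoticSolution.isTightMeasureSet (h : IsAsymptoticSolution c κ μ) :
    IsTightMeasureSet (Set.range fun n => (μ n : Measure ℝ)) := by
  have hc := h.pos
  refine isTightMeasureSet_range_of_tendsto_limsup_measure_norm_gt ?_
  have hev : ∀ N : ℕ, 2 * (c + 1) ≤ N → ∀ᶠ n in atTop,
      (μ n : Measure ℝ) {x | (N : ℝ) < ‖x‖} ≤ ENNReal.ofReal (8 * (c + 1) / N) := fun N hN => by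
    have hN1 : (1 : ℝ) ≤ N := by linarith
    have hN1' : 1 ≤ N := by exact_mod_cast hN1
    have hr := (h.tendsto_residual 0 N hN hN1').norm
    rw [norm_zero] at hr
    filter_upwards [hr.eventually_lt_const (show (0 : ℝ) < (c + 1) / N by positivity),
      h.tendsto_ratio.eventually_lt_const (lt_add_one c)] with n h1 h2
    have hκ := h.nonneg n
    simp only [Rat.cast_zero, zero_add] at h1
    set w : ℂ := (N : ℝ) * Complex.I with hw
    have hwN : w.im = N := by simp [hw]
    have hw0 : 0 < w.im := by linarith
    have h3 := measureReal_norm_gt_le (μ n : Measure ℝ) (v := N) (by linarith)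
    have h4 := norm_one_add_mul_le (z := w) hκ
      (norm_ofReal_mul_stieltjes_le (μ n : Measure ℝ) (z := w) hκ hw0 (by linarith))
    have h5 := norm_stieltjes_le (μ n : Measure ℝ) hw0
    rw [hwN] at h5
    have h6 : 3 * κ n * ‖stieltjes (μ n) w‖ ^ 2 ≤ 3 * ((c + 1) / N) := by
      have h7 : ‖stieltjes (μ n) w‖ ^ 2 ≤ (N : ℝ)⁻¹ := by
        have h8 : (N : ℝ)⁻¹ ≤ 1 := inv_le_one_of_one_le₀ hN1
        nlinarith [norm_nonneg (stieltjes (μ n) w)]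
      calc 3 * κ n * ‖stieltjes (μ n) w‖ ^ 2 ≤ 3 * (c + 1) * (N : ℝ)⁻¹ := by gcongr
        _ = _ := by ring
    rw [← ofReal_measureReal]
    refine ENNReal.ofReal_le_ofReal (h3.trans ?_)
    have e8 : 8 * (c + 1) / N = 2 * ((c + 1) / N + 3 * ((c + 1) / N)) := by ring
    rw [e8]
    linarith
  have hb : Tendsto (fun r : ℝ => ENNReal.ofReal (8 * (c + 1) / (⌊r⌋₊ : ℝ))) atTop (𝓝 0) := by
    rw [← ENNReal.ofReal_zero]
    exact ENNReal.tendsto_ofReal (Tendsto.const_div_atTop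
      (tendsto_natCast_atTop_atTop.comp tendsto_nat_floor_atTop) _)
  refine tendsto_of_tendsto_of_tendsto_of_le_of_le' tendsto_const_nhds hb
    (Eventually.of_forall fun _ => zero_le) ?_
  filter_upwards [eventually_ge_atTop (2 * (c + 1) + 1)] with r hr
  have hfl : 2 * (c + 1) ≤ (⌊r⌋₊ : ℝ) := by
    have := Nat.lt_floor_add_one r
    linarith
  refine limsup_le_of_le (h := ?_)
  filter_upwards [hev ⌊r⌋₊ hfl] with n hn
  refine (measure_mono fun x hx => ?_).trans hn
  exact lt_of_le_of_lt (Nat.floor_le (show 0 ≤ r by linarith)) hx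

theorem IsAsymptoticSolution.exists_subseq (h : IsAsymptoticSolution c κ μ) :
    ∃ F : ProbabilityMeasure ℝ, (∀ z : ℂ, 0 < z.im → lsdCubic c z (stieltjes F z) = 0) ∧
      ∃ φ : ℕ → ℕ, Tendsto (fun n => μ (φ n)) atTop (𝓝 F) := by
  have hcpt : IsCompact (closure (Set.range μ)) := by
    refine isCompact_closure_of_isTightMeasureSet ?_
    convert h.isTightMeasureSet using 1
    ext x
    simp
  obtain ⟨F, -, φ, hφ, hF⟩ := hcpt.tendsto_subseq fun n => subset_closure (Set.mem_range_self n)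
  exact ⟨F, fun z hz => (h.comp hφ.tendsto_atTop).lsdCubic_limit hF hz, φ, hF⟩

theorem IsAsymptoticSolution.tendsto (h : IsAsymptoticSolution c κ μ) {F : ProbabilityMeasure ℝ}
    (hF : ∀ z : ℂ, 0 < z.im → lsdCubic c z (stieltjes F z) = 0) : Tendsto μ atTop (𝓝 F) := by
  refine tendsto_of_subseq_tendsto fun ns hns => ?_
  obtain ⟨G, hG, φ, hφ⟩ := (h.comp hns).exists_subseq
  have : G = F := Subtype.ext (eq_of_lsdCubic h.pos (G : Measure ℝ) (F : Measure ℝ) hG hF)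
  exact ⟨φ, this ▸ hφ⟩

end Limit

/-! ### The limiting spectral distribution -/

section Spectral

/-- The empirical spectral distribution as a probability measure (a point mass if there are no
eigenvalues). -/
def probESD {p n : ℕ} (Z : Fin 2 → Matrix (Fin p) (Fin n) ℂ) : ProbabilityMeasure ℝ :=
  if hp : 0 < p then
    ⟨skewESD (sampleCommutator (Z 0) (Z 1)) (sampleCommutator_conjTranspose _ _),
      isProbabilityMeasure_skewESD _ hp⟩
  else ⟨Measure.dirac 0, inferInstance⟩

theorem coe_probESD {p n : ℕ} (Z : Fin 2 → Matrix (Fin p) (Fin n) ℂ) (hp : 0 < p) :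
    (probESD Z : Measure ℝ)
      = skewESD (sampleCommutator (Z 0) (Z 1)) (sampleCommutator_conjTranspose _ _) :=
  congrArg Subtype.val (dif_pos hp)

variable {Ω : Type*} [MeasurableSpace Ω] {P : Measure Ω} [IsProbabilityMeasure P] {p : ℕ → ℕ}
  {Z : (n : ℕ) → Fin 2 → Ω → Matrix (Fin (p n)) (Fin n) ℂ}

theorem eventually_pos_of_tendsto_ratio {c : ℝ} (hc : 0 < c)
    (hpc : Tendsto (fun n : ℕ => (p n : ℝ) / (n : ℝ)) atTop (𝓝 c)) : ∀ᶠ n in atTop, 0 < p n := by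
  filter_upwards [hpc.eventually_const_lt hc] with n hn
  refine Nat.pos_of_ne_zero fun h => ?_
  rw [h] at hn
  simp at hn

theorem IsInnovationArray.ae_isAsymptoticSolution {c : ℝ} (hc : 0 < c)
    (hZ : IsInnovationArray P p Z)
    (hpc : Tendsto (fun n : ℕ => (p n : ℝ) / (n : ℝ)) atTop (𝓝 c)) :
    ∀ᵐ ω ∂P, IsAsymptoticSolution c (fun n => (p n : ℝ) / n)
      (fun n => probESD fun k => Z n k ω) := by
  have h : ∀ᵐ ω ∂P, ∀ (q : ℚ) (N : ℕ), 2 * (c + 1) ≤ N → 1 ≤ N →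
      Tendsto (fun n => residual ((p n : ℝ) / n) (q + (N : ℝ) * Complex.I)
        (colStieltjes (q + (N : ℝ) * Complex.I) (columns fun k => Z n k ω))) atTop (𝓝 0) := by
    refine ae_all_iff.2 fun q => ae_all_iff.2 fun N => ?_
    by_cases hN : 2 * (c + 1) ≤ N
    · by_cases hN1 : 1 ≤ N
      · have him : ((q : ℂ) + (N : ℝ) * Complex.I).im = N := by simp
        filter_upwards [hZ.ae_tendsto_residual hc hpc (z := q + (N : ℝ) * Complex.I)
          (by rw [him]; exact_mod_cast hN1) (by rw [him]; exact hN)] with ω hω _ _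
        exact hω
      · exact ae_of_all _ fun ω _ h => absurd h hN1
    · exact ae_of_all _ fun ω h => absurd h hN
  filter_upwards [h] with ω hω
  refine ⟨hc, hpc, fun n => by positivity, fun q N hN hN1 => (hω q N hN hN1).congr' ?_⟩
  filter_upwards [eventually_pos_of_tendsto_ratio hc hpc] with n hn
  have him : 0 < ((q : ℂ) + (N : ℝ) * Complex.I).im := by
    have : (0 : ℝ) < N := by exact_mod_cast hN1
    simpa using this
  rw [coe_probESD _ hn, ← stieltjes_skewESD_eq_colStieltjes (fun k => Z n k ω) him]

/-- If the Stieltjes transform of `F` solves the cubic equation, then `F` is the limiting spectral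
distribution of every admissible model. -/
theorem isLSD_of_lsdCubic {c : ℝ} (hc : 0 < c) {F : ProbabilityMeasure ℝ}
    (hF : ∀ z : ℂ, 0 < z.im → lsdCubic c z (stieltjes F z) = 0) (hZ : IsInnovationArray P p Z)
    (hpc : Tendsto (fun n : ℕ => (p n : ℝ) / (n : ℝ)) atTop (𝓝 c)) :
    IsLSD P p Z (F : Measure ℝ) := by
  filter_upwards [hZ.ae_isAsymptoticSolution hc hpc] with ω hω f
  refine ((ProbabilityMeasure.tendsto_iff_forall_integral_tendsto.1 (hω.tendsto hF)) f).congr' ?_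
  filter_upwards [eventually_pos_of_tendsto_ratio hc hpc] with n hn
  rw [coe_probESD _ hn]

end Spectral

/-! ### Existence of an admissible model -/

section Existence

/-- The symmetric distribution on `{1, -1}`. -/
def signLaw : Measure ℂ := (2 : ℝ≥0∞)⁻¹ • (Measure.dirac 1 + Measure.dirac (-1))

instance : IsProbabilityMeasure signLaw := by
  refine ⟨?_⟩
  simp only [signLaw, Measure.smul_apply, Measure.add_apply, measure_univ, smul_eq_mul,
    one_add_one_eq_two]
  exact ENNReal.inv_mul_cancel (by norm_num) (by norm_num)

theorem integral_signLaw {E : Type*} [NormedAddCommGroup E] [NormedSpace ℝ E] [CompleteSpace E]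
    (f : ℂ → E) : ∫ e, f e ∂signLaw = (2 : ℝ)⁻¹ • (f 1 + f (-1)) := by
  rw [signLaw, integral_smul_measure, integral_add_measure (integrable_dirac (by simp))
    (integrable_dirac (by simp)), integral_dirac, integral_dirac]
  simp

/-- Data matrices with independent random signs as entries. -/
def signArray (p : ℕ → ℕ) (n : ℕ) (k : Fin 2) (ω : Fin 2 × ℕ × ℕ → ℂ) :
    Matrix (Fin (p n)) (Fin n) ℂ :=
  fun i j => ω (k, i, j)

theorem isInnovationArray_signArray (p : ℕ → ℕ) :
    IsInnovationArray (Measure.infinitePi fun _ : Fin 2 × ℕ × ℕ => signLaw) p (signArray p) where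
  measurable_entry n k i j := measurable_pi_apply _
  indep n := by
    have h : iIndepFun (fun (e : Fin 2 × ℕ × ℕ) (ω : Fin 2 × ℕ × ℕ → ℂ) => ω e)
        (Measure.infinitePi fun _ : Fin 2 × ℕ × ℕ => signLaw) :=
      iIndepFun_infinitePi (X := fun _ e => e) fun _ => measurable_id
    refine h.precomp (g := fun e : Fin 2 × Fin (p n) × Fin n => (e.1, (e.2.1 : ℕ), (e.2.2 : ℕ))) ?_
    rintro ⟨a, b, c⟩ ⟨a', b', c'⟩ h
    simp only [Prod.mk.injEq] at h
    obtain ⟨rfl, h2, h3⟩ := h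
    rw [Fin.ext h2, Fin.ext h3]
  mean_zero n k i j := by
    have hmp := measurePreserving_eval_infinitePi (fun _ : Fin 2 × ℕ × ℕ => signLaw)
      (k, (i : ℕ), (j : ℕ))
    have h := integral_map (μ := Measure.infinitePi fun _ : Fin 2 × ℕ × ℕ => signLaw)
      hmp.measurable.aemeasurable (f := fun e : ℂ => e) (by fun_prop)
    rw [hmp.map_eq, integral_signLaw] at h
    exact h.symm.trans (by simp)
  variance_one n k i j := by
    have hmp := measurePreserving_eval_infinitePi (fun _ : Fin 2 × ℕ × ℕ => signLaw)
      (k, (i : ℕ), (j : ℕ))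
    have h := integral_map (μ := Measure.infinitePi fun _ : Fin 2 × ℕ × ℕ => signLaw)
      hmp.measurable.aemeasurable (f := fun e : ℂ => ‖e‖ ^ 2) (by fun_prop)
    rw [hmp.map_eq, integral_signLaw] at h
    refine h.symm.trans ?_
    norm_num
  moment_bound := by
    refine ⟨1, one_pos, 1, fun n k i j => ?_⟩
    have hmp := measurePreserving_eval_infinitePi (fun _ : Fin 2 × ℕ × ℕ => signLaw)
      (k, (i : ℕ), (j : ℕ))
    have h := lintegral_map (μ := Measure.infinitePi fun _ : Fin 2 × ℕ × ℕ => signLaw)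
      (f := fun e : ℂ => ‖e‖ₑ ^ (2 + 1 : ℝ)) (by fun_prop) hmp.measurable
    rw [hmp.map_eq] at h
    refine h.symm.le.trans ?_
    rw [signLaw, lintegral_smul_measure, lintegral_add_measure, lintegral_dirac, lintegral_dirac]
    simp only [enorm_one, enorm_neg, ENNReal.one_rpow, one_add_one_eq_two, smul_eq_mul,
      ENNReal.coe_one]
    exact (ENNReal.inv_mul_cancel (by norm_num) (by norm_num)).le

/-- The cubic equation is solved by the Stieltjes transform of a probability measure. -/
theorem exists_lsdCubic {c : ℝ} (hc : 0 < c) :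
    ∃ F : ProbabilityMeasure ℝ, ∀ z : ℂ, 0 < z.im → lsdCubic c z (stieltjes F z) = 0 := by
  have hpc : Tendsto (fun n : ℕ => ((⌊c * n⌋₊ : ℕ) : ℝ) / (n : ℝ)) atTop (𝓝 c) :=
    (tendsto_nat_floor_mul_div_atTop hc.le).comp tendsto_natCast_atTop_atTop
  obtain ⟨ω, hω⟩ := ((isInnovationArray_signArray fun n => ⌊c * n⌋₊).ae_isAsymptoticSolution hc
    hpc).exists
  obtain ⟨F, hF, -⟩ := hω.exists_subseq
  exact ⟨F, hF⟩

end Existence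

end CommutatorLSD

end

theorem theorem6p1 (c : ℝ) (hc : 0 < c) :
    ∃ F : ProbabilityMeasure ℝ,
      -- `F` is the limiting spectral distribution of every admissible model with ratio `c`
      (∀ (Ω : Type*) [MeasurableSpace Ω] (P : Measure Ω) [IsProbabilityMeasure P] (p : ℕ → ℕ)
        (Z : (n : ℕ) → Fin 2 → Ω → Matrix (Fin (p n)) (Fin n) ℂ),
        Tendsto (fun n : ℕ => (p n : ℝ) / (n : ℝ)) atTop (𝓝 c) →
        CommutatorLSD.IsInnovationArray P p Z →
        CommutatorLSD.IsLSD P p Z (F : Measure ℝ)) ∧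
      -- its distribution function is differentiable off the origin, with the explicit density
      (∀ x : ℝ, x ≠ 0 →
        HasDerivAt (fun t : ℝ => cdf (F : Measure ℝ) t) (CommutatorLSD.density c x) x) ∧
      -- at the origin the derivative exists exactly when `c < 2`
      (DifferentiableAt ℝ (fun t : ℝ => cdf (F : Measure ℝ) t) 0 ↔ c < 2) ∧
      (c < 2 → HasDerivAt (fun t : ℝ => cdf (F : Measure ℝ) t)
        (1 / (Real.pi * √(2 * c - c ^ 2))) 0) ∧
      -- the density is continuous wherever it exists
      (∀ x : ℝ, DifferentiableAt ℝ (fun t : ℝ => cdf (F : Measure ℝ) t) x →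
        ContinuousAt (deriv fun t : ℝ => cdf (F : Measure ℝ) t) x) := by
  obtain ⟨F, hF⟩ := CommutatorLSD.exists_lsdCubic hc
  refine ⟨F, fun Ω _ P _ p Z hpc hZ => CommutatorLSD.isLSD_of_lsdCubic hc hF hZ hpc,
    fun x hx => ?_, CommutatorLSD.differentiableAt_cdf_zero_iff hc hF,
    fun hc2 => CommutatorLSD.hasDerivAt_cdf_zero hc hc2 hF,
    fun x hx => CommutatorLSD.continuousAt_deriv_cdf hc hF hx⟩
  rw [CommutatorLSD.density_eq_formula hc hx]
  exact CommutatorLSD.hasDerivAt_cdf hc hF hx
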